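/- Let $R$ be a commutative ring with $1$ and a fixed invertible element $q^{1/2}$ such that $\alpha=q+q^{-1}$ is invertible; put $\overline q=q^{-1}$, $\beta=\alpha^{-1}$. Let $\Sigma=\Sigma_{0,n+1}$ be a large disk in $\mathbb R^2$ punctured at $\mathsf p_k=(k,0)$, $1\le k\le n$, and let $\mathcal S_n=\mathcal S(\Sigma;R)$ be its Kauffman bracket skein algebra: the $R$-module generated by framed links in $\Sigma\times(0,1)$ up to isotopy (given by link diagrams in $\Sigma$ with vertical framing) modulo the skein relations (a crossing equals $q^{1/2}$ times the smoothing joining the two regions swept out by turning the overcrossing strand counterclockwise, plus $q^{-1/2}$ times the other smoothing; a trivial circle equals $-\alpha$), with $L_1L_2$ given by drawing $L_1$ above $L_2$. For $S\subseteq\{1,\dots,n\}$ let $t_S$ be the simple closed curve enclosing exactly the punctures in $S$ and disjoint from the rays $\{(k,y):y>0\}$, $k\notin S$; write $t_{i_1\cdots i_r}=t_{\{i_1,\dots,i_r\}}$. For distinct indices put $$s_{ij}=t_{ij}+\beta t_it_j,\quad s_{ii}=\alpha-\beta t_i^2,\quad s_{ijk}=t_{ijk}+\beta(t_it_{jk}+t_jt_{ik}+t_kt_{ij})+2\beta^2t_it_jt_k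 .$$ Indices $(i_1,\dots,i_m)$ are in cyclic order if some cyclic rotation of them is strictly increasing. Then the following identities hold in $\mathcal S_n$. For $(i_1,\dots,i_6)$ in cyclic order, \begin{align*} &s_{i_2i_4}s_{i_3i_6}s_{i_1i_5}-s_{i_1i_3}s_{i_2i_5}s_{i_4i_6}\\ =\ &\alpha(s_{i_2i_3i_4}s_{i_1i_5i_6}-s_{i_1i_2i_3}s_{i_4i_5i_6})+(q^2-\overline{q}^2)(s_{i_2i_3}s_{i_4i_6}s_{i_1i_5}-s_{i_5i_6}s_{i_1i_3}s_{i_2i_4})\\ &+q^2(s_{i_1i_6}s_{i_2i_4}s_{i_3i_5}-s_{i_1i_2}s_{i_3i_5}s_{i_4i_6})+\overline{q}^2(s_{i_3i_4}s_{i_1i_5}s_{i_2i_6}-s_{i_4i_5}s_{i_2i_6}s_{i_1i_3})\\ &+\overline{q}^4(s_{i_1i_2}s_{i_3i_6}s_{i_4i_5}-s_{i_1i_6}s_{i_2i_5}s_{i_3i_4})+(q^2-\overline{q}^2)^2(s_{i_1i_2}s_{i_3i_4}s_{i_5i_6}-s_{i_1i_6}s_{i_2i_3}s_{i_4i_5}),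 \end{align*} \begin{align*} &s_{i_1i_4}s_{i_2i_5}s_{i_3i_6}-(q^3+\overline{q}^3)s_{i_1i_2i_3}s_{i_4i_5i_6}\\ =\ &\overline{q}^2(s_{i_2i_4}s_{i_3i_6}s_{i_1i_5}+s_{i_3i_5}s_{i_1i_4}s_{i_2i_6})-s_{i_3i_4}s_{i_1i_5}s_{i_2i_6}-s_{i_1i_6}s_{i_2i_4}s_{i_3i_5}+\overline{q}^6s_{i_1i_6}s_{i_2i_5}s_{i_3i_4}\\ &+(1-\overline{q}^2)\big(s_{i_1i_3}s_{i_2i_5}s_{i_4i_6}+s_{i_4i_5}s_{i_2i_6}s_{i_1i_3}-q^2s_{i_1i_2}s_{i_3i_5}s_{i_4i_6}-\overline{q}^2s_{i_2i_3}s_{i_4i_6}s_{i_1i_5}\big)\\ &+(q^4-2q^2+2\overline{q}^2-\overline{q}^6)s_{i_1i_2}s_{i_3i_4}s_{i_5i_6}+(2-q^2-\overline{q}^4)(s_{i_5i_6}s_{i_1i_3}s_{i_2i_4}+s_{i_1i_6}s_{i_2i_3}s_{i_4i_5})\\ &+(q^2+\overline{q}^4-2\overline{q}^2)(s_{i_1i_4}s_{i_2i_3}s_{i_5i_6}+s_{i_1i_2}s_{i_3i_6}s_{i_4i_5}),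 \end{align*} \begin{align*} \alpha s_{i_1i_2i_4}s_{i_3i_5i_6}&=s_{i_1i_3}s_{i_2i_5}s_{i_4i_6}+\overline{q}^2(s_{i_3i_4}s_{i_1i_5}s_{i_2i_6}-s_{i_2i_3}s_{i_4i_6}s_{i_1i_5}-s_{i_4i_5}s_{i_2i_6}s_{i_1i_3})\\ &\quad+(2-\overline{q}^4)s_{i_1i_6}s_{i_2i_3}s_{i_4i_5}-\overline{q}^4s_{i_1i_6}s_{i_3i_4}s_{i_2i_5}\\ &\quad+(q^2-1)\big(\alpha s_{i_1i_2i_3}s_{i_4i_5i_6}+(q^2-\overline{q}^2-1)s_{i_1i_2}s_{i_3i_4}s_{i_5i_6}-s_{i_1i_2}s_{i_3i_5}s_{i_4i_6}\\ &\quad-s_{i_5i_6}s_{i_1i_3}s_{i_2i_4}-\overline{q}^4(s_{i_1i_2}s_{i_3i_6}s_{i_4i_5}+s_{i_5i_6}s_{i_1i_4}s_{i_2i_3})\big), \end{align*} \begin{align*} \alpha s_{i_1i_3i_5}s_{i_2i_4i_6}&=q^2s_{i_1i_4}s_{i_2i_5}s_{i_3i_6}+(q^2+q^4-q^6)s_{i_1i_2}s_{i_3i_4}s_{i_5i_6}-s_{i_1i_6}s_{i_2i_5}s_{i_3i_4}\\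 &\quad+(2q^4-2q^2+2\overline{q}^2-1)s_{i_1i_6}s_{i_2i_3}s_{i_4i_5}+(1-\overline{q}^2-q^4)(s_{i_1i_4}s_{i_2i_3}s_{i_5i_6}+s_{i_1i_2}s_{i_3i_6}s_{i_4i_5})\\ &\quad+(1-q^2)\big(q^2\alpha s_{i_1i_2i_3}s_{i_4i_5i_6}-q^2(s_{i_1i_2}s_{i_3i_5}s_{i_4i_6}+s_{i_5i_6}s_{i_1i_3}s_{i_2i_4})+s_{i_1i_3}s_{i_2i_5}s_{i_4i_6}\\ &\quad+s_{i_2i_3}s_{i_4i_6}s_{i_1i_5}+s_{i_4i_5}s_{i_2i_6}s_{i_1i_3}-\overline{q}\alpha s_{i_3i_4}s_{i_1i_5}s_{i_2i_6}\big). \end{align*} For $(i_1,\dots,i_5)$ in cyclic order, \begin{align*} \alpha s_{i_1i_2i_3}s_{i_3i_4i_5}&=s_{i_1i_3}s_{i_2i_4}s_{i_3i_5}+\overline{q}^2(s_{i_1i_4}s_{i_2i_5}s_{i_3i_3}-s_{i_1i_3}s_{i_2i_5}s_{i_3i_4}-s_{i_1i_4}s_{i_2i_3}s_{i_3i_5})\\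 &\quad+\overline{q}^4(s_{i_1i_5}s_{i_2i_3}s_{i_3i_4}-s_{i_1i_5}s_{i_2i_4}s_{i_3i_3})+(1-q^2)s_{i_3i_3}s_{i_1i_2}s_{i_4i_5}\\ &\quad+(\overline{q}^2-1)t_{i_3}\big(s_{i_1i_3}s_{i_2i_4i_5}-\overline{q}^2s_{i_2i_3}s_{i_1i_4i_5}+(q^2-1)s_{i_4i_5}s_{i_1i_2i_3}\big),\\ \alpha s_{i_1i_3i_5}s_{i_2i_3i_4}&=s_{i_1i_3}s_{i_2i_5}s_{i_3i_4}-s_{i_2i_5}s_{i_1i_4}s_{i_3i_3}+s_{i_3i_5}s_{i_1i_4}s_{i_2i_3}-q^{2}s_{i_3i_5}s_{i_1i_2}s_{i_3i_4}\\ &\quad+\overline{q}^2(s_{i_4i_5}s_{i_1i_2}s_{i_3i_3}-s_{i_4i_5}s_{i_1i_3}s_{i_2i_3})+(1-\overline{q}^2)s_{i_3i_3}s_{i_1i_5}s_{i_2i_4}\\ &\quad+(q^2-1)t_{i_3}\big(s_{i_3i_4}s_{i_1i_2i_5}-\overline{q}^2s_{i_2i_3}s_{i_1i_4i_5}+(\overline{q}^2-1)s_{i_1i_5}s_{i_2i_3i_4}\big),\\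 \alpha s_{i_1i_3i_4}s_{i_2i_3i_5}&=s_{i_1i_3}s_{i_2i_4}s_{i_3i_5}+q^2(s_{i_3i_3}s_{i_1i_2}s_{i_4i_5}-s_{i_1i_2}s_{i_3i_4}s_{i_3i_5}-s_{i_1i_3}s_{i_2i_3}s_{i_4i_5})\\ &\quad+\overline{q}^2(s_{i_1i_5}s_{i_2i_3}s_{i_3i_4}-s_{i_3i_3}s_{i_1i_5}s_{i_2i_4})+(1-\overline{q}^2)s_{i_3i_3}s_{i_1i_4}s_{i_2i_5}\\ &\quad+(1-\overline{q}^2)t_{i_3}\big(s_{i_2i_3}s_{i_1i_4i_5}+q^2s_{i_4i_5}s_{i_1i_2i_3}+s_{i_1i_3i_4}s_{i_2i_5}\big). \end{align*} For $(i_1,\dots,i_4)$ in cyclic order, \begin{align*} \alpha s_{i_1i_2i_3}s_{i_2i_3i_4}&=\overline{q}^2(s_{i_1i_2}s_{i_2i_3}s_{i_3i_4}-s_{i_1i_4}s_{i_2i_3}^2+s_{i_2i_2}s_{i_3i_3}s_{i_1i_4}-s_{i_3i_3}s_{i_1i_2}s_{i_2i_4})\\ &\quad+s_{i_2i_3}s_{i_1i_3}s_{i_2i_4}+(1-q^2-\overline{q}^2)s_{i_2i_2}s_{i_1i_3}s_{i_3i_4}\\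 &\quad+(q^2-1)t_{i_2}\big((1-q^2)s_{i_3i_4}s_{i_1i_2i_3}-\overline{q}^2s_{i_2i_3}s_{i_1i_3i_4}+(q-\overline{q})^2s_{i_3i_3}s_{i_1i_2i_4}\big)\\ &\quad+(1-\overline{q}^2)t_{i_3}(s_{i_1i_2}s_{i_2i_3i_4}-s_{i_2i_2}s_{i_1i_3i_4})\\ &\quad+(q^2-1)\beta t_{i_2}t_{i_3}\big((q-\overline{q})^2(s_{i_1i_3}s_{i_2i_4}-\overline{q}^2s_{i_1i_4}s_{i_2i_3})+(3q^2-q^4-2)s_{i_1i_2}s_{i_3i_4}\big),\\ \alpha s_{i_1i_2i_3}s_{i_1i_3i_4}&=(q^4-q^2+1)s_{i_1i_1}s_{i_2i_3}s_{i_3i_4}-s_{i_1i_1}s_{i_2i_4}s_{i_3i_3}+s_{i_1i_3}^2s_{i_2i_4}\\ &\quad-q^4s_{i_1i_2}s_{i_1i_3}s_{i_3i_4}+s_{i_1i_2}s_{i_1i_4}s_{i_3i_3}-\overline{q}^2s_{i_1i_3}s_{i_1i_4}s_{i_2i_3}\\ &\quad+(q^2-1)t_{i_1}\big(\overline{q}^2s_{i_2i_3}s_{i_1i_3i_4}+q^4s_{i_3i_4}s_{i_1i_2i_3}+(q^2-q^4-\overline{q}^2)s_{i_3i_3}s_{i_1i_2i_4}\big)\\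 &\quad+(q^2-1)t_{i_3}(s_{i_1i_1}s_{i_2i_3i_4}-s_{i_1i_2}s_{i_1i_3i_4})\\ &\quad-(q^2-1)^2\beta t_{i_1}t_{i_3}\big((q^2-\overline{q}^2)(s_{i_1i_3}s_{i_2i_4}-\overline{q}^2s_{i_1i_4}s_{i_2i_3})+(1+q^2-q^4)s_{i_1i_2}s_{i_3i_4}\big). \end{align*} For $(i_1,i_2,i_3)$ in cyclic order, \begin{align*} \alpha s_{i_1i_2i_3}^2&=\overline{q}\alpha s_{i_1i_2}s_{i_2i_3}s_{i_1i_3}+s_{i_1i_1}s_{i_2i_2}s_{i_3i_3}-q^2s_{i_1i_1}s_{i_2i_3}^2-\overline{q}^2s_{i_2i_2}s_{i_1i_3}^2-\overline{q}^2s_{i_3i_3}s_{i_1i_2}^2\\ &\quad+(\overline{q}^2-1)\big(q^2t_{i_1}s_{i_2i_3}-t_{i_2}s_{i_1i_3}-t_{i_3}s_{i_1i_2}-(q-\overline{q})^2\beta t_{i_1}t_{i_2}t_{i_3}\big)s_{i_1i_2i_3}\\ &\quad+(q-\overline{q})^2\beta\big(t_{i_2}t_{i_3}s_{i_1i_1}s_{i_2i_3}+t_{i_1}t_{i_3}s_{i_2i_2}s_{i_1i_3}-\overline{q}^2t_{i_1}t_{i_2}s_{i_3i_3}s_{i_1i_2}+\overline{q}\alpha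 t_{i_1}t_{i_2}s_{i_2i_3}s_{i_1i_3}\big). \end{align*} The mirrors of these identities, in which $q$ and $\overline q$ are interchanged and all products are reversed, hold as well. Finally let $q=1$. For all $a_1<a_2<a_3$ and $b_1<b_2<b_3$ in $\{1,\dots,n\}$, the classical type I relation $$2s_{a_1a_2a_3}s_{b_1b_2b_3}=\det\big[(s_{a_ib_j})_{i,j=1}^3\big]$$ is recovered from one of the identities above: for arbitrary elements $t_S$ of a commutative $R$-algebra, with $s_{ij},s_{ii},s_{ijk}$ defined from them by the formulas above, the difference of the two sides of one of these identities is, up to sign, the difference of the two sides of the classical relation. In particular the classical relations hold in $\mathcal S_n$ when $q=1$, the determinant being expanded as $\sum_\sigma\operatorname{sgn}(\sigma)\,s_{a_1b_{\sigma(1)}}s_{a_2b_{\sigma(2)}}s_{a_3b_{\sigma(3)}}$. -/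

import Mathlib

/-!
# The Kauffman bracket skein algebra of a planar surface

The planar surface `Σ_{0,n+1}` is a large disk in the plane with the `n` points `(k, 0)` removed
(in Lean the `k`-th puncture is the index `k : Fin n`, starting from `0`).  A framed link in
`Σ × (0,1)`, with vertical framing, is given by a link diagram in `Σ`.  A generic diagram is read
from left to right by a moving vertical line.  It is recorded as the list of the events that occur:
births and deaths of two adjacent strands, crossings of two adjacent strands, and the passage of the
moving line through a puncture.  The strands that meet the line are numbered `0, 1, 2, …` from
bottom to top.
-/

/-- The four kinds of events. -/
inductive Event where
  /-- two adjacent strands are born (a local minimum of the first coordinate) -/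
  | birth
  /-- two adjacent strands merge and disappear (a local maximum of the first coordinate) -/
  | death
  /-- two adjacent strands cross; `upOver = true` says that the strand that goes upward (from left
  to right) is the overcrossing strand, `false` says that it is the undercrossing one -/
  | cross (upOver : Bool)
  /-- the line passes through the next puncture -/
  | punct

namespace Event

/-- Number of strands on the left that take part in the event. -/
def ins : Event → ℕ
  | birth => 0
  | death => 2
  | cross _ => 2
  | punct => 0

/-- Number of strands on the right that take part in the event. -/
def outs : Event → ℕ
  | birth => 2
  | death => 0
  | cross _ => 2
  | punct => 0

/-- Number of punctures passed. -/
def punctures : Event → ℕ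
  | punct => 1
  | _ => 0

end Event

/-- An event together with its position: exactly `pos` strands pass below it. -/
structure Slice where
  kind : Event
  pos : ℕ

namespace Slice

/-- The birth of strands number `i` and `i + 1`. -/
abbrev birth (i : ℕ) : Slice := ⟨.birth, i⟩

/-- Strands number `i` and `i + 1` merge. -/
abbrev death (i : ℕ) : Slice := ⟨.death, i⟩

/-- Strands number `i` and `i + 1` cross. -/
abbrev cross (i : ℕ) (upOver : Bool) : Slice := ⟨.cross upOver, i⟩

/-- The next puncture is passed; it has exactly `i` strands below it. -/
abbrev punct (i : ℕ) : Slice := ⟨.punct, i⟩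

end Slice

/-- `IsTangle m k w`: the list of slices `w` can be performed starting with `m` strands, it ends
with no strand, and it passes `k` punctures. -/
inductive IsTangle : ℕ → ℕ → List Slice → Prop
  | nil : IsTangle 0 0 []
  | cons (e : Event) (i j k : ℕ) (w : List Slice) (h : IsTangle (i + e.outs + j) k w) :
      IsTangle (i + e.ins + j) (e.punctures + k) (⟨e, i⟩ :: w)

/-- Link diagrams in the disk with `n` punctures. -/
def LinkDiagram (n : ℕ) : Type := {w : List Slice // IsTangle 0 n w}

open Slice in
/-- The local moves that generate isotopy of framed links, on diagrams with vertical framing: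
planar isotopy (rel punctures), and the framed Reidemeister moves. -/
inductive Move : List Slice → List Slice → Prop
  /-- Two events at disjoint positions, `a` below and `b` above, change their horizontal order.
  The punctures are fixed points of the plane, so two of them are never interchanged. -/
  | interchange (a b : Event) (i d : ℕ) (hab : ¬ (a = .punct ∧ b = .punct)) :
      Move [⟨b, i + a.ins + d⟩, ⟨a, i⟩] [⟨a, i⟩, ⟨b, i + a.outs + d⟩]
  /-- straightening a strand -/
  | zigzag (i : ℕ) : Move [birth i, death (i + 1)] []
  | zagzig (i : ℕ) : Move [birth (i + 1), death i] []
  /-- a strand is pulled over or under a minimum, or a maximum -/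
  | slideBirth (i : ℕ) (b : Bool) :
      Move [birth i, cross (i + 1) b] [birth (i + 1), cross i (!b)]
  | slideDeath (i : ℕ) (b : Bool) :
      Move [cross (i + 1) b, death i] [cross i (!b), death (i + 1)]
  /-- framed first Reidemeister move: the two kinks of equal writhe are isotopic -/
  | reidemeisterI (i : ℕ) (b : Bool) :
      Move [birth (i + 1), cross i b, death (i + 1)] [birth i, cross (i + 1) b, death i]
  /-- second Reidemeister move -/
  | reidemeisterII (i : ℕ) (b : Bool) : Move [cross i b, cross i (!b)] []
  /-- third Reidemeister move; the hypothesis says that the three strands lie one above the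
  other -/
  | reidemeisterIII (i : ℕ) (a b c : Bool) (h : a = c → b = a) :
      Move [cross i a, cross (i + 1) b, cross i c] [cross (i + 1) c, cross i b, cross (i + 1) a]

open Slice in
/-- `Superposed c w u v`: the tangle diagram `w` is a superposition of `u` above `v`.
The list `c` tells, from bottom to top, which of the strands at the start belong to the upper
diagram `u` (`true`) and which belong to the lower diagram `v` (`false`).  Forgetting the lower
strands of `w` gives `u`, forgetting the upper ones gives `v`, and wherever an upper strand and a
lower strand of `w` cross, the upper one is the overcrossing strand. -/
inductive Superposed : List Bool → List Slice → List Slice → List Slice → Prop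
  | nil : Superposed [] [] [] []
  | birthUpper (l r : List Bool) (w u v : List Slice)
      (h : Superposed (l ++ true :: true :: r) w u v) :
      Superposed (l ++ r) (birth l.length :: w) (birth (l.count true) :: u) v
  | birthLower (l r : List Bool) (w u v : List Slice)
      (h : Superposed (l ++ false :: false :: r) w u v) :
      Superposed (l ++ r) (birth l.length :: w) u (birth (l.count false) :: v)
  | deathUpper (l r : List Bool) (w u v : List Slice) (h : Superposed (l ++ r) w u v) :
      Superposed (l ++ true :: true :: r) (death l.length :: w) (death (l.count true) :: u) v
  | deathLower (l r : List Bool) (w u v : List Slice) (h : Superposed (l ++ r) w u v) :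
      Superposed (l ++ false :: false :: r) (death l.length :: w) u (death (l.count false) :: v)
  | crossUpper (b : Bool) (l r : List Bool) (w u v : List Slice)
      (h : Superposed (l ++ true :: true :: r) w u v) :
      Superposed (l ++ true :: true :: r) (cross l.length b :: w) (cross (l.count true) b :: u) v
  | crossLower (b : Bool) (l r : List Bool) (w u v : List Slice)
      (h : Superposed (l ++ false :: false :: r) w u v) :
      Superposed (l ++ false :: false :: r) (cross l.length b :: w) u (cross (l.count false) b :: v)
  /-- an upper strand goes upward and crosses over a lower one -/
  | crossMixedUp (l r : List Bool) (w u v : List Slice)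
      (h : Superposed (l ++ false :: true :: r) w u v) :
      Superposed (l ++ true :: false :: r) (cross l.length true :: w) u v
  /-- a lower strand goes upward and crosses under an upper one -/
  | crossMixedDown (l r : List Bool) (w u v : List Slice)
      (h : Superposed (l ++ true :: false :: r) w u v) :
      Superposed (l ++ false :: true :: r) (cross l.length false :: w) u v
  | punct (l r : List Bool) (w u v : List Slice) (h : Superposed (l ++ r) w u v) :
      Superposed (l ++ r) (punct l.length :: w) (punct (l.count true) :: u)
        (punct (l.count false) :: v)

open Slice in
/-- The defining relations of the skein algebra among (linear combinations of products of) link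
diagrams; `r` is the invertible element `q^{1/2}`. -/
inductive SkeinRel {R : Type*} [CommRing R] (r : Rˣ) (n : ℕ) :
    FreeAlgebra R (LinkDiagram n) → FreeAlgebra R (LinkDiagram n) → Prop
  /-- isotopic diagrams are equal -/
  | isotopy (x y u v : List Slice) (D E : LinkDiagram n) (h : Move x y)
      (hD : D.1 = u ++ x ++ v) (hE : E.1 = u ++ y ++ v) :
      SkeinRel r n (FreeAlgebra.ι R D) (FreeAlgebra.ι R E)
  /-- First skein relation: a crossing is `q^{1/2}` times the smoothing that joins the two regions
  swept out by turning the overcrossing strand counterclockwise, plus `q^{-1/2}` times the other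
  smoothing.  The two constructors treat the two positions of a crossing relative to the
  vertical direction. -/
  | crossUp (i : ℕ) (u v : List Slice) (D E F : LinkDiagram n)
      (hD : D.1 = u ++ [cross i true] ++ v) (hE : E.1 = u ++ [death i, birth i] ++ v)
      (hF : F.1 = u ++ v) :
      SkeinRel r n (FreeAlgebra.ι R D)
        ((r : R) • FreeAlgebra.ι R E + ((r⁻¹ : Rˣ) : R) • FreeAlgebra.ι R F)
  | crossDown (i : ℕ) (u v : List Slice) (D E F : LinkDiagram n)
      (hD : D.1 = u ++ [cross i false] ++ v) (hE : E.1 = u ++ [death i, birth i] ++ v)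
      (hF : F.1 = u ++ v) :
      SkeinRel r n (FreeAlgebra.ι R D)
        ((r : R) • FreeAlgebra.ι R F + ((r⁻¹ : Rˣ) : R) • FreeAlgebra.ι R E)
  /-- Second skein relation: a trivial circle is `-(q + q⁻¹)`. -/
  | circle (i : ℕ) (u v : List Slice) (D E : LinkDiagram n)
      (hD : D.1 = u ++ [birth i, death i] ++ v) (hE : E.1 = u ++ v) :
      SkeinRel r n (FreeAlgebra.ι R D)
        (-((r ^ 2 : Rˣ) + ((r ^ 2)⁻¹ : Rˣ) : R) • FreeAlgebra.ι R E)
  /-- the empty link is the unit -/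
  | empty (D : LinkDiagram n) (hD : D.1 = List.replicate n (punct 0)) :
      SkeinRel r n (FreeAlgebra.ι R D) 1
  /-- the product of two links is given by drawing the first one above the second one -/
  | superposition (D E F : LinkDiagram n) (h : Superposed [] D.1 E.1 F.1) :
      SkeinRel r n (FreeAlgebra.ι R D) (FreeAlgebra.ι R E * FreeAlgebra.ι R F)

/-- The Kauffman bracket skein algebra `S(Σ_{0,n+1}; R)` with `q^{1/2} = r`.  Since a product of
diagrams is identified with a superposition of them, it is spanned by link diagrams as a module. -/
abbrev SkeinAlgebra {R : Type*} [CommRing R] (r : Rˣ) (n : ℕ) : Type _ :=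
  RingQuot (SkeinRel r n)

namespace SkeinAlgebra

open Slice

/-- The class of a link diagram in the skein algebra. -/
noncomputable def ofDiagram {R : Type*} [CommRing R] (r : Rˣ) {n : ℕ} (D : LinkDiagram n) :
    SkeinAlgebra r n :=
  RingQuot.mkAlgHom R (SkeinRel r n) (FreeAlgebra.ι R D)

/-- The simple closed curve around the punctures in `S` that passes below all the other ones: it
crosses the vertical ray above a puncture (once) if and only if the puncture belongs to `S`. -/
def curveWord (n : ℕ) (S : Finset (Fin n)) : List Slice :=
  birth 0 :: ((List.finRange n).map fun k => punct (if k ∈ S then 1 else 2)) ++ [death 0]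

theorem isTangle_curve_aux {n : ℕ} (S : Finset (Fin n)) (L : List (Fin n)) :
    IsTangle 2 L.length
      ((L.map fun k => punct (if k ∈ S then 1 else 2)) ++ [death 0]) := by
  induction L with
  | nil => exact IsTangle.cons .death 0 0 0 [] IsTangle.nil
  | cons k L ih =>
    rw [List.length_cons, Nat.add_comm]
    by_cases hk : k ∈ S
    · rw [List.map_cons, if_pos hk]
      exact IsTangle.cons .punct 1 1 L.length _ ih
    · rw [List.map_cons, if_neg hk]
      exact IsTangle.cons .punct 2 0 L.length _ ih

/-- The simple closed curve `t_S` as a link diagram. -/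
def curve (n : ℕ) (S : Finset (Fin n)) : LinkDiagram n :=
  ⟨curveWord n S, by
    have h := isTangle_curve_aux S (List.finRange n)
    rw [List.length_finRange] at h
    have h' := IsTangle.cons .birth 0 0 n _ h
    rwa [show Event.birth.punctures + n = n from Nat.zero_add n] at h'⟩

/-- The element `t_{i₁⋯i_r}` of the skein algebra, for `S = {i₁, …, i_r}`. -/
noncomputable def t {R : Type*} [CommRing R] (r : Rˣ) {n : ℕ} (S : Finset (Fin n)) :
    SkeinAlgebra r n :=
  ofDiagram r (curve n S)

end SkeinAlgebra

section TypeI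

variable {R A : Type*} [CommRing R] [Ring A] [Algebra R A] {n : ℕ}

/-- `s_{ij} = t_{ij} + β t_i t_j` for `i ≠ j`, and `s_{ii} = α - β t_i²`. -/
def sPair (α β : R) (t : Finset (Fin n) → A) (i j : Fin n) : A :=
  if i = j then algebraMap R A α - β • t {i} ^ 2 else t {i, j} + β • (t {i} * t {j})

/-- `s_{ijk} = t_{ijk} + β (t_i t_{jk} + t_j t_{ik} + t_k t_{ij}) + 2 β² t_i t_j t_k`. -/
def sTriple (β : R) (t : Finset (Fin n) → A) (i j k : Fin n) : A :=
  t {i, j, k} + β • (t {i} * t {j, k} + t {j} * t {i, k} + t {k} * t {i, j})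
    + (2 * β ^ 2) • (t {i} * t {j} * t {k})

/-- A list of indices is in cyclic order if some rotation of it is strictly increasing. -/
def CyclicOrder (l : List (Fin n)) : Prop :=
  ∃ k : ℕ, (l.rotate k).Pairwise (· < ·)

/-- `TypeIRelation q p β t s s₃ x y` says that `x = y` is one of the quantized type I relations,
written with the scalars `q`, `p` (to be `q⁻¹`), `β` (to be `(q + q⁻¹)⁻¹`) and with elements `t i`,
`s i j`, `s₃ i j k` of an arbitrary algebra. -/
inductive TypeIRelation (q p β : R) (t : Fin n → A) (s : Fin n → Fin n → A)
    (s₃ : Fin n → Fin n → Fin n → A) : A → A → Prop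
  /-- six distinct indices, no overlap, first relation -/
  | six₁ (i₁ i₂ i₃ i₄ i₅ i₆ : Fin n) (h : CyclicOrder [i₁, i₂, i₃, i₄, i₅, i₆]) :
      TypeIRelation q p β t s s₃
        (s i₂ i₄ * s i₃ i₆ * s i₁ i₅ - s i₁ i₃ * s i₂ i₅ * s i₄ i₆)
        ((q + p) • (s₃ i₂ i₃ i₄ * s₃ i₁ i₅ i₆ - s₃ i₁ i₂ i₃ * s₃ i₄ i₅ i₆)
          + (q ^ 2 - p ^ 2) • (s i₂ i₃ * s i₄ i₆ * s i₁ i₅ - s i₅ i₆ * s i₁ i₃ * s i₂ i₄)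
          + q ^ 2 • (s i₁ i₆ * s i₂ i₄ * s i₃ i₅ - s i₁ i₂ * s i₃ i₅ * s i₄ i₆)
          + p ^ 2 • (s i₃ i₄ * s i₁ i₅ * s i₂ i₆ - s i₄ i₅ * s i₂ i₆ * s i₁ i₃)
          + p ^ 4 • (s i₁ i₂ * s i₃ i₆ * s i₄ i₅ - s i₁ i₆ * s i₂ i₅ * s i₃ i₄)
          + (q ^ 2 - p ^ 2) ^ 2 • (s i₁ i₂ * s i₃ i₄ * s i₅ i₆ - s i₁ i₆ * s i₂ i₃ * s i₄ i₅))
  /-- six distinct indices, no overlap, second relation -/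
  | six₂ (i₁ i₂ i₃ i₄ i₅ i₆ : Fin n) (h : CyclicOrder [i₁, i₂, i₃, i₄, i₅, i₆]) :
      TypeIRelation q p β t s s₃
        (s i₁ i₄ * s i₂ i₅ * s i₃ i₆ - (q ^ 3 + p ^ 3) • (s₃ i₁ i₂ i₃ * s₃ i₄ i₅ i₆))
        (p ^ 2 • (s i₂ i₄ * s i₃ i₆ * s i₁ i₅ + s i₃ i₅ * s i₁ i₄ * s i₂ i₆)
          - s i₃ i₄ * s i₁ i₅ * s i₂ i₆ - s i₁ i₆ * s i₂ i₄ * s i₃ i₅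
          + p ^ 6 • (s i₁ i₆ * s i₂ i₅ * s i₃ i₄)
          + (1 - p ^ 2) • (s i₁ i₃ * s i₂ i₅ * s i₄ i₆ + s i₄ i₅ * s i₂ i₆ * s i₁ i₃
              - q ^ 2 • (s i₁ i₂ * s i₃ i₅ * s i₄ i₆) - p ^ 2 • (s i₂ i₃ * s i₄ i₆ * s i₁ i₅))
          + (q ^ 4 - 2 * q ^ 2 + 2 * p ^ 2 - p ^ 6) • (s i₁ i₂ * s i₃ i₄ * s i₅ i₆)
          + (2 - q ^ 2 - p ^ 4) • (s i₅ i₆ * s i₁ i₃ * s i₂ i₄ + s i₁ i₆ * s i₂ i₃ * s i₄ i₅)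
          + (q ^ 2 + p ^ 4 - 2 * p ^ 2)
              • (s i₁ i₄ * s i₂ i₃ * s i₅ i₆ + s i₁ i₂ * s i₃ i₆ * s i₄ i₅))
  /-- six distinct indices, no overlap, third relation -/
  | six₃ (i₁ i₂ i₃ i₄ i₅ i₆ : Fin n) (h : CyclicOrder [i₁, i₂, i₃, i₄, i₅, i₆]) :
      TypeIRelation q p β t s s₃
        ((q + p) • (s₃ i₁ i₂ i₄ * s₃ i₃ i₅ i₆))
        (s i₁ i₃ * s i₂ i₅ * s i₄ i₆
          + p ^ 2 • (s i₃ i₄ * s i₁ i₅ * s i₂ i₆ - s i₂ i₃ * s i₄ i₆ * s i₁ i₅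
              - s i₄ i₅ * s i₂ i₆ * s i₁ i₃)
          + (2 - p ^ 4) • (s i₁ i₆ * s i₂ i₃ * s i₄ i₅)
          - p ^ 4 • (s i₁ i₆ * s i₃ i₄ * s i₂ i₅)
          + (q ^ 2 - 1) • ((q + p) • (s₃ i₁ i₂ i₃ * s₃ i₄ i₅ i₆)
              + (q ^ 2 - p ^ 2 - 1) • (s i₁ i₂ * s i₃ i₄ * s i₅ i₆)
              - s i₁ i₂ * s i₃ i₅ * s i₄ i₆ - s i₅ i₆ * s i₁ i₃ * s i₂ i₄
              - p ^ 4 • (s i₁ i₂ * s i₃ i₆ * s i₄ i₅ + s i₅ i₆ * s i₁ i₄ * s i₂ i₃)))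
  /-- six distinct indices, no overlap, fourth relation -/
  | six₄ (i₁ i₂ i₃ i₄ i₅ i₆ : Fin n) (h : CyclicOrder [i₁, i₂, i₃, i₄, i₅, i₆]) :
      TypeIRelation q p β t s s₃
        ((q + p) • (s₃ i₁ i₃ i₅ * s₃ i₂ i₄ i₆))
        (q ^ 2 • (s i₁ i₄ * s i₂ i₅ * s i₃ i₆)
          + (q ^ 2 + q ^ 4 - q ^ 6) • (s i₁ i₂ * s i₃ i₄ * s i₅ i₆)
          - s i₁ i₆ * s i₂ i₅ * s i₃ i₄
          + (2 * q ^ 4 - 2 * q ^ 2 + 2 * p ^ 2 - 1) • (s i₁ i₆ * s i₂ i₃ * s i₄ i₅)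
          + (1 - p ^ 2 - q ^ 4)
              • (s i₁ i₄ * s i₂ i₃ * s i₅ i₆ + s i₁ i₂ * s i₃ i₆ * s i₄ i₅)
          + (1 - q ^ 2) • ((q ^ 2 * (q + p)) • (s₃ i₁ i₂ i₃ * s₃ i₄ i₅ i₆)
              - q ^ 2 • (s i₁ i₂ * s i₃ i₅ * s i₄ i₆ + s i₅ i₆ * s i₁ i₃ * s i₂ i₄)
              + s i₁ i₃ * s i₂ i₅ * s i₄ i₆ + s i₂ i₃ * s i₄ i₆ * s i₁ i₅
              + s i₄ i₅ * s i₂ i₆ * s i₁ i₃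
              - (p * (q + p)) • (s i₃ i₄ * s i₁ i₅ * s i₂ i₆)))
  /-- one overlapping index, first relation -/
  | five₁ (i₁ i₂ i₃ i₄ i₅ : Fin n) (h : CyclicOrder [i₁, i₂, i₃, i₄, i₅]) :
      TypeIRelation q p β t s s₃
        ((q + p) • (s₃ i₁ i₂ i₃ * s₃ i₃ i₄ i₅))
        (s i₁ i₃ * s i₂ i₄ * s i₃ i₅
          + p ^ 2 • (s i₁ i₄ * s i₂ i₅ * s i₃ i₃ - s i₁ i₃ * s i₂ i₅ * s i₃ i₄
              - s i₁ i₄ * s i₂ i₃ * s i₃ i₅)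
          + p ^ 4 • (s i₁ i₅ * s i₂ i₃ * s i₃ i₄ - s i₁ i₅ * s i₂ i₄ * s i₃ i₃)
          + (1 - q ^ 2) • (s i₃ i₃ * s i₁ i₂ * s i₄ i₅)
          + (p ^ 2 - 1) • (t i₃ * (s i₁ i₃ * s₃ i₂ i₄ i₅ - p ^ 2 • (s i₂ i₃ * s₃ i₁ i₄ i₅)
              + (q ^ 2 - 1) • (s i₄ i₅ * s₃ i₁ i₂ i₃))))
  /-- one overlapping index, second relation -/
  | five₂ (i₁ i₂ i₃ i₄ i₅ : Fin n) (h : CyclicOrder [i₁, i₂, i₃, i₄, i₅]) :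
      TypeIRelation q p β t s s₃
        ((q + p) • (s₃ i₁ i₃ i₅ * s₃ i₂ i₃ i₄))
        (s i₁ i₃ * s i₂ i₅ * s i₃ i₄ - s i₂ i₅ * s i₁ i₄ * s i₃ i₃
          + s i₃ i₅ * s i₁ i₄ * s i₂ i₃ - q ^ 2 • (s i₃ i₅ * s i₁ i₂ * s i₃ i₄)
          + p ^ 2 • (s i₄ i₅ * s i₁ i₂ * s i₃ i₃ - s i₄ i₅ * s i₁ i₃ * s i₂ i₃)
          + (1 - p ^ 2) • (s i₃ i₃ * s i₁ i₅ * s i₂ i₄)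
          + (q ^ 2 - 1) • (t i₃ * (s i₃ i₄ * s₃ i₁ i₂ i₅ - p ^ 2 • (s i₂ i₃ * s₃ i₁ i₄ i₅)
              + (p ^ 2 - 1) • (s i₁ i₅ * s₃ i₂ i₃ i₄))))
  /-- one overlapping index, third relation -/
  | five₃ (i₁ i₂ i₃ i₄ i₅ : Fin n) (h : CyclicOrder [i₁, i₂, i₃, i₄, i₅]) :
      TypeIRelation q p β t s s₃
        ((q + p) • (s₃ i₁ i₃ i₄ * s₃ i₂ i₃ i₅))
        (s i₁ i₃ * s i₂ i₄ * s i₃ i₅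
          + q ^ 2 • (s i₃ i₃ * s i₁ i₂ * s i₄ i₅ - s i₁ i₂ * s i₃ i₄ * s i₃ i₅
              - s i₁ i₃ * s i₂ i₃ * s i₄ i₅)
          + p ^ 2 • (s i₁ i₅ * s i₂ i₃ * s i₃ i₄ - s i₃ i₃ * s i₁ i₅ * s i₂ i₄)
          + (1 - p ^ 2) • (s i₃ i₃ * s i₁ i₄ * s i₂ i₅)
          + (1 - p ^ 2) • (t i₃ * (s i₂ i₃ * s₃ i₁ i₄ i₅ + q ^ 2 • (s i₄ i₅ * s₃ i₁ i₂ i₃)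
              + s₃ i₁ i₃ i₄ * s i₂ i₅)))
  /-- two overlapping indices, first relation -/
  | four₁ (i₁ i₂ i₃ i₄ : Fin n) (h : CyclicOrder [i₁, i₂, i₃, i₄]) :
      TypeIRelation q p β t s s₃
        ((q + p) • (s₃ i₁ i₂ i₃ * s₃ i₂ i₃ i₄))
        (p ^ 2 • (s i₁ i₂ * s i₂ i₃ * s i₃ i₄ - s i₁ i₄ * s i₂ i₃ ^ 2
              + s i₂ i₂ * s i₃ i₃ * s i₁ i₄ - s i₃ i₃ * s i₁ i₂ * s i₂ i₄)
          + s i₂ i₃ * s i₁ i₃ * s i₂ i₄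
          + (1 - q ^ 2 - p ^ 2) • (s i₂ i₂ * s i₁ i₃ * s i₃ i₄)
          + (q ^ 2 - 1) • (t i₂ * ((1 - q ^ 2) • (s i₃ i₄ * s₃ i₁ i₂ i₃)
              - p ^ 2 • (s i₂ i₃ * s₃ i₁ i₃ i₄) + (q - p) ^ 2 • (s i₃ i₃ * s₃ i₁ i₂ i₄)))
          + (1 - p ^ 2) • (t i₃ * (s i₁ i₂ * s₃ i₂ i₃ i₄ - s i₂ i₂ * s₃ i₁ i₃ i₄))
          + ((q ^ 2 - 1) * β) • (t i₂ * t i₃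
              * ((q - p) ^ 2 • (s i₁ i₃ * s i₂ i₄ - p ^ 2 • (s i₁ i₄ * s i₂ i₃))
                + (3 * q ^ 2 - q ^ 4 - 2) • (s i₁ i₂ * s i₃ i₄))))
  /-- two overlapping indices, second relation -/
  | four₂ (i₁ i₂ i₃ i₄ : Fin n) (h : CyclicOrder [i₁, i₂, i₃, i₄]) :
      TypeIRelation q p β t s s₃
        ((q + p) • (s₃ i₁ i₂ i₃ * s₃ i₁ i₃ i₄))
        ((q ^ 4 - q ^ 2 + 1) • (s i₁ i₁ * s i₂ i₃ * s i₃ i₄) - s i₁ i₁ * s i₂ i₄ * s i₃ i₃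
          + s i₁ i₃ ^ 2 * s i₂ i₄ - q ^ 4 • (s i₁ i₂ * s i₁ i₃ * s i₃ i₄)
          + s i₁ i₂ * s i₁ i₄ * s i₃ i₃ - p ^ 2 • (s i₁ i₃ * s i₁ i₄ * s i₂ i₃)
          + (q ^ 2 - 1) • (t i₁ * (p ^ 2 • (s i₂ i₃ * s₃ i₁ i₃ i₄)
              + q ^ 4 • (s i₃ i₄ * s₃ i₁ i₂ i₃)
              + (q ^ 2 - q ^ 4 - p ^ 2) • (s i₃ i₃ * s₃ i₁ i₂ i₄)))
          + (q ^ 2 - 1) • (t i₃ * (s i₁ i₁ * s₃ i₂ i₃ i₄ - s i₁ i₂ * s₃ i₁ i₃ i₄))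
          - ((q ^ 2 - 1) ^ 2 * β) • (t i₁ * t i₃
              * ((q ^ 2 - p ^ 2) • (s i₁ i₃ * s i₂ i₄ - p ^ 2 • (s i₁ i₄ * s i₂ i₃))
                + (1 + q ^ 2 - q ^ 4) • (s i₁ i₂ * s i₃ i₄))))
  /-- three overlapping indices -/
  | three (i₁ i₂ i₃ : Fin n) (h : CyclicOrder [i₁, i₂, i₃]) :
      TypeIRelation q p β t s s₃
        ((q + p) • s₃ i₁ i₂ i₃ ^ 2)
        ((p * (q + p)) • (s i₁ i₂ * s i₂ i₃ * s i₁ i₃) + s i₁ i₁ * s i₂ i₂ * s i₃ i₃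
          - q ^ 2 • (s i₁ i₁ * s i₂ i₃ ^ 2) - p ^ 2 • (s i₂ i₂ * s i₁ i₃ ^ 2)
          - p ^ 2 • (s i₃ i₃ * s i₁ i₂ ^ 2)
          + (p ^ 2 - 1) • ((q ^ 2 • (t i₁ * s i₂ i₃) - t i₂ * s i₁ i₃ - t i₃ * s i₁ i₂
              - ((q - p) ^ 2 * β) • (t i₁ * t i₂ * t i₃)) * s₃ i₁ i₂ i₃)
          + ((q - p) ^ 2 * β) • (t i₂ * t i₃ * s i₁ i₁ * s i₂ i₃
              + t i₁ * t i₃ * s i₂ i₂ * s i₁ i₃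
              - p ^ 2 • (t i₁ * t i₂ * s i₃ i₃ * s i₁ i₂)
              + (p * (q + p)) • (t i₁ * t i₂ * s i₂ i₃ * s i₁ i₃)))

end TypeI

/-! Each identity is reduced to a finite computation that is valid over every ring `R` at once.

Reduction to few punctures. An identity involves m = 3, 4, 5 or 6 indices. Their increasing
enumeration induces an algebra homomorphism from the skein algebra with m punctures that sends the
curve around S to the curve around the image of S (`exists_embed`): each puncture is replaced by a
row of punctures, one of which stays in place while the other ones pass above all strands. Hence it
suffices to treat m punctures and the m rotations of 0, …, m - 1.

The computation. Products of curves are evaluated by drawing a curve above a crossingless diagram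
(`superposed_sup`), resolving the crossings (`combRep_run`), and simplifying crossingless diagrams
by isotopies and removal of circles (`rel_pushBirth`, `rel_pushPunct`, `sound_pushDeath`). Only
soundness of the rewriting is proved. Neither uniqueness of normal forms nor linear independence is
needed, since vanishing of all collected coefficients already proves the identity. Coefficients are
polynomials in r over a power of r times a power of q + q⁻¹. A polynomial with natural coefficients
is stored as its value at a large number, from which it can be recovered as long as the sum of its
coefficients stays below that number (`eq_zero_of_isZero`).

Keeping the computation small. The loop t_i is central, because it can be drawn without crossings
inside any diagram (`commute_loop`). Moving puncture i above all strands is an endomorphism fill_i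
with fill_i(t_i) = -α. The projector P_i = id + β t_i fill_i therefore kills t_i y whenever
fill_i(y) = y, and it commutes with multiplication by elements fixed by fill_i. It also turns t_ij
into t_ij + β t_i t_j, and likewise creates the terms of s_ijk that have the factor t_i. So for an
index i that occurs exactly once in each product, it is enough to verify a shorter identity, in
which such terms are left out and multiples of t_i of the above kind are ignored, and then to apply
P_i (`projAll_exprVal`, `projAll_killed`, `exprVal_eq_zero`). Indices that occur twice are expanded
in full.

The mirrors follow because changing all crossings is a homomorphism from the skein algebra with
parameter r⁻¹ to the opposite of the one with parameter r, and it fixes all t_S.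

For q = 1 a crossing may be changed freely, so the t_S commute. Two increasing triples, merged and
placed on a circle, form one of nine patterns up to rotation and exchange of the triples, and each
pattern is the specialization of one quantized relation (`classicalFromQuantized`). Applied in the
commutative subalgebra generated by the t_S, this gives the classical relations. -/

namespace SkeinAlgebra

/-! ### Words of slices and their classes in the skein algebra. -/

open Slice

/-- The number of strands after the slices `w` have been performed, starting with `m` strands. -/
def widthAfter : ℕ → List Slice → Option ℕ
  | m, [] => some m
  | m, s :: w =>
    if s.pos + s.kind.ins ≤ m then widthAfter (m - s.kind.ins + s.kind.outs) w else none

/-- The slices `w` can be performed starting with `m` strands, and end with `k` strands. -/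
abbrev Runs (m : ℕ) (w : List Slice) (k : ℕ) : Prop := widthAfter m w = some k

/-- The number of punctures passed by a list of slices. -/
def numPunct : List Slice → ℕ
  | [] => 0
  | s :: w => s.kind.punctures + numPunct w

@[simp] theorem numPunct_nil : numPunct [] = 0 := rfl

@[simp] theorem numPunct_cons (s : Slice) (w : List Slice) :
    numPunct (s :: w) = s.kind.punctures + numPunct w := rfl

@[simp] theorem numPunct_append (u v : List Slice) :
    numPunct (u ++ v) = numPunct u + numPunct v := by
  induction u with
  | nil => simp
  | cons s u ih => simp [ih, add_assoc]

theorem runs_nil {m k : ℕ} : Runs m [] k ↔ m = k := Option.some_inj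

theorem runs_cons {m k : ℕ} {s : Slice} {w : List Slice} :
    Runs m (s :: w) k ↔
      s.pos + s.kind.ins ≤ m ∧ Runs (m - s.kind.ins + s.kind.outs) w k := by
  unfold Runs
  rw [widthAfter]
  split_ifs with h <;> simp [h]

theorem runs_append {m k : ℕ} {u v : List Slice} :
    Runs m (u ++ v) k ↔ ∃ l, Runs m u l ∧ Runs l v k := by
  induction u generalizing m with
  | nil => simp only [List.nil_append, runs_nil, exists_eq_left']
  | cons s u ih => simp only [List.cons_append, runs_cons, ih, exists_and_left, and_assoc]

theorem Runs.append {m l k : ℕ} {u v : List Slice} (hu : Runs m u l) (hv : Runs l v k) :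
    Runs m (u ++ v) k := runs_append.2 ⟨l, hu, hv⟩

theorem Runs.unique {m k l : ℕ} {w : List Slice} (h : Runs m w k) (h' : Runs m w l) : k = l := by
  unfold Runs at h h'
  simpa [h] using h'

/-- Being a tangle amounts to a width computation and a count of punctures, both of which split
along concatenations; this is what makes cutting and pasting of words possible. -/
theorem isTangle_iff {m k : ℕ} {w : List Slice} :
    IsTangle m k w ↔ Runs m w 0 ∧ numPunct w = k := by
  constructor
  · intro h
    induction h with
    | nil => exact ⟨runs_nil.2 rfl, rfl⟩
    | cons e i j k w h ih =>
      refine ⟨runs_cons.2 ⟨Nat.le_add_right _ _, ?_⟩, by simp [ih.2]⟩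
      have : i + e.ins + j - e.ins + e.outs = i + e.outs + j := by omega
      simpa [this] using ih.1
  · induction w generalizing m k with
    | nil =>
      rintro ⟨h, rfl⟩
      rw [runs_nil] at h
      subst h
      exact .nil
    | cons s w ih =>
      rintro ⟨h, rfl⟩
      obtain ⟨e, i⟩ := s
      rw [runs_cons] at h
      obtain ⟨h1, h2⟩ := h
      obtain ⟨j, rfl⟩ := Nat.exists_eq_add_of_le h1
      rw [numPunct_cons]
      apply IsTangle.cons
      apply ih
      simp only at h2
      rw [show i + e.ins + j - e.ins + e.outs = i + e.outs + j by omega] at h2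
      exact ⟨h2, rfl⟩

theorem _root_.IsTangle.cons' (e : Event) (i j : ℕ) {k m k' m' : ℕ} {w : List Slice}
    (h : IsTangle m' k w) (hm : m = i + e.ins + j) (hm' : m' = i + e.outs + j)
    (hk : k' = e.punctures + k) : IsTangle m k' (⟨e, i⟩ :: w) := by
  subst hm hm' hk
  exact .cons e i j k w h

theorem numPunct_eq_of_move {x y : List Slice} (h : Move x y) : numPunct x = numPunct y := by
  cases h <;> simp [add_comm, Event.punctures]

theorem Runs.of_move {x y : List Slice} (h : Move x y) {m k : ℕ} (hx : Runs m x k) :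
    Runs m y k := by
  cases h <;> simp only [runs_cons, runs_nil, Event.ins, Event.outs] at hx ⊢ <;> omega

variable {R : Type*} [CommRing R] (r : Rˣ) (n : ℕ)

open Classical in
/-- The class of a word in the skein algebra; words that are not link diagrams have class `0`. -/
noncomputable def ofWord (w : List Slice) : SkeinAlgebra r n :=
  if h : IsTangle 0 n w then ofDiagram r ⟨w, h⟩ else 0

variable {r n}

theorem ofWord_eq {w : List Slice} (h : IsTangle 0 n w) :
    ofWord r n w = ofDiagram r ⟨w, h⟩ := dif_pos h

theorem ofWord_eq_zero {w : List Slice} (h : ¬ IsTangle 0 n w) : ofWord r n w = 0 := dif_neg h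

theorem ofWord_val (D : LinkDiagram n) : ofWord r n D.1 = ofDiagram r D := ofWord_eq D.2

theorem rel_of_skeinRel {x y : FreeAlgebra R (LinkDiagram n)} (h : SkeinRel r n x y) :
    RingQuot.mkAlgHom R (SkeinRel r n) x = RingQuot.mkAlgHom R (SkeinRel r n) y :=
  RingQuot.mkAlgHom_rel R h

/-- The continuation v is arbitrary: if it does not complete one side to a link diagram, it does not
complete the other side either, and both classes are 0. Thus the default value 0 of `ofWord` removes
all side conditions on continuations. -/
theorem ofWord_move {u v x y : List Slice} {m k : ℕ} (hu : Runs 0 u m) (hx : Runs m x k)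
    (h : Move x y) : ofWord r n (u ++ (x ++ v)) = ofWord r n (u ++ (y ++ v)) := by
  by_cases hv : IsTangle 0 n (u ++ (x ++ v))
  · have hv' : IsTangle 0 n (u ++ (y ++ v)) := by
      rw [isTangle_iff] at hv ⊢
      simp only [runs_append, numPunct_append] at hv ⊢
      obtain ⟨⟨m', hm', k', hk', h0⟩, hn⟩ := hv
      exact ⟨⟨m', hm', k', Runs.of_move h hk', h0⟩, by rw [← hn, numPunct_eq_of_move h]⟩
    rw [ofWord_eq hv, ofWord_eq hv']
    exact rel_of_skeinRel (.isotopy x y u v _ _ h (by simp) (by simp))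
  · have hv' : ¬ IsTangle 0 n (u ++ (y ++ v)) := by
      rw [isTangle_iff] at hv ⊢
      simp only [runs_append, numPunct_append] at hv ⊢
      rintro ⟨⟨m', hm', k', hk', h0⟩, hn⟩
      obtain rfl := hu.unique hm'
      obtain rfl := (Runs.of_move h hx).unique hk'
      exact hv ⟨⟨m, hu, k, hx, h0⟩, by rw [← hn, numPunct_eq_of_move h]⟩
    rw [ofWord_eq_zero hv, ofWord_eq_zero hv']

theorem isTangle_congr {u v x y : List Slice} {m k : ℕ} (hu : Runs 0 u m) (hx : Runs m x k)
    (hy : Runs m y k) (hn : numPunct x = numPunct y) :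
    IsTangle 0 n (u ++ (x ++ v)) ↔ IsTangle 0 n (u ++ (y ++ v)) := by
  simp only [isTangle_iff, runs_append, numPunct_append, hn]
  refine and_congr_left fun _ => ⟨?_, ?_⟩
  · rintro ⟨m', hm', k', hk', h0⟩
    obtain rfl := hu.unique hm'
    obtain rfl := hx.unique hk'
    exact ⟨_, hu, _, hy, h0⟩
  · rintro ⟨m', hm', k', hk', h0⟩
    obtain rfl := hu.unique hm'
    obtain rfl := hy.unique hk'
    exact ⟨_, hu, _, hx, h0⟩

theorem ofWord_crossUp {u v : List Slice} {m i : ℕ} (hu : Runs 0 u m) (hi : i + 2 ≤ m) :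
    ofWord r n (u ++ cross i true :: v) =
      (r : R) • ofWord r n (u ++ death i :: birth i :: v)
        + ((r⁻¹ : Rˣ) : R) • ofWord r n (u ++ v) := by
  have h1 : Runs m [cross i true] m := by
    simp only [runs_cons, runs_nil, Event.ins, Event.outs]; omega
  have h2 : Runs m [death i, birth i] m := by
    simp only [runs_cons, runs_nil, Event.ins, Event.outs]; omega
  have h3 : Runs m [] m := runs_nil.2 rfl
  have e12 := isTangle_congr (n := n) (v := v) hu h1 h2 rfl
  have e13 := isTangle_congr (n := n) (v := v) hu h1 h3 rfl
  simp only [List.cons_append, List.nil_append] at e12 e13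
  by_cases h : IsTangle 0 n (u ++ cross i true :: v)
  · rw [ofWord_eq h, ofWord_eq (e12.1 h), ofWord_eq (e13.1 h)]
    simpa [ofDiagram] using rel_of_skeinRel (r := r) (.crossUp i u v _ _ _ (by simp) (by simp) (by simp))
  · rw [ofWord_eq_zero h, ofWord_eq_zero (e12.not.1 h), ofWord_eq_zero (e13.not.1 h)]
    simp

theorem ofWord_crossDown {u v : List Slice} {m i : ℕ} (hu : Runs 0 u m) (hi : i + 2 ≤ m) :
    ofWord r n (u ++ cross i false :: v) =
      (r : R) • ofWord r n (u ++ v)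
        + ((r⁻¹ : Rˣ) : R) • ofWord r n (u ++ death i :: birth i :: v) := by
  have h1 : Runs m [cross i false] m := by
    simp only [runs_cons, runs_nil, Event.ins, Event.outs]; omega
  have h2 : Runs m [death i, birth i] m := by
    simp only [runs_cons, runs_nil, Event.ins, Event.outs]; omega
  have h3 : Runs m [] m := runs_nil.2 rfl
  have e12 := isTangle_congr (n := n) (v := v) hu h1 h2 rfl
  have e13 := isTangle_congr (n := n) (v := v) hu h1 h3 rfl
  simp only [List.cons_append, List.nil_append] at e12 e13
  by_cases h : IsTangle 0 n (u ++ cross i false :: v)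
  · rw [ofWord_eq h, ofWord_eq (e12.1 h), ofWord_eq (e13.1 h)]
    simpa [ofDiagram] using rel_of_skeinRel (r := r) (.crossDown i u v _ _ _ (by simp) (by simp) (by simp))
  · rw [ofWord_eq_zero h, ofWord_eq_zero (e12.not.1 h), ofWord_eq_zero (e13.not.1 h)]
    simp

theorem ofWord_circle {u v : List Slice} {m i : ℕ} (hu : Runs 0 u m) (hi : i ≤ m) :
    ofWord r n (u ++ birth i :: death i :: v) =
      (-((r ^ 2 : Rˣ) + ((r ^ 2)⁻¹ : Rˣ) : R)) • ofWord r n (u ++ v) := by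
  have h1 : Runs m [birth i, death i] m := by
    simp only [runs_cons, runs_nil, Event.ins, Event.outs]; omega
  have h3 : Runs m [] m := runs_nil.2 rfl
  have e13 := isTangle_congr (n := n) (v := v) hu h1 h3 rfl
  simp only [List.cons_append, List.nil_append] at e13
  by_cases h : IsTangle 0 n (u ++ birth i :: death i :: v)
  · rw [ofWord_eq h, ofWord_eq (e13.1 h)]
    simpa [ofDiagram] using rel_of_skeinRel (r := r) (.circle i u v _ _ (by simp) (by simp))
  · rw [ofWord_eq_zero h, ofWord_eq_zero (e13.not.1 h)]
    simp

theorem ofWord_empty : ofWord r n (List.replicate n (punct 0)) = 1 := by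
  have h : IsTangle 0 n (List.replicate n (punct 0)) := by
    rw [isTangle_iff]
    constructor
    · induction n with
      | zero => exact runs_nil.2 rfl
      | succ n ih => simpa [List.replicate_succ, runs_cons, Event.ins, Event.outs] using ih
    · induction n with
      | zero => rfl
      | succ n ih => simp [List.replicate_succ, ih, Event.punctures, add_comm]
  rw [ofWord_eq h]
  simpa [ofDiagram] using rel_of_skeinRel (r := r) (.empty _ rfl)

/-! ### Superpositions -/

/-- The upper strands, the lower strands and their union are counted separately at each event, and a
puncture is passed by all three diagrams simultaneously. -/
theorem isTangle_of_superposed {c : List Bool} {w u v : List Slice} (h : Superposed c w u v) :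
    ∃ k, IsTangle c.length k w ∧ IsTangle (c.count true) k u ∧ IsTangle (c.count false) k v := by
  induction h with
  | nil => exact ⟨0, .nil, .nil, .nil⟩
  | birthUpper l r w u v h ih =>
    obtain ⟨k, h1, h2, h3⟩ := ih
    exact ⟨k, h1.cons' .birth l.length r.length (by simp [Event.ins])
      (by simp [Event.outs]; omega) (by simp [Event.punctures]),
      h2.cons' .birth _ (r.count true) (by simp [Event.ins])
      (by simp [Event.outs]; omega) (by simp [Event.punctures]), by simpa using h3⟩
  | birthLower l r w u v h ih =>
    obtain ⟨k, h1, h2, h3⟩ := ih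
    exact ⟨k, h1.cons' .birth l.length r.length (by simp [Event.ins])
      (by simp [Event.outs]; omega) (by simp [Event.punctures]), by simpa using h2,
      h3.cons' .birth _ (r.count false) (by simp [Event.ins])
      (by simp [Event.outs]; omega) (by simp [Event.punctures])⟩
  | deathUpper l r w u v h ih =>
    obtain ⟨k, h1, h2, h3⟩ := ih
    exact ⟨k, h1.cons' .death l.length r.length (by simp [Event.ins]; omega)
      (by simp [Event.outs]) (by simp [Event.punctures]),
      h2.cons' .death _ (r.count true) (by simp [Event.ins]; omega)
      (by simp [Event.outs]) (by simp [Event.punctures]), by simpa using h3⟩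
  | deathLower l r w u v h ih =>
    obtain ⟨k, h1, h2, h3⟩ := ih
    exact ⟨k, h1.cons' .death l.length r.length (by simp [Event.ins]; omega)
      (by simp [Event.outs]) (by simp [Event.punctures]), by simpa using h2,
      h3.cons' .death _ (r.count false) (by simp [Event.ins]; omega)
      (by simp [Event.outs]) (by simp [Event.punctures])⟩
  | crossUpper b l r w u v h ih =>
    obtain ⟨k, h1, h2, h3⟩ := ih
    exact ⟨k, h1.cons' (.cross b) l.length r.length (by simp [Event.ins]; omega)
      (by simp [Event.outs]; omega) (by simp [Event.punctures]),
      h2.cons' (.cross b) _ (r.count true) (by simp [Event.ins]; omega)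
      (by simp [Event.outs]; omega) (by simp [Event.punctures]), h3⟩
  | crossLower b l r w u v h ih =>
    obtain ⟨k, h1, h2, h3⟩ := ih
    exact ⟨k, h1.cons' (.cross b) l.length r.length (by simp [Event.ins]; omega)
      (by simp [Event.outs]; omega) (by simp [Event.punctures]), h2,
      h3.cons' (.cross b) _ (r.count false) (by simp [Event.ins]; omega)
      (by simp [Event.outs]; omega) (by simp [Event.punctures])⟩
  | crossMixedUp l r w u v h ih =>
    obtain ⟨k, h1, h2, h3⟩ := ih
    exact ⟨k, h1.cons' (.cross true) l.length r.length (by simp [Event.ins]; omega)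
      (by simp [Event.outs]; omega) (by simp [Event.punctures]), by simpa using h2,
      by simpa using h3⟩
  | crossMixedDown l r w u v h ih =>
    obtain ⟨k, h1, h2, h3⟩ := ih
    exact ⟨k, h1.cons' (.cross false) l.length r.length (by simp [Event.ins]; omega)
      (by simp [Event.outs]; omega) (by simp [Event.punctures]), by simpa using h2,
      by simpa using h3⟩
  | punct l r w u v h ih =>
    obtain ⟨k, h1, h2, h3⟩ := ih
    exact ⟨1 + k, h1.cons' .punct l.length r.length (by simp [Event.ins])
      (by simp [Event.outs]) rfl, h2.cons' .punct _ (r.count true) (by simp [Event.ins])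
      (by simp [Event.outs]) rfl, h3.cons' .punct _ (r.count false) (by simp [Event.ins])
      (by simp [Event.outs]) rfl⟩

theorem ofWord_superposed {w u v : List Slice} (h : Superposed [] w u v) :
    ofWord r n w = ofWord r n u * ofWord r n v := by
  obtain ⟨k, h1, h2, h3⟩ := isTangle_of_superposed h
  simp only [List.length_nil, List.count_nil] at h1 h2 h3
  by_cases hk : k = n
  · subst hk
    rw [ofWord_eq h1, ofWord_eq h2, ofWord_eq h3]
    simpa [ofDiagram] using rel_of_skeinRel (r := r) (.superposition ⟨w, h1⟩ ⟨u, h2⟩ ⟨v, h3⟩ h)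
  · have hne : ∀ {x}, IsTangle 0 k x → ¬ IsTangle 0 n x := fun hx hx' =>
      hk ((isTangle_iff.1 hx).2.symm.trans (isTangle_iff.1 hx').2)
    rw [ofWord_eq_zero (hne h1), ofWord_eq_zero (hne h2), zero_mul]

/-! ### Congruence of beginnings of words -/

variable (r n) in
/-- The beginnings `u` and `u'` of a word have the same shape, and exchanging the first for the
second one multiplies the class of the word with `c`. -/
def Rel (c : R) (u u' : List Slice) : Prop :=
  (∃ m, Runs 0 u m ∧ Runs 0 u' m) ∧ numPunct u = numPunct u' ∧
    ∀ v, ofWord r n (u ++ v) = c • ofWord r n (u' ++ v)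

theorem Rel.rfl' {u : List Slice} {m : ℕ} (h : Runs 0 u m) : Rel r n 1 u u :=
  ⟨⟨m, h, h⟩, rfl, fun v => by simp⟩

theorem Rel.trans {c d : R} {u u' u'' : List Slice} (h : Rel r n c u u') (h' : Rel r n d u' u'') :
    Rel r n (c * d) u u'' := by
  obtain ⟨⟨m, h1, h2⟩, h3, h4⟩ := h
  obtain ⟨⟨m', h1', h2'⟩, h3', h4'⟩ := h'
  obtain rfl := h2.unique h1'
  exact ⟨⟨m, h1, h2'⟩, h3.trans h3', fun v => by rw [h4, h4', smul_smul]⟩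

theorem Rel.trans_one {d : R} {u u' u'' : List Slice} (h : Rel r n 1 u u')
    (h' : Rel r n d u' u'') : Rel r n d u u'' := by
  simpa using h.trans h'

theorem Rel.one_trans {d : R} {u u' u'' : List Slice} (h : Rel r n d u u')
    (h' : Rel r n 1 u' u'') : Rel r n d u u'' := by
  simpa using h.trans h'

theorem Rel.append {c : R} {u u' : List Slice} {m k : ℕ} (h : Rel r n c u u') {e : List Slice}
    (hu : Runs 0 u m) (he : Runs m e k) : Rel r n c (u ++ e) (u' ++ e) := by
  obtain ⟨⟨m', h1, h2⟩, h3, h4⟩ := h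
  obtain rfl := h1.unique hu
  exact ⟨⟨k, hu.append he, h2.append he⟩, by simp [h3], fun v => by simp [h4]⟩

theorem Rel.runs {c : R} {u u' : List Slice} {m : ℕ} (h : Rel r n c u u') (hu : Runs 0 u m) :
    Runs 0 u' m := by
  obtain ⟨⟨m', h1, h2⟩, -⟩ := h
  obtain rfl := h1.unique hu
  exact h2

theorem Rel.of_move {u x y : List Slice} {m k : ℕ} (hu : Runs 0 u m) (hx : Runs m x k)
    (h : Move x y) : Rel r n 1 (u ++ x) (u ++ y) :=
  ⟨⟨k, hu.append hx, hu.append (.of_move h hx)⟩, by simp [numPunct_eq_of_move h], fun v => by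
    simpa using ofWord_move hu hx h⟩

theorem Rel.of_move' {u x y : List Slice} {m k : ℕ} (hu : Runs 0 u m) (hx : Runs m x k)
    (h : Move x y) : Rel r n 1 (u ++ y) (u ++ x) :=
  ⟨⟨k, hu.append (.of_move h hx), hu.append hx⟩, by simp [numPunct_eq_of_move h], fun v => by
    simpa using (ofWord_move hu hx h).symm⟩

/-- An event moves to the left, past one above it. -/
theorem Rel.swap_above {u : List Slice} {m : ℕ} (hu : Runs 0 u m) {a b : Event} {i j j' : ℕ}
    (hab : ¬ (a = .punct ∧ b = .punct)) (hj : i + a.ins ≤ j) (hm : j + b.ins ≤ m)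
    (hj' : j' + a.ins = j + a.outs) :
    Rel r n 1 (u ++ [⟨b, j⟩, ⟨a, i⟩]) (u ++ [⟨a, i⟩, ⟨b, j'⟩]) := by
  obtain ⟨d, rfl⟩ := Nat.exists_eq_add_of_le hj
  obtain rfl : j' = i + a.outs + d := by omega
  refine Rel.of_move (k := m - b.ins + b.outs - a.ins + a.outs) hu ?_ (.interchange a b i d hab)
  exact runs_cons.2 ⟨hm, runs_cons.2 ⟨by simp only; omega, runs_nil.2 rfl⟩⟩

/-- An event moves to the left, past one below it. -/
theorem Rel.swap_below {u : List Slice} {m : ℕ} (hu : Runs 0 u m) {a b : Event} {i j j' : ℕ}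
    (hab : ¬ (a = .punct ∧ b = .punct)) (hj : i + a.outs ≤ j)
    (hm : j' + b.ins ≤ m) (hj' : j' + a.outs = j + a.ins) :
    Rel r n 1 (u ++ [⟨a, i⟩, ⟨b, j⟩]) (u ++ [⟨b, j'⟩, ⟨a, i⟩]) := by
  obtain ⟨d, rfl⟩ := Nat.exists_eq_add_of_le hj
  obtain rfl : j' = i + a.ins + d := by omega
  refine Rel.of_move' (k := m - b.ins + b.outs - a.ins + a.outs) hu ?_ (.interchange a b i d hab)
  exact runs_cons.2 ⟨hm, runs_cons.2 ⟨by simp only; omega, runs_nil.2 rfl⟩⟩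

end SkeinAlgebra

namespace SkeinAlgebra

open Slice

/-! ### Crossingless words -/

/-- Lists of births, deaths and punctures. -/
inductive Stk
  | nil
  | b (i : ℕ) (s : Stk)
  | d (i : ℕ) (s : Stk)
  | p (i : ℕ) (s : Stk)

namespace Stk

/-- The word whose events are listed in reverse order. -/
def word : Stk → List Slice
  | nil => []
  | b i s => s.word ++ [birth i]
  | d i s => s.word ++ [death i]
  | p i s => s.word ++ [punct i]

/-- The word whose events are listed in order. -/
def fwd : Stk → List Slice
  | nil => []
  | b i s => birth i :: s.fwd
  | d i s => death i :: s.fwd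
  | p i s => punct i :: s.fwd

end Stk

theorem runs_snoc {k m : ℕ} {w : List Slice} {s : Slice} :
    Runs k (w ++ [s]) m ↔
      ∃ l, Runs k w l ∧ s.pos + s.kind.ins ≤ l ∧ l - s.kind.ins + s.kind.outs = m := by
  simp only [runs_append, runs_cons, runs_nil]

theorem runs_snoc_birth {k m i : ℕ} {w : List Slice} :
    Runs k (w ++ [birth i]) m ↔ ∃ l, Runs k w l ∧ i ≤ l ∧ l + 2 = m := runs_snoc

theorem runs_snoc_death {k m i : ℕ} {w : List Slice} :
    Runs k (w ++ [death i]) m ↔ ∃ l, Runs k w l ∧ i + 2 ≤ l ∧ l - 2 = m := runs_snoc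

theorem runs_snoc_punct {k m i : ℕ} {w : List Slice} :
    Runs k (w ++ [punct i]) m ↔ ∃ l, Runs k w l ∧ i ≤ l ∧ l = m := runs_snoc

theorem not_le_of_ble_eq_false {a b : ℕ} (h : Nat.ble a b = false) : ¬ a ≤ b := fun h' => by
  rw [Nat.ble_eq_true_of_le h'] at h
  exact Bool.noConfusion h

/-- Append a birth, and move it to the left past the births above it. -/
def pushBirth (j : ℕ) : Stk → Stk
  | .nil => .b j .nil
  | .b i s => bif Nat.ble j i then .b (Nat.add i 2) (pushBirth j s) else .b j (.b i s)
  | .d i s => .b j (.d i s)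
  | .p i s => .b j (.p i s)

/-- `d` nested births around a puncture. -/
def nestWord : ℕ → ℕ → List Slice
  | 0, j => [punct j]
  | d + 1, j => birth j :: nestWord d (j + 1)

/-- Append `d` nested births around a puncture. -/
def nest : ℕ → ℕ → Stk → Stk
  | 0, j, s => .p j s
  | d + 1, j, s => nest d (Nat.succ j) (.b j s)

/-- Append `d` nested births around a puncture, and move them to the left past other births. -/
def pushPunct : Stk → ℕ → ℕ → Stk
  | .nil, j, d => nest d j .nil
  | .b a s, j, d =>
    bif Nat.ble j a then pushBirth (Nat.add a (Nat.add d d)) (pushPunct s j d)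
    else bif Nat.beq j (Nat.succ a) then pushPunct s a (Nat.succ d)
    else pushBirth a (pushPunct s (Nat.sub j 2) d)
  | .d i s, j, d => nest d j (.d i s)
  | .p i s, j, d => nest d j (.p i s)

/-- The result of appending a death: it may be impossible to move it to the left until it
disappears, or it disappears, leaving a number of trivial circles. -/
inductive Res
  | stuck
  | ok (circles : ℕ) (s : Stk)

/-- Append a death, and move it to the left. -/
def pushDeath : ℕ → Stk → ℕ → Res
  | 0, _, _ => .stuck
  | f + 1, s, i =>
    match s with
    | .nil => .stuck
    | .b j s =>
      bif Nat.beq j i then .ok 1 s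
      else bif Nat.beq j (Nat.succ i) then .ok 0 s
      else bif Nat.beq i (Nat.succ j) then .ok 0 s
      else bif Nat.ble i j then
        match pushDeath f s i with
        | .stuck => .ok 0 (pushBirth (Nat.sub j 2) (.d i s))
        | .ok k s' => .ok k (pushBirth (Nat.sub j 2) s')
      else
        match pushDeath f s (Nat.sub i 2) with
        | .stuck => .ok 0 (pushBirth j (.d (Nat.sub i 2) s))
        | .ok k s' => .ok k (pushBirth j s')
    | .p j s =>
      bif Nat.beq j (Nat.succ i) then .stuck
      else match pushDeath f s i with
        | .stuck => .ok 0 (.p (bif Nat.ble j i then j else Nat.sub j 2) (.d i s))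
        | .ok k s' => .ok k (pushPunct s' (bif Nat.ble j i then j else Nat.sub j 2) 0)
    | .d j s =>
      bif Nat.beq j (Nat.succ i) then .stuck
      else bif Nat.ble j i then
        match pushDeath f s (Nat.add i 2) with
        | .stuck => .stuck
        | .ok k s' =>
          match pushDeath f s' j with
          | .stuck => .ok k (.d j s')
          | .ok k' s'' => .ok (Nat.add k k') s''
      else
        match pushDeath f s i with
        | .stuck => .ok 0 (.d (Nat.sub j 2) (.d i s))
        | .ok k s' =>
          match pushDeath f s' (Nat.sub j 2) with
          | .stuck => .ok k (.d (Nat.sub j 2) s')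
          | .ok k' s'' => .ok (Nat.add k k') s''

variable {R : Type*} [CommRing R] {r : Rˣ} {n : ℕ}

/-- A birth at j ≤ i happens below one at i and may precede it, raising it to i + 2. Consecutive
births are sorted in this way by increasing position. -/
theorem rel_pushBirth {s : Stk} {j m : ℕ} (hs : Runs 0 s.word m) (hj : j ≤ m) :
    Rel r n 1 (s.word ++ [birth j]) (pushBirth j s).word := by
  have key : Rel r n 1 (s.word ++ [birth j]) (s.word ++ [birth j]) :=
    Rel.rfl' (runs_snoc_birth.2 ⟨m, hs, hj, rfl⟩)
  induction s generalizing m with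
  | nil => exact key
  | d i s ih => exact key
  | p i s ih => exact key
  | b i s ih =>
    rw [pushBirth]
    cases h : Nat.ble j i with
    | false => exact key
    | true =>
      have hji : j ≤ i := Nat.le_of_ble_eq_true h
      obtain ⟨l, hl, hil, rfl⟩ := runs_snoc_birth.1 hs
      have hb : Runs 0 (s.word ++ [birth j]) (l + 2) := runs_snoc_birth.2 ⟨l, hl, by omega, rfl⟩
      have h1 : Rel r n 1 (s.word ++ [birth i, birth j]) (s.word ++ [birth j, birth (i + 2)]) :=
        Rel.swap_above hl (by simp) (by simpa [Event.ins] using hji)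
          (by simpa [Event.ins] using hil) (by simp [Event.ins, Event.outs])
      have h2 : Rel r n 1 (s.word ++ [birth j] ++ [birth (i + 2)])
          ((pushBirth j s).word ++ [birth (i + 2)]) :=
        (ih hl (by omega) (Rel.rfl' hb)).append hb
          (runs_cons.2 ⟨by simp [Event.ins]; omega, runs_nil.2 rfl⟩)
      simpa [Stk.word] using h1.trans_one (by simpa using h2)

theorem runs_nestWord {m j : ℕ} (d : ℕ) (hj : j ≤ m) : Runs m (nestWord d j) (m + 2 * d) := by
  induction d generalizing m j with
  | zero => exact runs_cons.2 ⟨hj, runs_nil.2 rfl⟩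
  | succ d ih =>
    refine runs_cons.2 ⟨hj, ?_⟩
    have := ih (m := m + 2) (j := j + 1) (by omega)
    rwa [show m + 2 + 2 * d = m + 2 * (d + 1) by ring] at this

theorem word_nest (d j : ℕ) (s : Stk) : (nest d j s).word = s.word ++ nestWord d j := by
  induction d generalizing j s with
  | zero => rfl
  | succ d ih => simp [nest, nestWord, ih, Stk.word]

/-- The nest lies below the birth, and each of its d births raises that birth by two. -/
theorem rel_birth_nest_above {u : List Slice} {m a j : ℕ} (d : ℕ) (hu : Runs 0 u m) (hj : j ≤ a)
    (ha : a ≤ m) :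
    Rel r n 1 (u ++ birth a :: nestWord d j) (u ++ nestWord d j ++ [birth (a + 2 * d)]) := by
  induction d generalizing u m a j with
  | zero =>
    simpa [nestWord] using Rel.swap_above (r := r) (n := n) (a := .punct) (b := .birth) (i := j)
      (j := a) (j' := a) hu (by simp) (by simpa [Event.ins] using hj)
      (by simpa [Event.ins] using ha) (by simp [Event.ins, Event.outs])
  | succ d ih =>
    have h1 := Rel.swap_above (r := r) (n := n) (a := .birth) (b := .birth) (i := j)
      (j := a) (j' := a + 2) hu (by simp) (by simpa [Event.ins] using hj)
      (by simpa [Event.ins] using ha) (by simp [Event.ins, Event.outs])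
    have hab : Runs m [birth a, birth j] (m + 4) :=
      runs_cons.2 ⟨ha, runs_cons.2 ⟨by simp [Event.ins, Event.outs]; omega, runs_nil.2 rfl⟩⟩
    have h2 := h1.append (hu.append hab) (runs_nestWord (j := j + 1) d (by omega))
    have h3 := ih (u := u ++ [birth j]) (m := m + 2) (a := a + 2) (j := j + 1)
      (runs_snoc_birth.2 ⟨m, hu, by omega, rfl⟩) (by omega) (by omega)
    rw [show a + 2 * (d + 1) = a + 2 + 2 * d by ring]
    simp only [nestWord, List.append_assoc, List.cons_append, List.nil_append] at h2 h3 ⊢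
    exact h2.trans_one h3

theorem rel_birth_nest_below {u : List Slice} {m a j : ℕ} (d : ℕ) (hu : Runs 0 u m) (hj : a ≤ j)
    (hm : j ≤ m) :
    Rel r n 1 (u ++ birth a :: nestWord d (j + 2)) (u ++ nestWord d j ++ [birth a]) := by
  induction d generalizing u m j with
  | zero =>
    simpa [nestWord] using Rel.swap_below (r := r) (n := n) (a := .birth) (b := .punct) (i := a)
      (j := j + 2) (j' := j) hu (by simp) (by simp [Event.outs]; omega)
      (by simpa [Event.ins] using hm) (by simp [Event.ins, Event.outs])
  | succ d ih =>
    have h1 := Rel.swap_below (r := r) (n := n) (a := .birth) (b := .birth) (i := a)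
      (j := j + 2) (j' := j) hu (by simp) (by simp [Event.outs]; omega)
      (by simpa [Event.ins] using hm) (by simp [Event.ins, Event.outs])
    have hab : Runs m [birth a, birth (j + 2)] (m + 4) :=
      runs_cons.2 ⟨by simp [Event.ins]; omega,
        runs_cons.2 ⟨by simp [Event.ins, Event.outs]; omega, runs_nil.2 rfl⟩⟩
    have h2 := h1.append (hu.append hab) (runs_nestWord (j := j + 2 + 1) d (by omega))
    have h3 := ih (u := u ++ [birth j]) (m := m + 2) (j := j + 1)
      (runs_snoc_birth.2 ⟨m, hu, by omega, rfl⟩) (by omega) (by omega)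
    rw [show j + 1 + 2 = j + 2 + 1 by ring] at h3
    simp only [nestWord, List.append_assoc, List.cons_append, List.nil_append] at h2 h3 ⊢
    exact h2.trans_one h3

/-- Births are delayed as much as possible. A birth below or above the puncture is exchanged with
it. A birth whose two strands enclose the puncture cannot be exchanged, so it joins the nest and
moves along; this is the reason for the parameter d. -/
theorem rel_pushPunct {s : Stk} {j m : ℕ} (d : ℕ) (hs : Runs 0 s.word m) (hj : j ≤ m) :
    Rel r n 1 (s.word ++ nestWord d j) (pushPunct s j d).word := by
  have key : Rel r n 1 (s.word ++ nestWord d j) (nest d j s).word := by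
    rw [word_nest]
    exact Rel.rfl' (hs.append (runs_nestWord d hj))
  induction s generalizing m j d with
  | nil => exact key
  | d i s ih => exact key
  | p i s ih => exact key
  | b a s ih =>
    obtain ⟨l, hl, hil, rfl⟩ := runs_snoc_birth.1 hs
    have ih' {d j : ℕ} (hj : j ≤ l) := ih d hl hj (by
      rw [word_nest]
      exact Rel.rfl' (hl.append (runs_nestWord d hj)))
    rw [pushPunct]
    cases h : Nat.ble j a with
    | true =>
      have hja : j ≤ a := Nat.le_of_ble_eq_true h
      have h1 := rel_birth_nest_above (r := r) (n := n) d hl hja hil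
      have h2 := (ih' (d := d) (j := j) (by omega)).append (e := [birth (a + 2 * d)])
        (hl.append (runs_nestWord d (by omega)))
        (runs_cons.2 ⟨by simp [Event.ins]; omega, runs_nil.2 rfl⟩)
      have h3 := rel_pushBirth (r := r) (n := n) (j := a + 2 * d)
        ((ih' (d := d) (j := j) (by omega)).runs (hl.append (runs_nestWord d (by omega))))
        (by omega)
      simp only [Stk.word, cond_true, Nat.add_eq, ← two_mul]
      exact (by simpa using h1 : Rel r n 1 _ _).trans_one (h2.trans_one h3)
    | false =>
      have hja : ¬ j ≤ a := not_le_of_ble_eq_false h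
      cases h' : Nat.beq j (Nat.succ a) with
      | true =>
        obtain rfl := Nat.eq_of_beq_eq_true h'
        simpa [Stk.word, nestWord] using ih' (d := d + 1) (j := a) hil
      | false =>
        have hne : j ≠ a + 1 := Nat.ne_of_beq_eq_false h'
        obtain ⟨j, rfl⟩ : ∃ j', j = j' + 2 := ⟨j - 2, by omega⟩
        have h1 := rel_birth_nest_below (r := r) (n := n) (a := a) (j := j) d hl (by omega)
          (by omega)
        have h2 := (ih' (d := d) (j := j) (by omega)).append (e := [birth a])
          (hl.append (runs_nestWord d (by omega)))
          (runs_cons.2 ⟨by simp [Event.ins]; omega, runs_nil.2 rfl⟩)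
        have h3 := rel_pushBirth (r := r) (n := n) (j := a)
          ((ih' (d := d) (j := j) (by omega)).runs (hl.append (runs_nestWord d (by omega))))
          (by omega)
        simp only [Stk.word, cond_false, Nat.sub_eq, Nat.add_sub_cancel]
        exact (by simpa using h1 : Rel r n 1 _ _).trans_one (h2.trans_one h3)

/-- The scalar `q + q⁻¹`. -/
def qTwo (r : Rˣ) : R := (r ^ 2 : Rˣ) + ((r ^ 2)⁻¹ : Rˣ)

theorem rel_circle {u : List Slice} {m i : ℕ} (hu : Runs 0 u m) (hi : i ≤ m) :
    Rel r n (-qTwo r) (u ++ [birth i, death i]) u := by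
  refine ⟨⟨m, hu.append ?_, hu⟩, by simp [Event.punctures], fun v => by
    rw [List.append_assoc]; exact ofWord_circle hu hi⟩
  exact runs_cons.2 ⟨hi, runs_cons.2 ⟨by simp [Event.ins, Event.outs]; omega, runs_nil.2 rfl⟩⟩

/-- Correctness of the result of appending a death. -/
def Res.Sound (r : Rˣ) (n : ℕ) (u : List Slice) : Res → Prop
  | .stuck => True
  | .ok k s => Rel r n ((-qTwo r) ^ k) u s.word

/-- A death meeting a birth at the same position closes a circle, and at a neighbouring position it
straightens a zigzag. Otherwise it commutes with the preceding event, unless it encloses a puncture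
or another death. The fuel f only makes the recursion structural: when it runs out the answer is
`stuck`, about which nothing is claimed, and the death may then simply be left where it is. -/
theorem sound_pushDeath (f : ℕ) {s : Stk} {i m : ℕ} (hs : Runs 0 s.word m) (hi : i + 2 ≤ m) :
    (pushDeath f s i).Sound r n (s.word ++ [death i]) := by
  induction f generalizing s i m with
  | zero => trivial
  | succ f ih =>
    have hdeath {u : List Slice} {l i : ℕ} (hl : Runs 0 u l) (hi : i + 2 ≤ l) :
        Runs 0 (u ++ [death i]) (l - 2) := runs_snoc_death.2 ⟨l, hl, hi, rfl⟩
    cases s with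
    | nil => trivial
    | b j s =>
      obtain ⟨l, hl, hil, rfl⟩ := runs_snoc_birth.1 hs
      have hbd : Runs l [birth j, death i] l := by
        exact runs_cons.2 ⟨hil, runs_cons.2 ⟨hi, runs_nil.2 rfl⟩⟩
      simp only [pushDeath, Stk.word]
      cases h1 : Nat.beq j i with
      | true =>
        obtain rfl := Nat.eq_of_beq_eq_true h1
        simpa [Res.Sound] using rel_circle (r := r) (n := n) hl hil
      | false =>
      have hji : j ≠ i := Nat.ne_of_beq_eq_false h1
      cases h2 : Nat.beq j (Nat.succ i) with
      | true =>
        obtain rfl := Nat.eq_of_beq_eq_true h2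
        simpa [Res.Sound] using Rel.of_move (r := r) (n := n) hl hbd (.zagzig i)
      | false =>
      have hji2 : j ≠ i + 1 := Nat.ne_of_beq_eq_false h2
      cases h3 : Nat.beq i (Nat.succ j) with
      | true =>
        obtain rfl := Nat.eq_of_beq_eq_true h3
        simpa [Res.Sound] using Rel.of_move (r := r) (n := n) hl hbd (.zigzag j)
      | false =>
      have hji3 : i ≠ j + 1 := Nat.ne_of_beq_eq_false h3
      cases h4 : Nat.ble i j with
      | true =>
        have hij : i ≤ j := Nat.le_of_ble_eq_true h4
        have e1 := Rel.swap_above (r := r) (n := n) (a := .death) (b := .birth) (i := i)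
          (j := j) (j' := j - 2) hl (by simp) (by simp [Event.ins]; omega)
          (by simpa [Event.ins] using hil) (by simp [Event.ins, Event.outs]; omega)
        have hd := hdeath (i := i) hl (by omega)
        have hb : Runs (l - 2) [birth (j - 2)] l :=
          runs_cons.2 ⟨by simp [Event.ins]; omega,
            runs_nil.2 (by simp [Event.ins, Event.outs]; omega)⟩
        have ih1 := ih (i := i) hl (by omega)
        cases hp : pushDeath f s i with
        | stuck =>
          simp only [Res.Sound, cond_false, cond_true, pow_zero]
          have e2 := rel_pushBirth (r := r) (n := n) (s := .d i s) (j := j - 2) hd (by omega)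
          simp only [Stk.word, List.append_assoc, List.cons_append, List.nil_append] at e2 ⊢
          exact e1.trans_one e2
        | ok k s' =>
          simp only [Res.Sound, cond_false, cond_true, hp] at ih1 ⊢
          have e2 := ih1.append hd hb
          have e3 := rel_pushBirth (r := r) (n := n) (j := j - 2) (ih1.runs hd) (by omega)
          simp only [List.append_assoc, List.cons_append, List.nil_append] at e2 e3 ⊢
          exact e1.trans_one (e2.one_trans e3)
      | false =>
        have hij : ¬ i ≤ j := not_le_of_ble_eq_false h4
        have e1 := Rel.swap_below (r := r) (n := n) (a := .birth) (b := .death) (i := j)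
          (j := i) (j' := i - 2) hl (by simp) (by simp [Event.outs]; omega)
          (by simp [Event.ins]; omega) (by simp [Event.ins, Event.outs]; omega)
        have hd := hdeath (i := i - 2) hl (by omega)
        have hb : Runs (l - 2) [birth j] l :=
          runs_cons.2 ⟨by simp [Event.ins]; omega,
            runs_nil.2 (by simp [Event.ins, Event.outs]; omega)⟩
        have ih1 := ih (i := i - 2) hl (by omega)
        cases hp : pushDeath f s (i - 2) with
        | stuck =>
          simp only [Res.Sound, cond_false, Nat.sub_eq, hp, pow_zero]
          have e2 := rel_pushBirth (r := r) (n := n) (s := .d (i - 2) s) (j := j) hd (by omega)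
          simp only [Stk.word, List.append_assoc, List.cons_append, List.nil_append] at e2 ⊢
          exact e1.trans_one e2
        | ok k s' =>
          simp only [Res.Sound, cond_false, Nat.sub_eq, hp] at ih1 ⊢
          have e2 := ih1.append hd hb
          have e3 := rel_pushBirth (r := r) (n := n) (j := j) (ih1.runs hd) (by omega)
          simp only [List.append_assoc, List.cons_append, List.nil_append] at e2 e3 ⊢
          exact e1.trans_one (e2.one_trans e3)
    | p j s =>
      obtain ⟨l, hl, hil, rfl⟩ := runs_snoc_punct.1 hs
      simp only [pushDeath, Stk.word]
      cases h1 : Nat.beq j (Nat.succ i) with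
      | true => trivial
      | false =>
      have hji : j ≠ i + 1 := Nat.ne_of_beq_eq_false h1
      -- The puncture is either below both dying strands and keeps its position, or above both and
      -- descends by two; the case between them was excluded above.
      obtain ⟨j', hj', e1, hjl⟩ : ∃ j', (bif Nat.ble j i then j else Nat.sub j 2) = j' ∧
          Rel r n 1 (s.word ++ [punct j, death i]) (s.word ++ [death i, punct j']) ∧
            j' ≤ l - 2 := by
        refine ⟨_, rfl, ?_⟩
        cases h2 : Nat.ble j i with
        | true =>
          have hij : j ≤ i := Nat.le_of_ble_eq_true h2
          exact ⟨Rel.swap_below hl (by simp) (by simp [Event.outs]; omega)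
            (by simp [Event.ins]; omega) (by simp [Event.ins, Event.outs]),
            by simp only [cond_true]; omega⟩
        | false =>
          have hij : ¬ j ≤ i := not_le_of_ble_eq_false h2
          exact ⟨Rel.swap_above hl (by simp) (by simp [Event.ins]; omega)
            (by simp [Event.ins]; omega) (by simp [Event.ins, Event.outs]; omega),
            by simp only [cond_false, Nat.sub_eq]; omega⟩
      rw [hj']
      have hd := hdeath (i := i) hl (by omega)
      have ih1 := ih (i := i) hl (by omega)
      cases hp : pushDeath f s i with
      | stuck => simpa [Res.Sound, Stk.word] using e1
      | ok k s' =>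
        simp only [Res.Sound, cond_false, hp] at ih1 ⊢
        have e2 := ih1.append (e := [punct j']) hd (runs_cons.2 ⟨hjl, runs_nil.2 rfl⟩)
        have e3 := rel_pushPunct (r := r) (n := n) (j := j') 0 (ih1.runs hd) hjl
        simp only [nestWord, List.append_assoc, List.cons_append, List.nil_append] at e2 e3 ⊢
        exact e1.trans_one (e2.one_trans e3)
    | d j s =>
      obtain ⟨l, hl, hil, rfl⟩ := runs_snoc_death.1 hs
      simp only [pushDeath, Stk.word]
      cases h1 : Nat.beq j (Nat.succ i) with
      | true => trivial
      | false =>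
      have hji : j ≠ i + 1 := Nat.ne_of_beq_eq_false h1
      cases h2 : Nat.ble j i with
      | true =>
        have hij : j ≤ i := Nat.le_of_ble_eq_true h2
        have e1 := Rel.swap_below (r := r) (n := n) (a := .death) (b := .death) (i := j)
          (j := i) (j' := i + 2) hl (by simp) (by simp [Event.outs]; omega)
          (by simp [Event.ins]; omega) (by simp [Event.ins, Event.outs])
        have hd := hdeath (i := i + 2) hl (by omega)
        have hb : Runs (l - 2) [death j] (l - 2 - 2) :=
          runs_cons.2 ⟨by simp [Event.ins]; omega, runs_nil.2 rfl⟩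
        have ih1 := ih (i := i + 2) hl (by omega)
        cases hp : pushDeath f s (i + 2) with
        | stuck => simp [Res.Sound, hp]
        | ok k s' =>
          simp only [Res.Sound, hp] at ih1
          have e2 := ih1.append hd hb
          -- The later death has been carried to the left past the earlier one, which now ends a
          -- possibly different word and gets another chance to cancel. The circles of the two
          -- stages add up.
          have ih2 := ih (i := j) (ih1.runs hd) (by omega)
          simp only [List.append_assoc, List.cons_append, List.nil_append] at e2 ⊢
          cases hq : pushDeath f s' j with
          | stuck =>
            simp only [Res.Sound, cond_false, cond_true, Nat.add_eq, hp, hq]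
            exact e1.trans_one e2
          | ok k' s'' =>
            simp only [Res.Sound, cond_false, cond_true, Nat.add_eq, hp, hq, pow_add] at ih2 ⊢
            exact e1.trans_one (e2.trans ih2)
      | false =>
        have hij : ¬ j ≤ i := not_le_of_ble_eq_false h2
        have e1 := Rel.swap_above (r := r) (n := n) (a := .death) (b := .death) (i := i)
          (j := j) (j' := j - 2) hl (by simp) (by simp [Event.ins]; omega)
          (by simpa [Event.ins] using hil) (by simp [Event.ins, Event.outs]; omega)
        have hd := hdeath (i := i) hl (by omega)
        have hb : Runs (l - 2) [death (j - 2)] (l - 2 - 2) :=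
          runs_cons.2 ⟨by simp [Event.ins]; omega, runs_nil.2 rfl⟩
        have ih1 := ih (i := i) hl (by omega)
        cases hp : pushDeath f s i with
        | stuck => simpa [Res.Sound, Stk.word] using e1
        | ok k s' =>
          simp only [Res.Sound, hp] at ih1
          have e2 := ih1.append hd hb
          have ih2 := ih (i := j - 2) (ih1.runs hd) (by omega)
          simp only [List.append_assoc, List.cons_append, List.nil_append] at e2 ⊢
          cases hq : pushDeath f s' (j - 2) with
          | stuck =>
            simp only [Res.Sound, cond_false, Nat.sub_eq, hq]
            exact e1.trans_one e2
          | ok k' s'' =>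
            simp only [Res.Sound, cond_false, Nat.sub_eq, Nat.add_eq, hq, pow_add] at ih2 ⊢
            exact e1.trans_one (e2.trans ih2)

end SkeinAlgebra

namespace SkeinAlgebra

open Slice

variable {R : Type*} [CommRing R] {r : Rˣ} {n : ℕ}

/-- This lets a factor q + q⁻¹ be traded for a polynomial in r at the price of r² in the
denominator, so that all numerators remain polynomials in r. -/
theorem sq_mul_qTwo (r : Rˣ) : (r : R) ^ 2 * qTwo r = (r : R) ^ 4 + 1 := by
  have h : (r : R) ^ 2 * ((r ^ 2)⁻¹ : Rˣ) = 1 := by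
    rw [← Units.val_pow_eq_pow_val, Units.mul_inv]
  rw [qTwo, mul_add, h, Units.val_pow_eq_pow_val]
  ring

/-! ### Coefficients -/

/-- The scalar `r⁻ˢ (q + q⁻¹)⁻ᵘ (P - N)`, where `P`, `N` are polynomials in `r` with natural
coefficients, given by their values `p`, `n` at a large number; `m` is the sum of the coefficients. -/
inductive Cf
  | mk (s u p n m : ℕ)

/-- The large number at which polynomials are evaluated. -/
def bigX : ℕ := 2 ^ 64

open Polynomial in
/-- The meaning of coefficients. -/
def CfRep (r : Rˣ) : Cf → R → Prop
  | ⟨s, u, p, n, m⟩, c => ∃ P N : ℕ[X], P.eval bigX = p ∧ N.eval bigX = n ∧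
      P.eval 1 + N.eval 1 = m ∧ (r : R) ^ s * qTwo r ^ u * c = aeval (r : R) P - aeval (r : R) N

def Cf.one : Cf := ⟨0, 0, 1, 0, 1⟩

def Cf.add : Cf → Cf → Cf
  | ⟨s, u, p, n, m⟩, ⟨s', u', p', n', m'⟩ =>
    bif and (Nat.beq s s') (Nat.beq u u') then ⟨s, u, Nat.add p p', Nat.add n n', Nat.add m m'⟩
    else
      let v := Nat.max u u'
      let a := Nat.add s (Nat.mul 2 (Nat.sub v u))
      let a' := Nat.add s' (Nat.mul 2 (Nat.sub v u'))
      let t := Nat.max a a'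
      let y := Nat.mul (Nat.pow (Nat.add (Nat.pow bigX 4) 1) (Nat.sub v u))
        (Nat.pow bigX (Nat.sub t a))
      let y' := Nat.mul (Nat.pow (Nat.add (Nat.pow bigX 4) 1) (Nat.sub v u'))
        (Nat.pow bigX (Nat.sub t a'))
      let z := Nat.pow 2 (Nat.sub v u)
      let z' := Nat.pow 2 (Nat.sub v u')
      ⟨t, v, Nat.add (Nat.mul y p) (Nat.mul y' p'), Nat.add (Nat.mul y n) (Nat.mul y' n'),
        Nat.add (Nat.mul z m) (Nat.mul z' m')⟩

/-- Multiply with `r ^ a * r⁻¹ ^ d * (-1) ^ o * (q + q⁻¹) ^ k * β ^ e * c`. -/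
def Cf.mul (a d : ℕ) (o : Bool) (k e c : ℕ) : Cf → Cf
  | ⟨s, u, p, n, m⟩ =>
    let y := Nat.mul c (Nat.mul (Nat.pow (Nat.add (Nat.pow bigX 4) 1) k) (Nat.pow bigX a))
    let s' := Nat.add s (Nat.add d (Nat.mul 2 k))
    let m' := Nat.mul c (Nat.mul (Nat.pow 2 k) m)
    bif o then ⟨s', Nat.add u e, Nat.mul y n, Nat.mul y p, m'⟩
    else ⟨s', Nat.add u e, Nat.mul y p, Nat.mul y n, m'⟩

def Cf.times : Cf → Cf → Cf
  | ⟨s, u, p, n, m⟩, ⟨s', u', p', n', m'⟩ =>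
   ⟨Nat.add s s', Nat.add u u', Nat.add (Nat.mul p p') (Nat.mul n n'),
     Nat.add (Nat.mul p n') (Nat.mul n p'), Nat.mul m m'⟩

def Cf.isZero : Cf → Bool
  | ⟨_, _, p, n, m⟩ => and (Nat.beq p n) (Nat.blt m bigX)

open Polynomial

theorem cfRep_one : CfRep r .one 1 := ⟨1, 0, by simp, by simp, by simp, by simp⟩

/-- Different denominators are extended to a common one. Raising the exponent of q + q⁻¹ by k
multiplies the numerator with (r⁴ + 1) ^ k and raises the exponent of r by 2k, after which the
exponents of r are equalized too. -/
theorem cfRep_add {x y : Cf} {c d : R} (hx : CfRep r x c) (hy : CfRep r y d) :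
    CfRep r (x.add y) (c + d) := by
  obtain ⟨s, u, p, n, m⟩ := x
  obtain ⟨s', u', p', n', m'⟩ := y
  obtain ⟨P, N, rfl, rfl, rfl, h⟩ := hx
  obtain ⟨P', N', rfl, rfl, rfl, h'⟩ := hy
  rw [Cf.add]
  cases hsu : and (Nat.beq s s') (Nat.beq u u') with
  | true =>
    rw [Bool.and_eq_true] at hsu
    obtain rfl := Nat.eq_of_beq_eq_true hsu.1
    obtain rfl := Nat.eq_of_beq_eq_true hsu.2
    refine ⟨P + P', N + N', by simp, by simp, ?_, ?_⟩
    · simp only [eval_add, Nat.add_eq]; ring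
    · rw [mul_add, h, h']
      simp only [map_add]; ring
  | false =>
    simp only [cond_false, Nat.add_eq, Nat.mul_eq, Nat.sub_eq, Nat.pow_eq]
    generalize hv : Nat.max u u' = v
    have hvu : u ≤ v := by rw [← hv]; exact Nat.le_max_left _ _
    have hvu' : u' ≤ v := by rw [← hv]; exact Nat.le_max_right _ _
    generalize ht : Nat.max (s + 2 * (v - u)) (s' + 2 * (v - u')) = t
    have hts : s + 2 * (v - u) ≤ t := by rw [← ht]; exact Nat.le_max_left _ _
    have hts' : s' + 2 * (v - u') ≤ t := by rw [← ht]; exact Nat.le_max_right _ _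
    obtain ⟨k, rfl⟩ := Nat.exists_eq_add_of_le hvu
    obtain ⟨k', hk'⟩ := Nat.exists_eq_add_of_le hvu'
    obtain ⟨l, rfl⟩ := Nat.exists_eq_add_of_le hts
    obtain ⟨l', hl'⟩ := Nat.exists_eq_add_of_le hts'
    simp only [Nat.add_sub_cancel_left] at hl' ⊢
    rw [show u + k - u' = k' by omega] at hl' ⊢
    rw [show s + 2 * k + l - (s' + 2 * k') = l' by omega]
    refine ⟨(X ^ 4 + 1) ^ k * X ^ l * P + (X ^ 4 + 1) ^ k' * X ^ l' * P',
      (X ^ 4 + 1) ^ k * X ^ l * N + (X ^ 4 + 1) ^ k' * X ^ l' * N', by simp, by simp, ?_, ?_⟩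
    · simp only [eval_add, eval_mul, eval_pow, eval_X, eval_one]
      ring
    · have e1 : (r : R) ^ (s + 2 * k + l) * qTwo r ^ (u + k) =
          ((r : R) ^ 4 + 1) ^ k * (r : R) ^ l * ((r : R) ^ s * qTwo r ^ u) := by
        rw [← sq_mul_qTwo]; ring
      have e2 : (r : R) ^ (s + 2 * k + l) * qTwo r ^ (u + k) =
          ((r : R) ^ 4 + 1) ^ k' * (r : R) ^ l' * ((r : R) ^ s' * qTwo r ^ u') := by
        rw [← sq_mul_qTwo, hl', hk']; ring
      simp only [map_add, map_mul, map_pow, aeval_X, map_one]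
      linear_combination c * e1 + d * e2 + (((r : R) ^ 4 + 1) ^ k * (r : R) ^ l) * h +
        (((r : R) ^ 4 + 1) ^ k' * (r : R) ^ l') * h'

theorem cfRep_mul {x : Cf} {c β : R} (hβ : qTwo r * β = 1) (hx : CfRep r x c) (a d : ℕ) (o : Bool)
    (k e l : ℕ) :
    CfRep r (x.mul a d o k e l) ((r : R) ^ a * ((r⁻¹ : Rˣ) : R) ^ d * (bif o then -1 else 1)
      * qTwo r ^ k * β ^ e * l * c) := by
  obtain ⟨s, u, p, n, m⟩ := x
  obtain ⟨P, N, rfl, rfl, rfl, h⟩ := hx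
  have e1 : (r : R) ^ (s + (d + 2 * k)) * qTwo r ^ (u + e) * ((r : R) ^ a * ((r⁻¹ : Rˣ) : R) ^ d
      * (bif o then -1 else 1) * qTwo r ^ k * β ^ e * l * c) =
      (bif o then -1 else 1) * (l * (((r : R) ^ 4 + 1) ^ k * (r : R) ^ a))
        * ((r : R) ^ s * qTwo r ^ u * c) := by
    have e2 : (r : R) ^ d * ((r⁻¹ : Rˣ) : R) ^ d = 1 := by
      rw [← mul_pow, Units.mul_inv, one_pow]
    have e3 : qTwo r ^ e * β ^ e = 1 := by rw [← mul_pow, hβ, one_pow]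
    rw [← sq_mul_qTwo]
    calc _ = ((r : R) ^ d * ((r⁻¹ : Rˣ) : R) ^ d) * (qTwo r ^ e * β ^ e) * ((bif o then -1 else 1)
        * (l * (((r : R) ^ 2 * qTwo r) ^ k * (r : R) ^ a)) * ((r : R) ^ s * qTwo r ^ u * c)) := by
          ring
      _ = _ := by rw [e2, e3]; ring
  -- A minus sign exchanges the positive and the negative part, since their coefficients are natural
  -- numbers.
  cases o with
  | true =>
    refine ⟨(l : ℕ[X]) * ((X ^ 4 + 1) ^ k * X ^ a) * N,
      (l : ℕ[X]) * ((X ^ 4 + 1) ^ k * X ^ a) * P, by simp, by simp,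
      ?_, ?_⟩
    · simp only [eval_add, eval_mul, eval_pow, eval_X, eval_one, eval_natCast, Nat.mul_eq,
        Nat.pow_eq, Nat.cast_id]
      ring
    · simp only [Nat.add_eq, Nat.mul_eq]
      rw [e1, h]
      simp only [cond_true, map_add, map_mul, map_pow, aeval_X, map_one, map_natCast]
      ring
  | false =>
    refine ⟨(l : ℕ[X]) * ((X ^ 4 + 1) ^ k * X ^ a) * P,
      (l : ℕ[X]) * ((X ^ 4 + 1) ^ k * X ^ a) * N, by simp, by simp,
      ?_, ?_⟩
    · simp only [eval_add, eval_mul, eval_pow, eval_X, eval_one, eval_natCast, Nat.mul_eq,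
        Nat.pow_eq, Nat.cast_id]
      ring
    · simp only [Nat.add_eq, Nat.mul_eq]
      rw [e1, h]
      simp only [cond_false, map_add, map_mul, map_pow, aeval_X, map_one, map_natCast]
      ring

theorem cfRep_times {x y : Cf} {c d : R} (hx : CfRep r x c) (hy : CfRep r y d) :
    CfRep r (x.times y) (c * d) := by
  obtain ⟨s, u, p, n, m⟩ := x
  obtain ⟨s', u', p', n', m'⟩ := y
  obtain ⟨P, N, rfl, rfl, rfl, h⟩ := hx
  obtain ⟨P', N', rfl, rfl, rfl, h'⟩ := hy
  refine ⟨P * P' + N * N', P * N' + N * P', by simp, by simp, ?_, ?_⟩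
  · simp only [eval_add, eval_mul, Nat.mul_eq]; ring
  · simp only [map_add, map_mul, Nat.add_eq]
    calc _ = ((r : R) ^ s * qTwo r ^ u * c) * ((r : R) ^ s' * qTwo r ^ u' * d) := by ring
      _ = _ := by rw [h, h']; ring

theorem coeff_lt_of_eval_one_lt {P : ℕ[X]} {b : ℕ} (h : P.eval 1 < b) (i : ℕ) : P.coeff i < b := by
  refine lt_of_le_of_lt ?_ h
  rw [eval_eq_sum, sum_def]
  simp only [one_pow, mul_one]
  by_cases hi : i ∈ P.support
  · exact Finset.single_le_sum (f := fun i => P.coeff i) (fun _ _ => Nat.zero_le _) hi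
  · simp [notMem_support_iff.1 hi]

/-- The coefficients are the digits in base b of the value at b, and these are determined by the
value. -/
theorem eq_of_eval_eq {b : ℕ} {P N : ℕ[X]} (hP : ∀ i, P.coeff i < b)
    (hN : ∀ i, N.coeff i < b) (h : P.eval b = N.eval b) : P = N := by
  induction hd : P.natDegree using Nat.strong_induction_on generalizing P N with
  | _ d ih =>
  have key : ∀ Q : ℕ[X], (∀ i, Q.coeff i < b) →
      Q.eval b % b = Q.coeff 0 ∧ Q.eval b / b = Q.divX.eval b := by
    intro Q hQ
    have hb : 0 < b := lt_of_le_of_lt (Nat.zero_le _) (hQ 0)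
    have : Q.eval b = Q.coeff 0 + b * Q.divX.eval b := by
      conv_lhs => rw [← divX_mul_X_add Q]
      simp [mul_comm, add_comm]
    rw [this]
    exact ⟨by rw [Nat.add_mul_mod_self_left, Nat.mod_eq_of_lt (hQ 0)],
      by rw [Nat.add_mul_div_left _ _ hb, Nat.div_eq_of_lt (hQ 0), zero_add]⟩
  have h0 : P.coeff 0 = N.coeff 0 := by rw [← (key P hP).1, ← (key N hN).1, h]
  have h1 : P.divX.eval b = N.divX.eval b := by rw [← (key P hP).2, ← (key N hN).2, h]
  rcases Nat.eq_zero_or_pos d with rfl | hpos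
  -- The induction is on the degree of P, so nothing is known yet about the degree of N. Its higher
  -- part has value 0 at b > 0 and natural coefficients, hence vanishes.
  · have hP0 : P = C (P.coeff 0) := eq_C_of_natDegree_eq_zero hd
    have hz : ∀ Q : ℕ[X], (∀ i, Q.coeff i < b) → Q.eval b = 0 → Q = 0 := by
      intro Q hQ
      have hb : 0 < b := lt_of_le_of_lt (Nat.zero_le _) (hQ 0)
      intro h
      rw [eval_eq_sum, sum_def] at h
      ext i
      by_cases hi : i ∈ Q.support
      · have := (Finset.sum_eq_zero_iff.1 h) i hi
        simpa [hb.ne'] using this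
      · simpa using hi
    have hNX : N.divX = 0 := by
      refine hz _ (fun i => by simpa [coeff_divX] using hN (i + 1)) ?_
      rw [← h1, hP0, divX_C, eval_zero]
    rw [← divX_mul_X_add N, hNX, ← h0, zero_mul, zero_add, ← hP0]
  · have := ih (P.divX.natDegree) (by rw [natDegree_divX_eq_natDegree_tsub_one]; omega)
      (P := P.divX) (N := N.divX) (fun i => by simpa [coeff_divX] using hP (i + 1))
      (fun i => by simpa [coeff_divX] using hN (i + 1)) h1 rfl
    rw [← divX_mul_X_add P, ← divX_mul_X_add N, this, h0]

/-- The sum m of all coefficients bounds each of them, so m < `bigX` allows the two parts to be read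
off from their values and compared as polynomials. The denominator is cancelled because r and q +
q⁻¹ are invertible. -/
theorem eq_zero_of_isZero {x : Cf} {c β : R} (hβ : qTwo r * β = 1) (hx : CfRep r x c)
    (h : x.isZero = true) : c = 0 := by
  obtain ⟨s, u, p, n, m⟩ := x
  obtain ⟨P, N, rfl, hn, rfl, hc⟩ := hx
  simp only [Cf.isZero, Bool.and_eq_true] at h
  have h1 := Nat.eq_of_beq_eq_true h.1
  have h2 : P.eval 1 + N.eval 1 < bigX := Nat.le_of_ble_eq_true h.2
  have : P = N := eq_of_eval_eq (b := bigX) (coeff_lt_of_eval_one_lt (by omega))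
    (coeff_lt_of_eval_one_lt (by omega)) (by simpa [hn] using h1)
  rw [this, sub_self] at hc
  have e2 : (r : R) ^ s * ((r⁻¹ : Rˣ) : R) ^ s = 1 := by
    rw [← mul_pow, Units.mul_inv, one_pow]
  have e3 : qTwo r ^ u * β ^ u = 1 := by rw [← mul_pow, hβ, one_pow]
  calc c = ((r : R) ^ s * ((r⁻¹ : Rˣ) : R) ^ s) * (qTwo r ^ u * β ^ u) * c := by
        rw [e2, e3]; ring
    _ = ((r⁻¹ : Rˣ) : R) ^ s * β ^ u * ((r : R) ^ s * qTwo r ^ u * c) := by ring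
    _ = 0 := by rw [hc, mul_zero]

/-! ### Linear combinations of words -/

/-- Linear combinations of words. -/
inductive Comb
  | nil
  | cons (w : Stk) (x : Cf) (C : Comb)

variable (r n) in
/-- The meaning of a linear combination of words. -/
inductive CombRep : Comb → SkeinAlgebra r n → Prop
  | nil : CombRep .nil 0
  | cons (w : Stk) (x : Cf) (C : Comb) (c : R) (z : SkeinAlgebra r n)
      (hw : IsTangle 0 n w.word) (hx : CfRep r x c) (hC : CombRep C z) :
      CombRep (.cons w x C) (c • ofWord r n w.word + z)

def eqW : Stk → Stk → Bool
  | .nil, .nil => true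
  | .b i s, .b j t => and (Nat.beq i j) (eqW s t)
  | .d i s, .d j t => and (Nat.beq i j) (eqW s t)
  | .p i s, .p j t => and (Nat.beq i j) (eqW s t)
  | _, _ => false

theorem eq_of_eqW {s t : Stk} (h : eqW s t = true) : s = t := by
  induction s generalizing t with
  | nil => cases t <;> first | rfl | exact Bool.noConfusion h
  | b i s ih =>
    cases t <;> first | exact Bool.noConfusion h | skip
    simp only [eqW, Bool.and_eq_true] at h
    rw [Nat.eq_of_beq_eq_true h.1, ih h.2]
  | d i s ih =>
    cases t <;> first | exact Bool.noConfusion h | skip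
    simp only [eqW, Bool.and_eq_true] at h
    rw [Nat.eq_of_beq_eq_true h.1, ih h.2]
  | p i s ih =>
    cases t <;> first | exact Bool.noConfusion h | skip
    simp only [eqW, Bool.and_eq_true] at h
    rw [Nat.eq_of_beq_eq_true h.1, ih h.2]

/-- Add a multiple of a word. -/
def addW (w : Stk) (x : Cf) : Comb → Comb
  | .nil => .cons w x .nil
  | .cons w' y C => bif eqW w w' then .cons w' (Cf.add x y) C else .cons w' y (addW w x C)

theorem CombRep.congr {C : Comb} {z z' : SkeinAlgebra r n} (h : CombRep r n C z) (e : z = z') :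
    CombRep r n C z' := e ▸ h

theorem combRep_addW {w : Stk} {x : Cf} {C : Comb} {c : R} {z : SkeinAlgebra r n}
    (hC : CombRep r n C z) (hw : IsTangle 0 n w.word) (hx : CfRep r x c) :
    CombRep r n (addW w x C) (z + c • ofWord r n w.word) := by
  induction hC with
  | nil => exact (CombRep.cons w x .nil c 0 hw hx .nil).congr (add_comm _ _)
  | cons w' y C d z hw' hy hC ih =>
    rw [addW]
    cases h : eqW w w' with
    | true =>
      obtain rfl := eq_of_eqW h
      exact (CombRep.cons w _ C _ z hw (cfRep_add hx hy) hC).congr (by rw [add_smul]; abel)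
    | false => exact (CombRep.cons w' _ _ _ _ hw' hy ih).congr (by abel)

/-! ### Resolution of crossings -/

/-- Lists of births, deaths, punctures and crossings. -/
inductive Wd
  | nil
  | b (i : ℕ) (w : Wd)
  | d (i : ℕ) (w : Wd)
  | p (i : ℕ) (w : Wd)
  | c (up : Bool) (i : ℕ) (w : Wd)

/-- The word of a list of events. -/
def Wd.word : Wd → List Slice
  | nil => []
  | b i w => birth i :: w.word
  | d i w => death i :: w.word
  | p i w => punct i :: w.word
  | c up i w => cross i up :: w.word

/-- A way to evaluate a function on a number that has been computed before. -/
def forceNat {α : Type} (n : ℕ) (k : ℕ → α) : α := Nat.rec (k 0) (fun m _ => k (Nat.succ m)) n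

/-- Case distinction on the argument forces its evaluation before the continuation uses it, while
the value of the function is unchanged. -/
theorem forceNat_eq {α : Type} (n : ℕ) (k : ℕ → α) : forceNat n k = k n := by
  cases n <;> rfl

/-- A way to evaluate a function on a word that has been computed before. -/
def force {α : Type} : Stk → (Stk → α) → α
  | .nil, k => k .nil
  | .b i s, k => forceNat i fun i => force s fun s => k (.b i s)
  | .d i s, k => forceNat i fun i => force s fun s => k (.d i s)
  | .p i s, k => forceNat i fun i => force s fun s => k (.p i s)

theorem force_eq {α : Type} (s : Stk) (k : Stk → α) : force s k = k s := by
  induction s generalizing k <;> simp [force, forceNat_eq, *]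

/-- Resolve the crossings of `w`, to be performed after `s`, add the result to `acc`.  The weight is
`r ^ a * r⁻¹ ^ d * (-qTwo r) ^ k`. -/
def run : Wd → Stk → ℕ → ℕ → ℕ → Comb → Comb
  | .nil, s, a, d, k, acc =>
    force s fun s => addW s (Cf.mul a d (Nat.beq (Nat.mod k 2) 1) k 0 1 .one) acc
  | .b i w, s, a, d, k, acc => run w (pushBirth i s) a d k acc
  | .p i w, s, a, d, k, acc => run w (pushPunct s i 0) a d k acc
  | .d i w, s, a, d, k, acc =>
    match pushDeath 100 s i with
    | .stuck => run w (.d i s) a d k acc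
    | .ok k' s' => run w s' a d (Nat.add k k') acc
  | .c up i w, s, a, d, k, acc =>
    match up, pushDeath 100 s i with
    | true, .stuck =>
      run w s a (Nat.succ d) k (run w (pushBirth i (.d i s)) (Nat.succ a) d k acc)
    | true, .ok k' s' =>
      run w s a (Nat.succ d) k (run w (pushBirth i s') (Nat.succ a) d (Nat.add k k') acc)
    | false, .stuck =>
      run w s (Nat.succ a) d k (run w (pushBirth i (.d i s)) a (Nat.succ d) k acc)
    | false, .ok k' s' =>
      run w s (Nat.succ a) d k (run w (pushBirth i s') a (Nat.succ d) (Nat.add k k') acc)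

theorem Rel.isTangle_iff {c : R} {u u' : List Slice} (h : Rel r n c u u') {l : ℕ}
    {v : List Slice} : IsTangle 0 l (u ++ v) ↔ IsTangle 0 l (u' ++ v) := by
  obtain ⟨⟨m, h1, h2⟩, h3, -⟩ := h
  simp only [SkeinAlgebra.isTangle_iff, runs_append, numPunct_append, h3]
  refine and_congr_left fun _ => ⟨?_, ?_⟩
  · rintro ⟨m', hm', h0⟩
    obtain rfl := h1.unique hm'
    exact ⟨_, h2, h0⟩
  · rintro ⟨m', hm', h0⟩
    obtain rfl := h2.unique hm'
    exact ⟨_, h1, h0⟩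

/-- A cap followed by a cup, after cancellation of the cap. -/
theorem rel_pushDeath_birth {s : Stk} {i m : ℕ} (hs : Runs 0 s.word m) (hi : i + 2 ≤ m) :
    (match pushDeath 100 s i with
      | .stuck => Rel r n 1 (s.word ++ [death i, birth i]) (pushBirth i (.d i s)).word
      | .ok k s' => Rel r n ((-qTwo r) ^ k) (s.word ++ [death i, birth i])
          (pushBirth i s').word) := by
  have h := sound_pushDeath (r := r) (n := n) 100 hs hi
  have hd : Runs 0 (s.word ++ [death i]) (m - 2) := runs_snoc_death.2 ⟨m, hs, hi, rfl⟩
  cases hp : pushDeath 100 s i with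
  | stuck => simpa [Stk.word] using rel_pushBirth (r := r) (n := n) (s := .d i s) (j := i) hd (by omega)
  | ok k s' =>
    simp only [Res.Sound, hp] at h ⊢
    have h1 := h.append (e := [birth i]) hd
      (runs_cons.2 ⟨by simp [Event.ins]; omega, runs_nil.2 rfl⟩)
    have h2 := rel_pushBirth (r := r) (n := n) (j := i) (h.runs hd) (by omega)
    simp only [List.append_assoc, List.cons_append, List.nil_append] at h1 h2
    exact h1.one_trans h2

/-- The part s already performed stays crossingless. Each further birth, death or puncture is
absorbed into it by an isotopy, up to circles, and a crossing branches into its two smoothings,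
whose weights are recorded in the exponents a, d and k. -/
theorem combRep_run {β : R} (hβ : qTwo r * β = 1) (w : Wd) {s : Stk} {a d k m : ℕ} {acc : Comb}
    {z : SkeinAlgebra r n} (hacc : CombRep r n acc z) (hs : Runs 0 s.word m)
    (ht : IsTangle 0 n (s.word ++ w.word)) :
    CombRep r n (run w s a d k acc) (z + ((r : R) ^ a * ((r⁻¹ : Rˣ) : R) ^ d * (-qTwo r) ^ k) •
      ofWord r n (s.word ++ w.word)) := by
  induction w generalizing s a d k m acc z with
  | nil =>
    rw [run, force_eq]
    have := combRep_addW hacc (by simpa [Wd.word] using ht)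
      (cfRep_mul hβ cfRep_one a d (Nat.beq (Nat.mod k 2) 1) k 0 1)
    refine this.congr ?_
    rw [Wd.word, List.append_nil]
    congr 2
    -- Coefficients store a sign and a power of q + q⁻¹ separately; the sign of k circles is the
    -- parity of k.
    have hk : (-qTwo r) ^ k = (bif Nat.beq (Nat.mod k 2) 1 then -1 else 1) * qTwo r ^ k := by
      rw [neg_pow]
      congr 1
      rcases Nat.even_or_odd k with h | h
      · rw [h.neg_one_pow, show Nat.mod k 2 = 0 from Nat.even_iff.1 h]; rfl
      · rw [h.neg_one_pow, show Nat.mod k 2 = 1 from Nat.odd_iff.1 h]; rfl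
    rw [hk]
    simp only [pow_zero, Nat.cast_one, mul_one, mul_assoc]
  | b i w ih =>
    have hi : i ≤ m := by
      obtain ⟨h, -⟩ := isTangle_iff.1 ht
      obtain ⟨m', h1, h2⟩ := runs_append.1 h
      obtain rfl := hs.unique h1
      exact (runs_cons.1 h2).1
    have h := rel_pushBirth (r := r) (n := n) (j := i) hs hi
    have hb : Runs 0 (s.word ++ [birth i]) (m + 2) := runs_snoc_birth.2 ⟨m, hs, hi, rfl⟩
    have ht' : IsTangle 0 n ((s.word ++ [birth i]) ++ w.word) := by simpa [Wd.word] using ht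
    have := ih (a := a) (d := d) (k := k) hacc (h.runs hb) (h.isTangle_iff.1 ht')
    refine this.congr ?_
    have e := h.2.2 w.word
    rw [one_smul] at e
    rw [← e, List.append_assoc]
    rfl
  | p i w ih =>
    have hi : i ≤ m := by
      obtain ⟨h, -⟩ := isTangle_iff.1 ht
      obtain ⟨m', h1, h2⟩ := runs_append.1 h
      obtain rfl := hs.unique h1
      exact (runs_cons.1 h2).1
    have h := rel_pushPunct (r := r) (n := n) (j := i) 0 hs hi
    have hb : Runs 0 (s.word ++ [punct i]) m := runs_snoc_punct.2 ⟨m, hs, hi, rfl⟩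
    have ht' : IsTangle 0 n ((s.word ++ [punct i]) ++ w.word) := by simpa [Wd.word] using ht
    have := ih (a := a) (d := d) (k := k) hacc (h.runs hb) (h.isTangle_iff.1 ht')
    refine this.congr ?_
    have e := h.2.2 w.word
    rw [one_smul] at e
    rw [← e, List.append_assoc]
    rfl
  | d i w ih =>
    have hi : i + 2 ≤ m := by
      obtain ⟨h, -⟩ := isTangle_iff.1 ht
      obtain ⟨m', h1, h2⟩ := runs_append.1 h
      obtain rfl := hs.unique h1
      exact (runs_cons.1 h2).1
    have h := sound_pushDeath (r := r) (n := n) 100 hs hi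
    have hb : Runs 0 (s.word ++ [death i]) (m - 2) := runs_snoc_death.2 ⟨m, hs, hi, rfl⟩
    have ht' : IsTangle 0 n ((s.word ++ [death i]) ++ w.word) := by simpa [Wd.word] using ht
    rw [run]
    cases hp : pushDeath 100 s i with
    | stuck =>
      refine (ih (s := .d i s) (a := a) (d := d) (k := k) hacc hb ht').congr ?_
      simp [Stk.word, Wd.word]
    | ok k' s' =>
      simp only [Res.Sound, hp] at h
      refine (ih (s := s') (a := a) (d := d) (k := k + k') hacc (h.runs hb)
        (h.isTangle_iff.1 ht')).congr ?_
      have e := h.2.2 w.word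
      rw [List.append_assoc] at e
      rw [Wd.word, ← List.singleton_append, e, smul_smul, pow_add]
      simp only [mul_assoc]
  | c up i w ih =>
    have hi : i + 2 ≤ m := by
      obtain ⟨h, -⟩ := isTangle_iff.1 ht
      obtain ⟨m', h1, h2⟩ := runs_append.1 h
      obtain rfl := hs.unique h1
      exact (runs_cons.1 h2).1
    have h := rel_pushDeath_birth (r := r) (n := n) hs hi
    have hb : Runs 0 (s.word ++ [death i, birth i]) m := by
      refine hs.append (runs_cons.2 ⟨hi, runs_cons.2 ⟨?_, runs_nil.2 ?_⟩⟩) <;>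
        simp [Event.ins, Event.outs] <;> omega
    have hc : Runs m [cross i up] m := by
      refine runs_cons.2 ⟨hi, runs_nil.2 ?_⟩
      simp [Event.ins, Event.outs]; omega
    have ht0 : IsTangle 0 n (s.word ++ w.word) :=
      (isTangle_congr hs hc (runs_nil.2 rfl) (by simp [Event.punctures])).1 ht
    have ht1 : IsTangle 0 n ((s.word ++ [death i, birth i]) ++ w.word) := by
      rw [List.append_assoc]
      refine (isTangle_congr hs hc ?_ (by simp [Event.punctures])).1 ht
      refine runs_cons.2 ⟨hi, runs_cons.2 ⟨?_, runs_nil.2 ?_⟩⟩ <;>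
        simp [Event.ins, Event.outs] <;> omega
    have hup := ofWord_crossUp (r := r) (n := n) (v := w.word) hs hi
    have hdown := ofWord_crossDown (r := r) (n := n) (v := w.word) hs hi
    cases hp : pushDeath 100 s i with
    | stuck =>
      simp only [hp] at h
      have e := h.2.2 w.word
      simp only [one_smul, List.append_assoc, List.cons_append, List.nil_append] at e
      cases up with
      | true =>
        simp only [run, hp]
        refine (ih (ih hacc (h.runs hb) (h.isTangle_iff.1 ht1)) hs ht0).congr ?_
        rw [Wd.word, hup, e, smul_add, smul_smul, smul_smul, pow_succ, pow_succ]
        module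
      | false =>
        simp only [run, hp]
        refine (ih (ih hacc (h.runs hb) (h.isTangle_iff.1 ht1)) hs ht0).congr ?_
        rw [Wd.word, hdown, e, smul_add, smul_smul, smul_smul, pow_succ, pow_succ]
        module
    | ok k' s' =>
      simp only [hp] at h
      have e := h.2.2 w.word
      simp only [List.append_assoc, List.cons_append, List.nil_append] at e
      cases up with
      | true =>
        simp only [run, hp]
        refine (ih (ih hacc (h.runs hb) (h.isTangle_iff.1 ht1)) hs ht0).congr ?_
        rw [Wd.word, hup, e, smul_add, smul_smul, smul_smul, smul_smul, pow_succ, pow_succ,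
          Nat.add_eq, pow_add]
        module
      | false =>
        simp only [run, hp]
        refine (ih (ih hacc (h.runs hb) (h.isTangle_iff.1 ht1)) hs ht0).congr ?_
        rw [Wd.word, hdown, e, smul_add, smul_smul, smul_smul, smul_smul, pow_succ, pow_succ,
          Nat.add_eq, pow_add]
        module

end SkeinAlgebra

namespace SkeinAlgebra

open Slice

variable {R : Type*} [CommRing R] {r : Rˣ} {n : ℕ}

/-! ### Multiplication with a curve -/

/-- The part of a curve after its first event; `B` tells which punctures are encircled. -/
def curveTail (B : List Bool) : List Slice :=
  (B.map fun b => punct (bif b then 1 else 2)) ++ [death 0]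

/-- The curve around the punctures marked in `B`. -/
def curveB (B : List Bool) : List Slice := birth 0 :: curveTail B

/-- The upper strand of a curve goes up across `k` strands. -/
def ups (w : Wd) (p : ℕ) : ℕ → Wd
  | 0 => w
  | k + 1 => .c true (Nat.succ p) (ups w (Nat.succ p) k)

/-- The upper strand of a curve goes down across `k` strands. -/
def downs (w : Wd) (i : ℕ) : ℕ → Wd
  | 0 => w
  | k + 1 => .c false (Nat.succ (Nat.add i k)) (downs w i k)

/-- Draw the curve `curveB B` above a crossingless diagram.  The lower strand of the curve passes
below the diagram, the upper one passes above `p` strands. -/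
def sup : Stk → List Bool → ℕ → Wd
  | .p i w, true :: B, p =>
    bif Nat.ble i p then .p (Nat.succ i) (sup w B p)
    else ups (.p (Nat.succ i) (sup w B i)) p (Nat.sub i p)
  | .p i w, false :: B, p =>
    bif Nat.ble p i then .p (Nat.add i 2) (sup w B p)
    else downs (.p (Nat.add i 2) (sup w B i)) i (Nat.sub p i)
  | .b i w, B, p =>
    bif Nat.ble p i then .b (Nat.add i 2) (sup w B p) else .b (Nat.succ i) (sup w B (Nat.add p 2))
  | .d i w, B, p =>
    bif Nat.ble p i then .d (Nat.add i 2) (sup w B p)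
    else bif Nat.beq p (Nat.succ i) then .c true (Nat.succ p) (.d (Nat.succ i) (sup w B i))
    else .d (Nat.succ i) (sup w B (Nat.sub p 2))
  | _, _, _ => .d 0 .nil

/-- The strands of a curve and of a diagram below it. -/
def strands (p q : ℕ) : List Bool :=
  true :: (List.replicate p false ++ true :: List.replicate q false)

theorem _root_.Superposed.cast {c c' : List Bool} {w w' u u' v v' : List Slice} (h : Superposed c w u v)
    (hc : c = c') (hw : w = w') (hu : u = u') (hv : v = v') : Superposed c' w' u' v' := by
  subst hc hw hu hv
  exact h

theorem superposed_ups {w : Wd} {u v : List Slice} (k : ℕ) {p q : ℕ}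
    (h : Superposed (strands (p + k) q) w.word u v) :
    Superposed (strands p (k + q)) (ups w p k).word u v := by
  induction k generalizing p with
  | zero => simpa [ups, downs] using h
  | succ k ih =>
    have h1 := ih (p := p + 1) (by rwa [show p + 1 + k = p + (k + 1) by ring])
    refine (Superposed.crossMixedUp (true :: List.replicate p false) (List.replicate (k + q) false)
      _ _ _ (h1.cast ?_ rfl rfl rfl)).cast ?_ ?_ rfl rfl
    · simp [strands, List.replicate_succ']
    · rw [show k + 1 + q = k + q + 1 by ring]
      simp [strands, List.replicate_succ]
    · simp [ups, Wd.word]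

theorem superposed_downs {w : Wd} {u v : List Slice} (k : ℕ) {i q : ℕ}
    (h : Superposed (strands i (k + q)) w.word u v) :
    Superposed (strands (i + k) q) (downs w i k).word u v := by
  induction k generalizing q with
  | zero => simpa [ups, downs] using h
  | succ k ih =>
    have h1 := ih (q := q + 1) (by rwa [show k + (q + 1) = k + 1 + q by ring])
    refine (Superposed.crossMixedDown (true :: List.replicate (i + k) false)
      (List.replicate q false) _ _ _ (h1.cast ?_ rfl rfl rfl)).cast ?_ ?_ rfl rfl
    · simp [strands, List.replicate_succ]
    · rw [← add_assoc]
      simp [strands, List.replicate_succ']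
    · simp [downs, Wd.word]

/-- The curve consists of a strand below the whole diagram and a strand with p strands of the
diagram beneath it. The latter is moved only when necessary: up over strands to enclose a marked
puncture, down over strands to release an unmarked one, and over one strand if it separates two
strands about to merge. -/
theorem superposed_sup (w : Stk) {B : List Bool} {p q : ℕ} (h : IsTangle (p + q) B.length w.fwd) :
    Superposed (strands p q) (sup w B p).word (curveTail B) w.fwd := by
  induction w generalizing B p q with
  | nil =>
    obtain ⟨h1, h2⟩ := isTangle_iff.1 h
    have h3 : p + q = 0 := runs_nil.1 h1
    obtain rfl : p = 0 := by omega
    obtain rfl : q = 0 := by omega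
    obtain rfl : B = [] := List.eq_nil_of_length_eq_zero h2.symm
    exact Superposed.deathUpper [] [] [] [] [] .nil
  | b i w ih =>
    obtain ⟨h1, h2⟩ := isTangle_iff.1 h
    obtain ⟨h3, h4⟩ := runs_cons.1 h1
    simp only [Event.ins, Event.outs, add_zero, Nat.sub_zero] at h3 h4
    simp only [Stk.fwd, numPunct_cons, Event.punctures, zero_add] at h2
    rw [sup]
    cases hp : Nat.ble p i with
    | true =>
      obtain ⟨k, rfl⟩ := Nat.exists_eq_add_of_le (Nat.le_of_ble_eq_true hp)
      obtain ⟨l, rfl⟩ : ∃ l, q = k + l := Nat.exists_eq_add_of_le (by omega)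
      have := ih (B := B) (p := p) (q := k + 2 + l) (isTangle_iff.2 ⟨by convert h4 using 1; ring, h2⟩)
      refine (Superposed.birthLower (true :: (List.replicate p false ++ true ::
        List.replicate k false)) (List.replicate l false) _ _ _ (this.cast ?_ rfl rfl rfl)).cast
        ?_ ?_ rfl ?_
      · simp [strands, List.replicate_add, -List.replicate_append_replicate]
      · simp [strands, List.replicate_add, -List.replicate_append_replicate]
      · simp [Wd.word]; omega
      · simp [Stk.fwd]
    | false =>
      have hip := not_le_of_ble_eq_false hp
      obtain ⟨k, rfl⟩ := Nat.exists_eq_add_of_le (show i ≤ p by omega)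
      have := ih (B := B) (p := i + k + 2) (q := q)
        (isTangle_iff.2 ⟨by convert h4 using 1; ring, h2⟩)
      refine (Superposed.birthLower (true :: List.replicate i false) (List.replicate k false ++
        true :: List.replicate q false) _ _ _ (this.cast ?_ rfl rfl rfl)).cast ?_ ?_ rfl ?_
      · rw [show i + k + 2 = i + 2 + k by ring]
        simp [strands, List.replicate_add, -List.replicate_append_replicate]
      · simp [strands, List.replicate_add, -List.replicate_append_replicate]
      · simp [Wd.word]
      · simp [Stk.fwd]
  | d i w ih =>
    obtain ⟨h1, h2⟩ := isTangle_iff.1 h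
    obtain ⟨h3, h4⟩ := runs_cons.1 h1
    simp only [Event.ins, Event.outs, add_zero] at h3 h4
    simp only [Stk.fwd, numPunct_cons, Event.punctures, zero_add] at h2
    rw [sup]
    cases hp : Nat.ble p i with
    | true =>
      obtain ⟨k, rfl⟩ := Nat.exists_eq_add_of_le (Nat.le_of_ble_eq_true hp)
      obtain ⟨l, rfl⟩ : ∃ l, q = k + 2 + l := Nat.exists_eq_add_of_le (by omega)
      have := ih (B := B) (p := p) (q := k + l) (isTangle_iff.2 ⟨by convert h4 using 1; omega, h2⟩)
      refine (Superposed.deathLower (true :: (List.replicate p false ++ true ::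
        List.replicate k false)) (List.replicate l false) _ _ _ (this.cast ?_ rfl rfl rfl)).cast
        ?_ ?_ rfl ?_
      · simp [strands, List.replicate_add, -List.replicate_append_replicate]
      · simp [strands, List.replicate_add, -List.replicate_append_replicate]
      · simp [Wd.word]; omega
      · simp [Stk.fwd]
    | false =>
    have hip := not_le_of_ble_eq_false hp
    cases hp' : Nat.beq p (Nat.succ i) with
    | true =>
      obtain rfl := Nat.eq_of_beq_eq_true hp'
      obtain ⟨q, rfl⟩ : ∃ q', q = q' + 1 := ⟨q - 1, by omega⟩
      have := ih (B := B) (p := i) (q := q) (isTangle_iff.2 ⟨by convert h4 using 1; omega, h2⟩)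
      -- The curve runs between the two dying strands; it is first lifted over the upper one, so
      -- that both die inside the curve.
      have h5 := Superposed.deathLower (true :: List.replicate i false)
        (true :: List.replicate q false) _ _ _ (this.cast (by simp [strands]) rfl rfl rfl)
      refine (Superposed.crossMixedUp (true :: List.replicate (i + 1) false)
        (List.replicate q false) _ _ _ (h5.cast ?_ rfl rfl rfl)).cast ?_ ?_ rfl ?_
      · simp [List.replicate_succ']
      · simp [strands, List.replicate_succ]
      · simp [Wd.word]
      · simp [Stk.fwd]
    | false =>
      have hne : p ≠ i + 1 := Nat.ne_of_beq_eq_false hp'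
      obtain ⟨k, rfl⟩ := Nat.exists_eq_add_of_le (show i + 2 ≤ p by omega)
      have := ih (B := B) (p := i + k) (q := q)
        (isTangle_iff.2 ⟨by convert h4 using 1; omega, h2⟩)
      simp only [cond_false, Nat.sub_eq]
      rw [show i + 2 + k - 2 = i + k by omega]
      refine (Superposed.deathLower (true :: List.replicate i false) (List.replicate k false ++
        true :: List.replicate q false) _ _ _ (this.cast ?_ rfl rfl rfl)).cast ?_ ?_ rfl ?_
      · simp [strands, List.replicate_add, -List.replicate_append_replicate]
      · simp [strands, List.replicate_add, -List.replicate_append_replicate]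
      · simp [Wd.word]
      · simp [Stk.fwd]
  | p i w ih =>
    obtain ⟨h1, h2⟩ := isTangle_iff.1 h
    obtain ⟨h3, h4⟩ := runs_cons.1 h1
    simp only [Event.ins, Event.outs, add_zero, Nat.sub_zero] at h3 h4
    simp only [Stk.fwd, numPunct_cons, Event.punctures] at h2
    obtain ⟨b, B, rfl⟩ := List.exists_cons_of_length_pos (show 0 < B.length by omega)
    have h5 : numPunct w.fwd = B.length := by simp at h2; omega
    cases b with
    | true =>
      rw [sup]
      have key {k l : ℕ} (hl : i + k + l = p + q) : Superposed (strands (i + k) l)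
          (punct (i + 1) :: (sup w B (i + k)).word) (curveTail (true :: B)) (punct i :: w.fwd) := by
        have := ih (B := B) (p := i + k) (q := l) (isTangle_iff.2 ⟨by rwa [hl], h5⟩)
        refine (Superposed.punct (true :: List.replicate i false) (List.replicate k false ++
          true :: List.replicate l false) _ _ _ (this.cast ?_ rfl rfl rfl)).cast ?_ ?_ ?_ ?_
        · simp [strands, List.replicate_add, -List.replicate_append_replicate]
        · simp [strands, List.replicate_add, -List.replicate_append_replicate]
        · simp
        · simp [curveTail, List.count_replicate]
        · simp
      cases hp : Nat.ble i p with
      | true =>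
        obtain ⟨k, rfl⟩ := Nat.exists_eq_add_of_le (Nat.le_of_ble_eq_true hp)
        exact key rfl
      | false =>
        have hip := not_le_of_ble_eq_false hp
        obtain ⟨k, rfl⟩ := Nat.exists_eq_add_of_le (show p ≤ i by omega)
        obtain ⟨l, rfl⟩ : ∃ l, q = k + l := Nat.exists_eq_add_of_le (by omega)
        simp only [cond_false, Nat.sub_eq, Nat.add_sub_cancel_left]
        exact superposed_ups k (key (k := 0) (by ring))
    | false =>
      rw [sup]
      have key {p' k l : ℕ} (hi : i = p' + k) (hl : p' + (k + l) = p + q) :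
          Superposed (strands p' (k + l))
          (punct (i + 2) :: (sup w B p').word) (curveTail (false :: B)) (punct i :: w.fwd) := by
        have := ih (B := B) (p := p') (q := k + l) (isTangle_iff.2 ⟨by rwa [hl], h5⟩)
        refine (Superposed.punct (true :: (List.replicate p' false ++
          true :: List.replicate k false)) (List.replicate l false) _ _ _
            (this.cast ?_ rfl rfl rfl)).cast ?_ ?_ ?_ ?_
        · simp [strands, List.replicate_add, -List.replicate_append_replicate]
        · simp [strands, List.replicate_add, -List.replicate_append_replicate]
        · simp [hi]; omega
        · simp [curveTail, List.count_replicate]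
        · simp [hi]
      cases hp : Nat.ble p i with
      | true =>
        obtain ⟨k, rfl⟩ := Nat.exists_eq_add_of_le (Nat.le_of_ble_eq_true hp)
        obtain ⟨l, rfl⟩ : ∃ l, q = k + l := Nat.exists_eq_add_of_le (by omega)
        exact key rfl rfl
      | false =>
        have hip := not_le_of_ble_eq_false hp
        obtain ⟨k, rfl⟩ := Nat.exists_eq_add_of_le (show i ≤ p by omega)
        simp only [cond_false, Nat.sub_eq, Nat.add_sub_cancel_left]
        have := key (p' := i) (k := 0) (l := k + q) rfl (by ring)
        rw [zero_add] at this
        exact superposed_downs k this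

/-- Reverse the order of the events of a word. -/
def Stk.rev : Stk → Stk → Stk
  | .nil, w => w
  | .b i s, w => s.rev (.b i w)
  | .d i s, w => s.rev (.d i w)
  | .p i s, w => s.rev (.p i w)

theorem Stk.fwd_rev (s w : Stk) : (s.rev w).fwd = s.word ++ w.fwd := by
  induction s generalizing w with
  | nil => rfl
  | b i s ih => simp [Stk.rev, ih, Stk.fwd, Stk.word]
  | d i s ih => simp [Stk.rev, ih, Stk.fwd, Stk.word]
  | p i s ih => simp [Stk.rev, ih, Stk.fwd, Stk.word]

/-- The product of a curve and a word. -/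
def mulWord (B : List Bool) (w : Stk) : Comb := run (sup (w.rev .nil) B 0) (.b 0 .nil) 0 0 0 .nil

/-- The curve is born before the diagram begins, at p = q = 0, so its first event can be put into
the initial crossingless word. -/
theorem combRep_mulWord {β : R} (hβ : qTwo r * β = 1) {B : List Bool} (hB : B.length = n) {w : Stk}
    (hw : IsTangle 0 n w.word) :
    CombRep r n (mulWord B w) (ofWord r n (curveB B) * ofWord r n w.word) := by
  have h1 := superposed_sup (w.rev .nil) (B := B) (p := 0) (q := 0)
    (by simpa [Stk.fwd_rev, Stk.fwd, hB] using hw)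
  rw [Stk.fwd_rev, Stk.fwd, List.append_nil] at h1
  have h2 : Superposed [] (birth 0 :: (sup (w.rev .nil) B 0).word) (curveB B) w.word :=
    Superposed.birthUpper [] [] _ _ _ h1
  obtain ⟨k, h3, -, h4⟩ := isTangle_of_superposed h2
  obtain rfl : k = n := (isTangle_iff.1 h4).2.symm.trans (isTangle_iff.1 hw).2
  have := combRep_run hβ (sup (w.rev .nil) B 0) (s := .b 0 .nil) (a := 0) (d := 0) (k := 0) (m := 2)
    (z := 0) .nil (runs_cons.2 ⟨Nat.zero_le _, runs_nil.2 rfl⟩) h3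
  refine this.congr ?_
  rw [← ofWord_superposed h2]
  simp [Stk.word]

/-- Add a multiple of a linear combination. -/
def addAll (x : Cf) : Comb → Comb → Comb
  | .nil, acc => acc
  | .cons w y C, acc => addAll x C (addW w (Cf.times x y) acc)

theorem combRep_addAll {x : Cf} {c : R} (hx : CfRep r x c) {C : Comb} {z : SkeinAlgebra r n}
    (hC : CombRep r n C z) {acc : Comb} {y : SkeinAlgebra r n} (hacc : CombRep r n acc y) :
    CombRep r n (addAll x C acc) (y + c • z) := by
  induction hC generalizing acc y with
  | nil => simpa [addAll] using hacc
  | cons w x' C c' z hw hx' hC ih =>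
    exact (ih (combRep_addW hacc hw (cfRep_times hx hx'))).congr (by module)

/-- The product of a curve and a linear combination. -/
def mulT (B : List Bool) : Comb → Comb → Comb
  | .nil, acc => acc
  | .cons w x C, acc => mulT B C (addAll x (mulWord B w) acc)

theorem combRep_mulT {β : R} (hβ : qTwo r * β = 1) {B : List Bool} (hB : B.length = n) {C : Comb}
    {z : SkeinAlgebra r n} (hC : CombRep r n C z) {acc : Comb} {y : SkeinAlgebra r n}
    (hacc : CombRep r n acc y) :
    CombRep r n (mulT B C acc) (y + ofWord r n (curveB B) * z) := by
  induction hC generalizing acc y with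
  | nil => simpa [mulT] using hacc
  | cons w x C c z hw hx hC ih =>
    refine (ih (combRep_addAll hx (combRep_mulWord hβ hB hw) hacc)).congr ?_
    rw [mul_add, mul_smul_comm, add_assoc]

/-- Add a multiple of a linear combination; the factor is that of `Cf.mul`. -/
def addScaled (a d : ℕ) (o : Bool) (k e c : ℕ) : Comb → Comb → Comb
  | .nil, acc => acc
  | .cons w x C, acc => addScaled a d o k e c C (addW w (x.mul a d o k e c) acc)

theorem combRep_addScaled {β : R} (hβ : qTwo r * β = 1) (a d : ℕ) (o : Bool) (k e c : ℕ) {C : Comb}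
    {z : SkeinAlgebra r n} (hC : CombRep r n C z) {acc : Comb} {y : SkeinAlgebra r n}
    (hacc : CombRep r n acc y) :
    CombRep r n (addScaled a d o k e c C acc) (y + ((r : R) ^ a * ((r⁻¹ : Rˣ) : R) ^ d *
      (bif o then -1 else 1) * qTwo r ^ k * β ^ e * c) • z) := by
  induction hC generalizing acc y with
  | nil => simpa [addScaled] using hacc
  | cons w x C c' z hw hx hC ih =>
    refine (ih (combRep_addW hacc hw (cfRep_mul hβ hx a d o k e c))).congr ?_
    rw [smul_add, smul_smul, add_assoc]

/-- Whether all the coefficients are zero. -/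
def Comb.isZero : Comb → Bool
  | .nil => true
  | .cons _ x C => and x.isZero C.isZero

theorem eq_zero_of_comb_isZero {β : R} (hβ : qTwo r * β = 1) {C : Comb} {z : SkeinAlgebra r n}
    (hC : CombRep r n C z) (h : C.isZero = true) : z = 0 := by
  induction hC with
  | nil => rfl
  | cons w x C c z hw hx hC ih =>
    simp only [Comb.isZero, Bool.and_eq_true] at h
    rw [eq_zero_of_isZero hβ hx h.1, ih h.2, zero_smul, add_zero]

end SkeinAlgebra

namespace SkeinAlgebra

open Slice

variable {R : Type*} [CommRing R] {r : Rˣ} {n : ℕ}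

/-! ### Replacing punctures by blocks of punctures -/

theorem ins_punct : Event.punct.ins = 0 := rfl

theorem outs_punct : Event.punct.outs = 0 := rfl

/-- A row of punctures; those marked `true` stay at position `i`, the other ones are moved to the
top, position `m`. -/
def punctRow (m i : ℕ) (b : List Bool) : List Slice := b.map fun x => punct (bif x then i else m)

/-- Replace each puncture by a row of punctures, in a word that starts with `m` strands. -/
def blockWord : ℕ → List (List Bool) → List Slice → List Slice
  | _, _, [] => []
  | m, b :: Bs, ⟨.punct, i⟩ :: w => punctRow m i b ++ blockWord m Bs w
  | m, [], ⟨.punct, _⟩ :: w => blockWord m [] w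
  | m, Bs, ⟨.birth, i⟩ :: w => birth i :: blockWord (m + 2) Bs w
  | m, Bs, ⟨.death, i⟩ :: w => death i :: blockWord (m - 2) Bs w
  | m, Bs, ⟨.cross b, i⟩ :: w => cross i b :: blockWord (m - 2 + 2) Bs w

@[simp] theorem blockWord_nil (m : ℕ) (Bs : List (List Bool)) : blockWord m Bs [] = [] := by
  cases Bs <;> rfl

theorem blockWord_cons {e : Event} (he : e ≠ .punct) (m i : ℕ) (Bs : List (List Bool))
    (w : List Slice) :
    blockWord m Bs (⟨e, i⟩ :: w) = ⟨e, i⟩ :: blockWord (m - e.ins + e.outs) Bs w := by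
  cases e <;> first | exact absurd rfl he | (cases Bs <;> rfl)

@[simp] theorem blockWord_punct (m i : ℕ) (b : List Bool) (Bs : List (List Bool))
    (w : List Slice) :
    blockWord m (b :: Bs) (punct i :: w) = punctRow m i b ++ blockWord m Bs w := rfl

theorem runs_punctRow {m i : ℕ} (hi : i ≤ m) (b : List Bool) : Runs m (punctRow m i b) m := by
  induction b with
  | nil => exact runs_nil.2 rfl
  | cons x b ih => exact runs_cons.2 ⟨by cases x <;> simp [Event.ins, hi], ih⟩

theorem numPunct_punctRow (m i : ℕ) (b : List Bool) : numPunct (punctRow m i b) = b.length := by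
  induction b with
  | nil => rfl
  | cons x b ih =>
    rw [punctRow, List.map_cons, numPunct_cons, List.length_cons, add_comm]
    exact congrArg (· + 1) ih

theorem runs_blockWord {m k : ℕ} {w : List Slice} (h : Runs m w k) {Bs : List (List Bool)}
    (hB : numPunct w ≤ Bs.length) : Runs m (blockWord m Bs w) k := by
  induction w generalizing m Bs with
  | nil => simpa using h
  | cons s w ih =>
    obtain ⟨e, i⟩ := s
    obtain ⟨h1, h2⟩ := runs_cons.1 h
    by_cases he : e = .punct
    · subst he
      simp only [numPunct_cons, Event.punctures] at hB
      obtain ⟨b, Bs, rfl⟩ := List.exists_cons_of_length_pos (show 0 < Bs.length by omega)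
      simp only [List.length_cons] at hB
      exact (runs_punctRow (by simpa [Event.ins] using h1) b).append
        (ih (by simpa [Event.ins, Event.outs] using h2) (by omega))
    · rw [blockWord_cons he]
      rw [numPunct_cons] at hB
      exact runs_cons.2 ⟨h1, ih h2 (by omega)⟩

theorem numPunct_blockWord (m : ℕ) {w : List Slice} {Bs : List (List Bool)}
    (hB : numPunct w = Bs.length) :
    numPunct (blockWord m Bs w) = (Bs.map List.length).sum := by
  induction w generalizing m Bs with
  | nil =>
    obtain rfl : Bs = [] := List.eq_nil_of_length_eq_zero hB.symm
    rfl
  | cons s w ih =>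
    obtain ⟨e, i⟩ := s
    by_cases he : e = .punct
    · subst he
      simp only [numPunct_cons, Event.punctures] at hB
      obtain ⟨b, Bs, rfl⟩ := List.exists_cons_of_length_pos (show 0 < Bs.length by omega)
      simp only [List.length_cons] at hB
      simp [numPunct_punctRow, ih m (Bs := Bs) (by omega)]
    · have h0 : e.punctures = 0 := by cases e <;> first | rfl | exact absurd rfl he
      rw [blockWord_cons he, numPunct_cons, ih _ (by simpa [h0] using hB), h0, zero_add]

theorem isTangle_blockWord {m k : ℕ} {w : List Slice} (h : IsTangle m k w)
    {Bs : List (List Bool)} (hB : Bs.length = k) :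
    IsTangle m (Bs.map List.length).sum (blockWord m Bs w) := by
  obtain ⟨h1, h2⟩ := isTangle_iff.1 h
  exact isTangle_iff.2 ⟨runs_blockWord h1 (by omega), numPunct_blockWord m (by omega)⟩

/-- The beginning u consumes as many blocks as it passes punctures. This makes the substitution
compatible with local relations. -/
theorem blockWord_append {m l : ℕ} {u : List Slice} (h : Runs m u l) (Bs : List (List Bool))
    (hB : numPunct u ≤ Bs.length) (v : List Slice) :
    blockWord m Bs (u ++ v) = blockWord m Bs u ++ blockWord l (Bs.drop (numPunct u)) v := by
  induction u generalizing m Bs with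
  | nil =>
    obtain rfl := runs_nil.1 h
    simp
  | cons s u ih =>
    obtain ⟨e, i⟩ := s
    obtain ⟨h1, h2⟩ := runs_cons.1 h
    by_cases he : e = .punct
    · subst he
      simp only [numPunct_cons, Event.punctures] at hB ⊢
      obtain ⟨b, Bs, rfl⟩ := List.exists_cons_of_length_pos (show 0 < Bs.length by omega)
      simp only [List.length_cons] at hB
      rw [List.cons_append, blockWord_punct, blockWord_punct, List.append_assoc,
        ih (by simpa [Event.ins, Event.outs] using h2) Bs (by omega), add_comm 1,
        List.drop_succ_cons]
    · have h0 : e.punctures = 0 := by cases e <;> first | rfl | exact absurd rfl he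
      rw [numPunct_cons, h0, zero_add] at hB
      rw [List.cons_append, blockWord_cons he, blockWord_cons he, List.cons_append, ih h2 Bs hB,
        numPunct_cons, h0, zero_add]

theorem blockWord_eq_self (m : ℕ) (Bs : List (List Bool)) {x : List Slice} (h : numPunct x = 0) :
    blockWord m Bs x = x := by
  induction x generalizing m with
  | nil => simp
  | cons s x ih =>
    obtain ⟨e, i⟩ := s
    rw [numPunct_cons] at h
    have he : e ≠ .punct := by rintro rfl; simp [Event.punctures] at h
    rw [blockWord_cons he, ih _ (by omega)]

theorem Rel.symm_one {u u' : List Slice} (h : Rel r n 1 u u') : Rel r n 1 u' u := by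
  obtain ⟨⟨m, h1, h2⟩, h3, h4⟩ := h
  exact ⟨⟨m, h2, h1⟩, h3.symm, fun v => by rw [h4, one_smul, one_smul]⟩

/-- The event is carried past the punctures one at a time. A puncture below it keeps its position,
and one above it is shifted by the change in the number of strands. -/
theorem rel_puncts_event {e : Event} (he : e ≠ .punct) {u : List Slice} {m j : ℕ}
    (hu : Runs 0 u m) (hj : j + e.ins ≤ m) (b : List Bool) (f f' : Bool → ℕ)
    (hf : ∀ x, (f x ≤ j ∧ f' x = f x) ∨
      (j + e.ins ≤ f x ∧ f x ≤ m ∧ f' x + e.ins = f x + e.outs)) :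
    Rel r n 1 (u ++ ((b.map fun x => punct (f x)) ++ [⟨e, j⟩]))
      (u ++ (⟨e, j⟩ :: b.map fun x => punct (f' x))) := by
  induction b generalizing u with
  | nil => exact Rel.rfl' (hu.append (runs_cons.2 ⟨hj, runs_nil.2 rfl⟩))
  | cons x b ih =>
    have hu' : Runs 0 (u ++ [punct (f x)]) m := by
      refine runs_snoc_punct.2 ⟨m, hu, ?_, rfl⟩
      rcases hf x with h | h <;> omega
    have h1 := ih hu'
    have h2 : Rel r n 1 (u ++ [punct (f x), ⟨e, j⟩]) (u ++ [⟨e, j⟩, punct (f' x)]) := by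
      rcases hf x with h | h
      · rw [h.2]
        exact Rel.swap_below hu (by simp [he]) (by simpa [Event.outs] using h.1)
          hj (by simp [Event.ins, Event.outs])
      · exact Rel.swap_above hu (by simp [he]) h.1 (by simpa [Event.ins] using h.2.1) h.2.2
    have he' : Runs m [punct (f x), ⟨e, j⟩] (m - e.ins + e.outs) := by
      refine runs_cons.2 ⟨?_, runs_cons.2 ⟨hj, runs_nil.2 rfl⟩⟩
      simp only [Event.ins]
      rcases hf x with h | h <;> omega
    have hb : Runs (m - e.ins + e.outs) (b.map fun x => punct (f' x)) (m - e.ins + e.outs) := by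
      clear h1 ih
      induction b with
      | nil => exact runs_nil.2 rfl
      | cons y b ih =>
        refine runs_cons.2 ⟨?_, ih⟩
        simp only [ins_punct]
        rcases hf y with h | h <;> omega
    have h3 := h2.append (hu.append he') hb
    simp only [List.map_cons, List.append_assoc, List.cons_append, List.nil_append] at h1 h3 ⊢
    exact h1.trans_one h3

/-- The only moves with punctures are interchanges, and there at most one of the two events is a
puncture; its row slides past the other event. The unmarked punctures of the row, being above all
strands, slide past it as well. -/
theorem rel_blockWord_of_move {x y u : List Slice} (h : Move x y) {m k : ℕ} (hu : Runs 0 u m)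
    (hx : Runs m x k) (Bs : List (List Bool)) (hB : numPunct x ≤ Bs.length) :
    Rel r n 1 (u ++ blockWord m Bs x) (u ++ blockWord m Bs y) := by
  by_cases h0 : numPunct x = 0
  · rw [blockWord_eq_self _ _ h0, blockWord_eq_self _ _ ((numPunct_eq_of_move h).symm.trans h0)]
    exact .of_move hu hx h
  · cases h with
    | interchange a b i d hab =>
      obtain ⟨β, Bs, rfl⟩ := List.exists_cons_of_length_pos (show 0 < Bs.length by omega)
      obtain ⟨h1, h2⟩ := runs_cons.1 hx
      obtain ⟨h3, -⟩ := runs_cons.1 h2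
      simp only at h1 h3
      by_cases ha : a = .punct
      · have hb : b ≠ .punct := fun hb => hab ⟨ha, hb⟩
        subst ha
        simp only [ins_punct, outs_punct, add_zero] at h1 h3 ⊢
        rw [blockWord_cons hb, blockWord_punct, blockWord_punct, blockWord_cons hb, blockWord_nil,
          List.append_nil]
        refine (rel_puncts_event hb hu h1 β (fun x => bif x then i else m) _ fun x => ?_).symm_one
        cases x with
        | true => exact .inl ⟨Nat.le_add_right _ _, rfl⟩
        | false => exact .inr ⟨h1, le_rfl, by simp only [cond_false]; omega⟩
      · by_cases hb : b = .punct
        · subst hb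
          simp only [ins_punct, outs_punct, add_zero, Nat.sub_zero] at h1 h3 ⊢
          rw [blockWord_punct, blockWord_cons ha, blockWord_cons ha, blockWord_punct,
            blockWord_nil, List.append_nil]
          refine rel_puncts_event ha hu (by omega) β
            (fun x => bif x then i + a.ins + d else m) _ fun x => ?_
          cases x with
          | true => exact .inr ⟨by simp, h1, by simp only [cond_true]; omega⟩
          | false => exact .inr ⟨by simp only [cond_false]; omega, le_rfl,
              by simp only [cond_false]; omega⟩
        · refine absurd ?_ h0
          cases a <;> cases b <;> simp [Event.punctures] at ha hb ⊢
    | _ => exact absurd (by simp [Event.punctures]) h0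

theorem superposed_punctRow (l r : List Bool) {w u v : List Slice}
    (h : Superposed (l ++ r) w u v) (b : List Bool) :
    Superposed (l ++ r) (punctRow (l ++ r).length l.length b ++ w)
      (punctRow ((l ++ r).count true) (l.count true) b ++ u)
      (punctRow ((l ++ r).count false) (l.count false) b ++ v) := by
  induction b with
  | nil => exact h
  | cons x b ih =>
    cases x with
    | true => exact Superposed.punct l r _ _ _ ih
    | false =>
      -- An unmarked puncture lies above all strands of the superposition, hence also above all
      -- strands of each of the two diagrams.
      have := Superposed.punct (l ++ r) [] _ _ _ (by simpa using ih)
      simpa [punctRow] using this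

theorem superposed_blockWord {c : List Bool} {w u v : List Slice} (h : Superposed c w u v)
    {Bs : List (List Bool)} (hB : numPunct w ≤ Bs.length) :
    Superposed c (blockWord c.length Bs w) (blockWord (c.count true) Bs u)
      (blockWord (c.count false) Bs v) := by
  induction h generalizing Bs with
  | nil => simpa using Superposed.nil
  | birthUpper l r w u v h ih =>
    rw [blockWord_cons (by simp), blockWord_cons (by simp)]
    refine Superposed.birthUpper l r _ _ _ ((ih (by simpa [Event.punctures] using hB)).cast rfl ?_ ?_ ?_)
      <;> congr 1 <;> simp [Event.ins, Event.outs] <;> omega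
  | birthLower l r w u v h ih =>
    rw [blockWord_cons (by simp), blockWord_cons (by simp)]
    refine Superposed.birthLower l r _ _ _ ((ih (by simpa [Event.punctures] using hB)).cast rfl ?_ ?_ ?_)
      <;> congr 1 <;> simp [Event.ins, Event.outs] <;> omega
  | deathUpper l r w u v h ih =>
    rw [blockWord_cons (by simp), blockWord_cons (by simp)]
    refine Superposed.deathUpper l r _ _ _ ((ih (by simpa [Event.punctures] using hB)).cast rfl ?_ ?_ ?_)
      <;> congr 1 <;> simp [Event.ins, Event.outs] <;> omega
  | deathLower l r w u v h ih =>
    rw [blockWord_cons (by simp), blockWord_cons (by simp)]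
    refine Superposed.deathLower l r _ _ _ ((ih (by simpa [Event.punctures] using hB)).cast rfl ?_ ?_ ?_)
      <;> congr 1 <;> simp [Event.ins, Event.outs] <;> omega
  | crossUpper b l r w u v h ih =>
    rw [blockWord_cons (by simp), blockWord_cons (by simp)]
    refine Superposed.crossUpper b l r _ _ _ ((ih (by simpa [Event.punctures] using hB)).cast rfl ?_ ?_ ?_)
      <;> congr 1 <;> simp [Event.ins, Event.outs] <;> omega
  | crossLower b l r w u v h ih =>
    rw [blockWord_cons (by simp), blockWord_cons (by simp)]
    refine Superposed.crossLower b l r _ _ _ ((ih (by simpa [Event.punctures] using hB)).cast rfl ?_ ?_ ?_)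
      <;> congr 1 <;> simp [Event.ins, Event.outs] <;> omega
  | crossMixedUp l r w u v h ih =>
    rw [blockWord_cons (by simp)]
    refine Superposed.crossMixedUp l r _ _ _ ((ih (by simpa [Event.punctures] using hB)).cast rfl ?_ ?_ ?_)
      <;> congr 1 <;> simp [Event.ins, Event.outs] <;> omega
  | crossMixedDown l r w u v h ih =>
    rw [blockWord_cons (by simp)]
    refine Superposed.crossMixedDown l r _ _ _ ((ih (by simpa [Event.punctures] using hB)).cast rfl ?_ ?_ ?_)
      <;> congr 1 <;> simp [Event.ins, Event.outs] <;> omega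
  | punct l r w u v h ih =>
    simp only [numPunct_cons, Event.punctures] at hB
    obtain ⟨b, Bs, rfl⟩ := List.exists_cons_of_length_pos (show 0 < Bs.length by omega)
    simp only [List.length_cons] at hB
    exact superposed_punctRow l r (ih (by omega)) b

/-- Every defining relation is carried to one of the same kind or to an isotopy: skein relations
take place away from the punctures, and superpositions go to superpositions. So the substitution
descends to an algebra homomorphism. -/
theorem skeinRel_blockWord {m : ℕ} {Bs : List (List Bool)} (hm : Bs.length = m)
    (hn : (Bs.map List.length).sum = n) {x y : FreeAlgebra R (LinkDiagram m)}
    (h : SkeinRel r m x y) :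
    FreeAlgebra.lift R (fun D : LinkDiagram m => ofWord r n (blockWord 0 Bs D.1)) x =
      FreeAlgebra.lift R (fun D : LinkDiagram m => ofWord r n (blockWord 0 Bs D.1)) y := by
  -- The image of a diagram is cut at the place where the local relation is applied; the middle
  -- piece x starts with the blocks left over by u.
  have split {u x v : List Slice} (D : LinkDiagram m) (hD : D.1 = u ++ x ++ v) :
      ∃ l k, Runs 0 u l ∧ Runs l x k ∧ numPunct u + numPunct x ≤ Bs.length ∧
        Runs 0 (blockWord 0 Bs u) l ∧
        blockWord 0 Bs (u ++ x ++ v) = blockWord 0 Bs u ++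
          (blockWord l (Bs.drop (numPunct u)) x ++
            blockWord k (Bs.drop (numPunct u + numPunct x)) v) := by
    obtain ⟨h1, h2⟩ := isTangle_iff.1 D.2
    rw [hD, List.append_assoc] at h1
    simp only [hD, numPunct_append] at h2
    obtain ⟨l, hl, h3⟩ := runs_append.1 h1
    obtain ⟨k, hk, -⟩ := runs_append.1 h3
    refine ⟨l, k, hl, hk, by omega, runs_blockWord hl (by omega), ?_⟩
    rw [List.append_assoc, blockWord_append hl _ (by omega), blockWord_append hk _ (by simp; omega),
      List.drop_drop]
  cases h with
  | isotopy x y u v D E h hD hE =>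
    obtain ⟨l, k, hl, hk, hB, hb, e⟩ := split D hD
    obtain ⟨l', k', hl', hk', -, -, e'⟩ := split E hE
    obtain rfl := hl.unique hl'
    obtain rfl := (Runs.of_move h hk).unique hk'
    rw [FreeAlgebra.lift_ι_apply, FreeAlgebra.lift_ι_apply, hD, hE, e, e',
      ← numPunct_eq_of_move h]
    have := (rel_blockWord_of_move (r := r) (n := n) h hb hk (Bs.drop (numPunct u))
      (by simp; omega)).2.2 (blockWord k (Bs.drop (numPunct u + numPunct x)) v)
    simpa using this
  | crossUp i u v D E F hD hE hF =>
    obtain ⟨l, k, hl, hk, hB, hb, e⟩ := split D hD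
    obtain ⟨l', k', hl', hk', -, -, e'⟩ := split E hE
    obtain ⟨l'', k'', hl'', hk'', -, -, e''⟩ := split (x := []) F (by simpa using hF)
    obtain rfl := hl.unique hl'
    obtain rfl := hl.unique hl''
    have hi : i + 2 ≤ l := (runs_cons.1 hk).1
    obtain rfl : l = k := by
      have := runs_nil.1 (runs_cons.1 hk).2
      simp only [Event.ins, Event.outs] at this
      omega
    obtain rfl : l = k' := by
      have := runs_nil.1 (runs_cons.1 (runs_cons.1 hk').2).2
      simp only [Event.ins, Event.outs] at this
      omega
    obtain rfl := runs_nil.1 hk''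
    rw [blockWord_eq_self (x := [cross i true]) _ _ rfl] at e
    rw [blockWord_eq_self (x := [death i, birth i]) _ _ rfl] at e'
    rw [blockWord_nil] at e''
    rw [map_add, map_smul, map_smul, FreeAlgebra.lift_ι_apply, FreeAlgebra.lift_ι_apply,
      FreeAlgebra.lift_ι_apply, hD, hE, hF, e, e', ← List.append_nil u, e'']
    simpa [Event.punctures] using ofWord_crossUp (r := r) (n := n) hb hi
  | crossDown i u v D E F hD hE hF =>
    obtain ⟨l, k, hl, hk, hB, hb, e⟩ := split D hD
    obtain ⟨l', k', hl', hk', -, -, e'⟩ := split E hE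
    obtain ⟨l'', k'', hl'', hk'', -, -, e''⟩ := split (x := []) F (by simpa using hF)
    obtain rfl := hl.unique hl'
    obtain rfl := hl.unique hl''
    have hi : i + 2 ≤ l := (runs_cons.1 hk).1
    obtain rfl : l = k := by
      have := runs_nil.1 (runs_cons.1 hk).2
      simp only [Event.ins, Event.outs] at this
      omega
    obtain rfl : l = k' := by
      have := runs_nil.1 (runs_cons.1 (runs_cons.1 hk').2).2
      simp only [Event.ins, Event.outs] at this
      omega
    obtain rfl := runs_nil.1 hk''
    rw [blockWord_eq_self (x := [cross i false]) _ _ rfl] at e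
    rw [blockWord_eq_self (x := [death i, birth i]) _ _ rfl] at e'
    rw [blockWord_nil] at e''
    rw [map_add, map_smul, map_smul, FreeAlgebra.lift_ι_apply, FreeAlgebra.lift_ι_apply,
      FreeAlgebra.lift_ι_apply, hD, hE, hF, e, e', ← List.append_nil u, e'']
    simpa [Event.punctures] using ofWord_crossDown (r := r) (n := n) hb hi
  | circle i u v D E hD hE =>
    obtain ⟨l, k, hl, hk, hB, hb, e⟩ := split D hD
    obtain ⟨l', k', hl', hk', -, -, e'⟩ := split (x := []) E (by simpa using hE)
    obtain rfl := hl.unique hl'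
    have hi : i ≤ l := (runs_cons.1 hk).1
    obtain rfl : l = k := by
      have := runs_nil.1 (runs_cons.1 (runs_cons.1 hk).2).2
      simp only [Event.ins, Event.outs] at this
      omega
    obtain rfl := runs_nil.1 hk'
    rw [blockWord_eq_self (x := [birth i, death i]) _ _ rfl] at e
    rw [blockWord_nil] at e'
    rw [map_smul, FreeAlgebra.lift_ι_apply, FreeAlgebra.lift_ι_apply, hD, hE, e,
      ← List.append_nil u, e']
    simpa [Event.punctures] using ofWord_circle (r := r) (n := n) hb hi
  | empty D hD =>
    rw [FreeAlgebra.lift_ι_apply, hD, map_one, ← ofWord_empty (r := r) (n := n)]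
    congr 1
    clear hD D split
    subst hm hn
    induction Bs with
    | nil => rfl
    | cons b Bs ih =>
      rw [List.length_cons, List.replicate_succ, blockWord_punct, ih, List.map_cons, List.sum_cons,
        List.replicate_add]
      congr 1
      simp [punctRow, List.map_const']
  | superposition D E F h =>
    rw [map_mul, FreeAlgebra.lift_ι_apply, FreeAlgebra.lift_ι_apply, FreeAlgebra.lift_ι_apply]
    refine ofWord_superposed ?_
    have := superposed_blockWord h (Bs := Bs) (by rw [(isTangle_iff.1 D.2).2, hm])
    exact this

/-- The homomorphism that replaces each puncture by a row of punctures. -/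
noncomputable def blockHom (r : Rˣ) (n : ℕ) {m : ℕ} (Bs : List (List Bool)) (hm : Bs.length = m)
    (hn : (Bs.map List.length).sum = n) : SkeinAlgebra r m →ₐ[R] SkeinAlgebra r n :=
  RingQuot.liftAlgHom R ⟨FreeAlgebra.lift R (fun D : LinkDiagram m => ofWord r n (blockWord 0 Bs D.1)),
    fun _ _ h => skeinRel_blockWord hm hn h⟩

theorem blockHom_ofWord {m : ℕ} {Bs : List (List Bool)} (hm : Bs.length = m)
    (hn : (Bs.map List.length).sum = n) {w : List Slice} (hw : IsTangle 0 m w) :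
    blockHom r n Bs hm hn (ofWord r m w) = ofWord r n (blockWord 0 Bs w) := by
  rw [ofWord_eq hw]
  unfold ofDiagram blockHom
  rw [RingQuot.liftAlgHom_mkAlgHom_apply]
  exact FreeAlgebra.lift_ι_apply _ _

/-- The marks of the punctures of a row, given the marks of the row and of the punctures. -/
def expand : List Bool → List (List Bool) → List Bool
  | x :: B, b :: Bs => b.map (x && ·) ++ expand B Bs
  | _, _ => []

/-- Between its birth and its death a curve has two strands, so a puncture moved to the top is
outside it, in the same position as a puncture that is not encircled. -/
theorem blockWord_curveB {B : List Bool} {Bs : List (List Bool)} (h : B.length = Bs.length) :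
    blockWord 0 Bs (curveB B) = curveB (expand B Bs) := by
  rw [curveB, blockWord_cons (by simp), curveB]
  congr 1
  simp only [Event.ins, Event.outs, Nat.sub_zero, zero_add]
  induction B generalizing Bs with
  | nil =>
    obtain rfl : Bs = [] := List.eq_nil_of_length_eq_zero h.symm
    rfl
  | cons x B ih =>
    obtain ⟨b, Bs, rfl⟩ := List.exists_cons_of_length_pos (show 0 < Bs.length by simp at h; omega)
    have := ih (Bs := Bs) (by simpa using h)
    simp only [curveTail, List.map_cons, List.cons_append] at this ⊢
    rw [blockWord_punct, this, expand, List.map_append, List.append_assoc]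
    congr 1
    simp only [punctRow, List.map_map, List.map_inj_left, Function.comp_apply]
    intro y _
    cases x <;> cases y <;> rfl

theorem isTangle_curveB (B : List Bool) : IsTangle 0 B.length (curveB B) := by
  refine isTangle_iff.2 ⟨runs_cons.2 ⟨Nat.zero_le _, ?_⟩, ?_⟩
  · simp only [Event.ins, Event.outs, Nat.sub_zero, zero_add]
    induction B with
    | nil => exact runs_cons.2 ⟨le_rfl, runs_nil.2 rfl⟩
    | cons b B ih => exact runs_cons.2 ⟨by cases b <;> simp [Event.ins], ih⟩
  · rw [curveB, numPunct_cons]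
    simp only [Event.punctures, zero_add]
    induction B with
    | nil => rfl
    | cons b B ih =>
      rw [curveTail, List.map_cons, List.cons_append, numPunct_cons, List.length_cons, add_comm]
      exact congrArg (· + 1) ih

theorem t_eq_ofWord (S : Finset (Fin n)) :
    t r S = ofWord r n (curveB ((List.finRange n).map fun k => decide (k ∈ S))) := by
  have h : curveWord n S = curveB ((List.finRange n).map fun k => decide (k ∈ S)) := by
    unfold curveWord curveB curveTail
    rw [List.map_map, ← List.cons_append]
    congr 3
    funext k
    by_cases h : k ∈ S <;> simp [h]
  rw [← h]
  exact (ofWord_val (curve n S)).symm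

end SkeinAlgebra

namespace SkeinAlgebra

open Slice

variable {R : Type*} [CommRing R] {r : Rˣ} {n : ℕ}

theorem induction_on {p : SkeinAlgebra r n → Prop} (hw : ∀ w, IsTangle 0 n w → p (ofWord r n w))
    (ha : ∀ c : R, p (algebraMap R _ c)) (hadd : ∀ x y, p x → p y → p (x + y))
    (hmul : ∀ x y, p x → p y → p (x * y)) (z : SkeinAlgebra r n) : p z := by
  obtain ⟨y, rfl⟩ := RingQuot.mkAlgHom_surjective R (SkeinRel r n) z
  induction y using FreeAlgebra.induction with
  | grade0 c => rw [AlgHom.commutes]; exact ha c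
  | grade1 D =>
    have h := hw D.1 D.2
    rw [ofWord_val] at h
    exact h
  | mul x y hx hy => rw [map_mul]; exact hmul _ _ hx hy
  | add x y hx hy => rw [map_add]; exact hadd _ _ hx hy

/-! ### Loops around a puncture -/

/-- A stretch without upper strands is a superposition of bare punctures above it. It is used on
both sides of a small loop. -/
theorem superposed_lower {k m : ℕ} {w x y z : List Slice} (hw : Runs k w m)
    (h : Superposed (List.replicate m false) x y z) :
    Superposed (List.replicate k false) (w ++ x)
      (List.replicate (numPunct w) (punct 0) ++ y) (w ++ z) := by
  induction w generalizing k with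
  | nil =>
    obtain rfl := runs_nil.1 hw
    exact h
  | cons s w ih =>
    obtain ⟨e, i⟩ := s
    obtain ⟨h1, h2⟩ := runs_cons.1 hw
    obtain ⟨j, rfl⟩ := Nat.exists_eq_add_of_le h1
    simp only at h2
    rw [show i + e.ins + j - e.ins + e.outs = i + e.outs + j by omega] at h2
    have ih := ih h2
    cases e with
    | birth =>
      exact (Superposed.birthLower (List.replicate i false) (List.replicate j false) _ _ _
        (ih.cast (by simp [Event.outs, List.replicate_add, -List.replicate_append_replicate])
          rfl rfl rfl)).cast (by simp [Event.ins]) (by simp) (by simp [Event.punctures]) (by simp)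
    | death =>
      exact (Superposed.deathLower (List.replicate i false) (List.replicate j false) _ _ _
        (ih.cast (by simp [Event.outs]) rfl rfl rfl)).cast
          (by simp [Event.ins, List.replicate_add, -List.replicate_append_replicate])
          (by simp) (by simp [Event.punctures]) (by simp)
    | cross b =>
      exact (Superposed.crossLower b (List.replicate i false) (List.replicate j false) _ _ _
        (ih.cast (by simp [Event.outs, List.replicate_add, -List.replicate_append_replicate])
          rfl rfl rfl)).cast
          (by simp [Event.ins, List.replicate_add, -List.replicate_append_replicate])
          (by simp) (by simp [Event.punctures]) (by simp)
    | punct =>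
      exact (Superposed.punct (List.replicate i false) (List.replicate j false) _ _ _
        (ih.cast (by simp [Event.outs]) rfl rfl rfl)).cast (by simp [Event.ins])
          (by simp) (by simp [Event.punctures, List.count_replicate, add_comm 1,
            List.replicate_succ]) (by simp)

theorem superposed_upper {k m : ℕ} {w x y z : List Slice} (hw : Runs k w m)
    (h : Superposed (List.replicate m true) x y z) :
    Superposed (List.replicate k true) (w ++ x) (w ++ y)
      (List.replicate (numPunct w) (punct 0) ++ z) := by
  induction w generalizing k with
  | nil =>
    obtain rfl := runs_nil.1 hw
    exact h
  | cons s w ih =>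
    obtain ⟨e, i⟩ := s
    obtain ⟨h1, h2⟩ := runs_cons.1 hw
    obtain ⟨j, rfl⟩ := Nat.exists_eq_add_of_le h1
    simp only at h2
    rw [show i + e.ins + j - e.ins + e.outs = i + e.outs + j by omega] at h2
    have ih := ih h2
    cases e with
    | birth =>
      exact (Superposed.birthUpper (List.replicate i true) (List.replicate j true) _ _ _
        (ih.cast (by simp [Event.outs, List.replicate_add, -List.replicate_append_replicate])
          rfl rfl rfl)).cast (by simp [Event.ins]) (by simp) (by simp) (by simp [Event.punctures])
    | death =>
      exact (Superposed.deathUpper (List.replicate i true) (List.replicate j true) _ _ _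
        (ih.cast (by simp [Event.outs]) rfl rfl rfl)).cast
          (by simp [Event.ins, List.replicate_add, -List.replicate_append_replicate])
          (by simp) (by simp) (by simp [Event.punctures])
    | cross b =>
      exact (Superposed.crossUpper b (List.replicate i true) (List.replicate j true) _ _ _
        (ih.cast (by simp [Event.outs, List.replicate_add, -List.replicate_append_replicate])
          rfl rfl rfl)).cast
          (by simp [Event.ins, List.replicate_add, -List.replicate_append_replicate])
          (by simp) (by simp) (by simp [Event.punctures])
    | punct =>
      exact (Superposed.punct (List.replicate i true) (List.replicate j true) _ _ _
        (ih.cast (by simp [Event.outs]) rfl rfl rfl)).cast (by simp [Event.ins])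
          (by simp) (by simp) (by simp [Event.punctures, List.count_replicate, add_comm 1,
            List.replicate_succ])

/-- Insert a loop around a puncture. -/
def loopWord (u : List Slice) (j : ℕ) (v : List Slice) : List Slice :=
  u ++ birth j :: punct (j + 1) :: death j :: v

/-- A tight loop around a puncture crosses no other strand, so it may be regarded as lying above the
rest of the diagram, and equally well (`superposed_loop_right`) as lying below it. -/
theorem superposed_loop_left {u v : List Slice} {j m : ℕ} (hu : Runs 0 u m) (hj : j ≤ m)
    (hv : Runs m v 0) :
    Superposed [] (loopWord u j v)
      (loopWord (List.replicate (numPunct u) (punct 0)) 0 (List.replicate (numPunct v) (punct 0)))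
      (u ++ punct j :: v) := by
  obtain ⟨k, rfl⟩ := Nat.exists_eq_add_of_le hj
  have h1 := superposed_lower hv (x := []) (y := []) (z := []) .nil
  simp only [List.append_nil] at h1
  have h2 := Superposed.deathUpper (List.replicate j false) (List.replicate k false) _ _ _
    (h1.cast (by simp) rfl rfl rfl)
  have h3 := Superposed.punct (List.replicate j false ++ [true]) (true :: List.replicate k false)
    _ _ _ (h2.cast (by simp) rfl rfl rfl)
  have h4 := Superposed.birthUpper (List.replicate j false) (List.replicate k false) _ _ _
    (h3.cast (by simp) rfl rfl rfl)
  refine (superposed_lower hu (h4.cast ?_ rfl rfl rfl)).cast ?_ ?_ ?_ ?_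
  all_goals simp [loopWord, List.count_replicate]

theorem superposed_loop_right {u v : List Slice} {j m : ℕ} (hu : Runs 0 u m) (hj : j ≤ m)
    (hv : Runs m v 0) :
    Superposed [] (loopWord u j v) (u ++ punct j :: v)
      (loopWord (List.replicate (numPunct u) (punct 0)) 0
        (List.replicate (numPunct v) (punct 0))) := by
  obtain ⟨k, rfl⟩ := Nat.exists_eq_add_of_le hj
  have h1 := superposed_upper hv (x := []) (y := []) (z := []) .nil
  simp only [List.append_nil] at h1
  have h2 := Superposed.deathLower (List.replicate j true) (List.replicate k true) _ _ _
    (h1.cast (by simp) rfl rfl rfl)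
  have h3 := Superposed.punct (List.replicate j true ++ [false]) (false :: List.replicate k true)
    _ _ _ (h2.cast (by simp) rfl rfl rfl)
  have h4 := Superposed.birthLower (List.replicate j true) (List.replicate k true) _ _ _
    (h3.cast (by simp) rfl rfl rfl)
  refine (superposed_upper hu (h4.cast ?_ rfl rfl rfl)).cast ?_ ?_ ?_ ?_
  all_goals simp [loopWord, List.count_replicate]

/-- The marks of the punctures whose number is in `l`. -/
def bits (n : ℕ) (l : List ℕ) : List Bool := (List.range n).map fun i => l.any (Nat.beq i)

variable (r n) in
/-- The curve around the punctures whose number is in `l`. -/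
noncomputable def tl (l : List ℕ) : SkeinAlgebra r n := ofWord r n (curveB (bits n l))

theorem length_bits (n : ℕ) (l : List ℕ) : (bits n l).length = n := by simp [bits]

theorem any_beq {l : List ℕ} {i : ℕ} : l.any (Nat.beq i) = decide (i ∈ l) := by
  rw [Bool.eq_iff_iff, List.any_eq_true, decide_eq_true_iff]
  constructor
  · rintro ⟨x, hx, h⟩
    exact Nat.eq_of_beq_eq_true h ▸ hx
  · exact fun h => ⟨i, h, Nat.beq_refl i⟩

theorem beq_eq_false_iff {i k : ℕ} : Nat.beq i k = false ↔ i ≠ k := by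
  refine ⟨Nat.ne_of_beq_eq_false, fun h => ?_⟩
  cases hb : Nat.beq i k with
  | false => rfl
  | true => exact absurd (Nat.eq_of_beq_eq_true hb) h

theorem bits_singleton {k l : ℕ} :
    bits (k + (1 + l)) [k] = List.replicate k false ++ true :: List.replicate l false := by
  apply List.ext_getElem
  · simp [bits]; omega
  intro i h1 h2
  simp only [bits, any_beq, List.getElem_map, List.getElem_range, List.mem_singleton]
  rcases lt_trichotomy i k with h | rfl | h
  · rw [List.getElem_append_left (by simpa using h), List.getElem_replicate]
    simp; omega
  · rw [List.getElem_append_right (by simp)]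
    simp
  · rw [List.getElem_append_right (by simp; omega)]
    obtain ⟨d, rfl⟩ := Nat.exists_eq_add_of_lt h
    simp [show k + d + 1 - k = d + 1 by omega]
    omega

/-- The birth of the loop is moved to the left and its death to the right, below the other
punctures, which thereby acquire the two strands of the loop beneath them. This agrees with the
convention that curves pass below the punctures they do not encircle. -/
theorem ofWord_loop {k l : ℕ} (h : k + (1 + l) = n) :
    ofWord r n (loopWord (List.replicate k (punct 0)) 0 (List.replicate l (punct 0))) =
      tl r n [k] := by
  subst h
  rw [tl, bits_singleton]
  have h1 := rel_puncts_event (r := r) (n := k + (1 + l)) (e := .birth) (by simp) (u := []) (m := 0)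
    (j := 0) (runs_nil.2 rfl) (by simp [Event.ins]) (List.replicate k false) (fun _ => 0)
    (fun _ => 2) (fun _ => .inr ⟨by simp [Event.ins], le_rfl, rfl⟩)
  have hr (j : ℕ) : Runs 2 (List.replicate j (punct 2)) 2 := by
    induction j with
    | zero => exact runs_nil.2 rfl
    | succ j ih => exact runs_cons.2 ⟨by simp [Event.ins], ih⟩
  have h2 := rel_puncts_event (r := r) (n := k + (1 + l)) (e := .death) (by simp)
    (u := birth 0 :: List.replicate k (punct 2) ++ [punct 1]) (m := 2)
    (j := 0) (runs_snoc_punct.2 ⟨2, runs_cons.2 ⟨by simp [Event.ins], hr k⟩, by simp, rfl⟩)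
    (by simp [Event.ins]) (List.replicate l false) (fun _ => 2)
    (fun _ => 0) (fun _ => .inr ⟨by simp [Event.ins], le_rfl, rfl⟩)
  have e1 := h1.2.2 (punct 1 :: death 0 :: List.replicate l (punct 0))
  have e2 := h2.2.2 []
  rw [one_smul] at e1 e2
  simp only [List.map_replicate, List.append_nil, List.nil_append, List.append_assoc,
    List.cons_append] at e1 e2
  rw [loopWord, e1, ← e2]
  simp [curveB, curveTail]

theorem ofWord_loopWord {u v : List Slice} {j : ℕ} (h : IsTangle 0 n (u ++ punct j :: v)) :
    ofWord r n (loopWord u j v) = tl r n [numPunct u] * ofWord r n (u ++ punct j :: v) ∧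
    ofWord r n (loopWord u j v) = ofWord r n (u ++ punct j :: v) * tl r n [numPunct u] := by
  obtain ⟨h1, h2⟩ := isTangle_iff.1 h
  obtain ⟨m, hm, h3⟩ := runs_append.1 h1
  obtain ⟨h4, h5⟩ := runs_cons.1 h3
  rw [← ofWord_loop (k := numPunct u) (l := numPunct v)
    (by simpa [Event.punctures] using h2)]
  exact ⟨ofWord_superposed (superposed_loop_left hm h4 h5),
    ofWord_superposed (superposed_loop_right hm h4 h5)⟩

theorem exists_punct {k : ℕ} {w : List Slice} (h : k < numPunct w) :
    ∃ u j v, w = u ++ punct j :: v ∧ numPunct u = k := by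
  induction w generalizing k with
  | nil => exact absurd h (Nat.not_lt_zero _)
  | cons s w ih =>
    obtain ⟨e, i⟩ := s
    by_cases he : e = .punct ∧ k = 0
    · obtain ⟨rfl, rfl⟩ := he
      exact ⟨[], i, w, rfl, rfl⟩
    · have hk : k - e.punctures < numPunct w ∧ e.punctures ≤ k := by
        rw [numPunct_cons] at h
        cases e <;> simp [Event.punctures] at h he ⊢ <;> omega
      obtain ⟨u, j, v, rfl, hu⟩ := ih hk.1
      exact ⟨⟨e, i⟩ :: u, j, v, rfl, by
        rw [numPunct_cons, hu]; exact Nat.add_sub_cancel' hk.2⟩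

/-- For a diagram both products are the class of the diagram with a tight loop inserted at puncture
k; diagrams generate the algebra. -/
theorem commute_loop {k : ℕ} (hk : k < n) (z : SkeinAlgebra r n) : tl r n [k] * z = z * tl r n [k] := by
  induction z using induction_on with
  | hw w hw =>
    obtain ⟨u, j, v, rfl, rfl⟩ := exists_punct (by rwa [(isTangle_iff.1 hw).2])
    exact (ofWord_loopWord hw).1.symm.trans (ofWord_loopWord hw).2
  | ha c => exact (Algebra.commutes c _).symm
  | hadd x y hx hy => rw [mul_add, add_mul, hx, hy]
  | hmul x y hx hy => rw [← mul_assoc, hx, mul_assoc, hy, mul_assoc]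

/-! ### Filling a puncture -/

/-- The blocks for the move of puncture `k` to the top. -/
def fillBlocks (n k : ℕ) : List (List Bool) := (List.range n).map fun i => [!(Nat.beq i k)]

theorem length_fillBlocks (n k : ℕ) : (fillBlocks n k).length = n := by simp [fillBlocks]

theorem sum_fillBlocks (n k : ℕ) : ((fillBlocks n k).map List.length).sum = n := by
  simp [fillBlocks, List.map_map, Function.comp_def]

variable (r n) in
/-- The homomorphism that moves puncture `k` to the top. -/
noncomputable def fill (k : ℕ) : SkeinAlgebra r n →ₐ[R] SkeinAlgebra r n :=
  blockHom r n (fillBlocks n k) (length_fillBlocks n k) (sum_fillBlocks n k)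

theorem expand_map {ι : Type*} (L : List ι) (f g : ι → Bool) :
    expand (L.map f) (L.map fun i => [g i]) = L.map fun i => f i && g i := by
  induction L with
  | nil => rfl
  | cons i L ih => simp [expand, ih]

/-- Once puncture k has been lifted above all strands, no curve encircles it any more. -/
theorem fill_tl (k : ℕ) (l : List ℕ) : fill r n k (tl r n l) = tl r n (l.filter (· ≠ k)) := by
  have h := isTangle_curveB (bits n l)
  rw [length_bits] at h
  rw [tl, fill, blockHom_ofWord _ _ h, blockWord_curveB (by simp [length_bits, length_fillBlocks]),
    tl]
  congr 2
  rw [fillBlocks, bits, expand_map, bits]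
  refine List.map_congr_left fun i _ => ?_
  rw [any_beq, any_beq, Bool.eq_iff_iff]
  simp only [Bool.and_eq_true, decide_eq_true_iff, List.mem_filter, Bool.not_eq_true',
    beq_eq_false_iff]

/-- A puncture stays in place under both substitutions only if neither of them lifts it. It follows
that fillings of punctures commute. -/
theorem blockWord_blockWord (m : ℕ) {ι : Type*} (L : List ι) (f g : ι → Bool) (w : List Slice) :
    blockWord m (L.map fun i => [f i]) (blockWord m (L.map fun i => [g i]) w) =
      blockWord m (L.map fun i => [f i && g i]) w := by
  induction w generalizing m L with
  | nil => simp
  | cons s w ih =>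
    obtain ⟨e, i⟩ := s
    by_cases he : e = .punct
    · subst he
      cases L with
      | nil => exact ih m []
      | cons x L =>
        have := ih m L
        simp only [List.map_cons, blockWord_punct, punctRow, List.map_nil, List.cons_append,
          List.nil_append, this]
        cases f x <;> cases g x <;> rfl
    · simp only [blockWord_cons he, ih]

theorem fill_ofWord {k : ℕ} {w : List Slice} (hw : IsTangle 0 n w) :
    fill r n k (ofWord r n w) = ofWord r n (blockWord 0 (fillBlocks n k) w) :=
  blockHom_ofWord _ _ hw

theorem fill_comm (i j : ℕ) (z : SkeinAlgebra r n) :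
    fill r n i (fill r n j z) = fill r n j (fill r n i z) := by
  have h (k : ℕ) {w : List Slice} (hw : IsTangle 0 n w) :
      IsTangle 0 n (blockWord 0 (fillBlocks n k) w) := by
    have := isTangle_blockWord hw (length_fillBlocks n k)
    rwa [sum_fillBlocks] at this
  induction z using induction_on with
  | hw w hw =>
    rw [fill_ofWord hw, fill_ofWord hw, fill_ofWord (h j hw), fill_ofWord (h i hw), fillBlocks,
      fillBlocks, blockWord_blockWord, blockWord_blockWord]
    simp only [Bool.and_comm]
  | ha c => simp only [AlgHom.commutes]
  | hadd x y hx hy => simp only [map_add, hx, hy]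
  | hmul x y hx hy => simp only [map_mul, hx, hy]

theorem blockWord_true (m : ℕ) {Bs : List (List Bool)} {w : List Slice}
    (h : ∀ i < numPunct w, Bs[i]? = some [true]) : blockWord m Bs w = w := by
  induction w generalizing m Bs with
  | nil => simp
  | cons s w ih =>
    obtain ⟨e, i⟩ := s
    by_cases he : e = .punct
    · subst he
      have h0 := h 0 (by simp [Event.punctures])
      cases Bs with
      | nil => simp at h0
      | cons b Bs =>
        obtain rfl : b = [true] := by simpa using h0
        rw [blockWord_punct, ih m fun i hi => ?_]
        · rfl
        · have := h (i + 1) (by simp [Event.punctures]; omega)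
          simpa using this
    · have h0 : e.punctures = 0 := by cases e <;> first | rfl | exact absurd rfl he
      rw [blockWord_cons he, ih _ fun i hi => h i (by rwa [numPunct_cons, h0, zero_add])]

/-- The position of the puncture equals the number of strands, so it is already above all of them
and lifting it changes nothing. -/
theorem fill_ofWord_top {u v : List Slice} {j : ℕ} (hu : Runs 0 u j)
    (h : IsTangle 0 n (u ++ punct j :: v)) :
    fill r n (numPunct u) (ofWord r n (u ++ punct j :: v)) = ofWord r n (u ++ punct j :: v) := by
  have hn := (isTangle_iff.1 h).2
  simp only [numPunct_append, numPunct_cons, Event.punctures] at hn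
  rw [fill_ofWord h, blockWord_append hu _ (by rw [length_fillBlocks]; omega)]
  congr 2
  · refine blockWord_true 0 fun i hi => ?_
    rw [fillBlocks, List.getElem?_map, List.getElem?_range (by omega)]
    simp [beq_eq_false_iff.2 (show i ≠ numPunct u by omega)]
  · have hd : (fillBlocks n (numPunct u)).drop (numPunct u) =
        [false] :: (fillBlocks n (numPunct u)).drop (numPunct u + 1) := by
      rw [List.drop_eq_getElem_cons (by rw [length_fillBlocks]; omega)]
      simp [fillBlocks]
    rw [hd, blockWord_punct, blockWord_true j fun i hi => ?_]
    · rfl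
    · rw [List.getElem?_drop, fillBlocks, List.getElem?_map, List.getElem?_range (by omega)]
      simp [beq_eq_false_iff.2 (show numPunct u + 1 + i ≠ numPunct u by omega)]

theorem tl_nil : tl r n [] = -qTwo r • 1 := by
  have hr (j : ℕ) : Runs 2 (List.replicate j (punct 2)) 2 := by
    induction j with
    | zero => exact runs_nil.2 rfl
    | succ j ih => exact runs_cons.2 ⟨by simp [Event.ins], ih⟩
  have h2 := rel_puncts_event (r := r) (n := n) (e := .death) (by simp)
    (u := [birth 0]) (m := 2) (j := 0) (runs_cons.2 ⟨by simp [Event.ins], runs_nil.2 rfl⟩)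
    (by simp [Event.ins]) (List.replicate n false) (fun _ => 2)
    (fun _ => 0) (fun _ => .inr ⟨by simp [Event.ins], le_rfl, rfl⟩)
  have e2 := h2.2.2 []
  rw [one_smul] at e2
  simp only [List.map_replicate, List.append_nil, List.append_assoc, List.nil_append,
    List.cons_append] at e2
  have h3 := ofWord_circle (r := r) (n := n) (u := []) (v := List.replicate n (punct 0)) (i := 0)
    (m := 0) (runs_nil.2 rfl) le_rfl
  rw [List.nil_append, List.nil_append, ofWord_empty] at h3
  refine Eq.trans ?_ (e2.trans h3)
  rw [tl]
  congr 1
  simp [curveB, curveTail, bits, List.map_const']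

/-! ### Projectors -/

variable (r n) in
/-- The linear map that annihilates the loops around puncture `k`. -/
noncomputable def proj (β : R) (k : ℕ) : SkeinAlgebra r n →ₗ[R] SkeinAlgebra r n :=
  LinearMap.id + β • (LinearMap.mulLeft R (tl r n [k]) ∘ₗ (fill r n k).toLinearMap)

theorem proj_apply (β : R) (k : ℕ) (z : SkeinAlgebra r n) :
    proj r n β k z = z + β • (tl r n [k] * fill r n k z) := rfl

theorem fill_loop_self (k : ℕ) : fill r n k (tl r n [k]) = -qTwo r • 1 := by
  rw [fill_tl, ← tl_nil]
  simp

theorem fill_loop_of_ne {i k : ℕ} (h : i ≠ k) : fill r n k (tl r n [i]) = tl r n [i] := by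
  rw [fill_tl]
  simp [h]

/-- Centrality of the loop lets the fixed factor x be pulled out to the left of t_k; a fixed factor
on the right needs no centrality. -/
theorem proj_mul_left {β : R} {k : ℕ} (hk : k < n) {x : SkeinAlgebra r n} (hx : fill r n k x = x)
    (y : SkeinAlgebra r n) : proj r n β k (x * y) = x * proj r n β k y := by
  rw [proj_apply, proj_apply, map_mul, hx, ← mul_assoc, commute_loop hk, mul_add, mul_smul_comm,
    mul_assoc]

theorem proj_mul_right {β : R} {k : ℕ} {y : SkeinAlgebra r n} (hy : fill r n k y = y)
    (x : SkeinAlgebra r n) : proj r n β k (x * y) = proj r n β k x * y := by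
  rw [proj_apply, proj_apply, map_mul, hy, add_mul, smul_mul_assoc, mul_assoc]

/-- After filling, the loop is a trivial circle with value -(q + q⁻¹), which the factor β normalizes
to -1. -/
theorem proj_loop {β : R} (hβ : qTwo r * β = 1) (k : ℕ) : proj r n β k (tl r n [k]) = 0 := by
  rw [proj_apply, fill_loop_self, mul_smul_comm, mul_one, smul_smul, mul_neg, mul_comm, hβ]
  module

variable (r n) in
/-- The span of the multiples `t_i y` with `i ∈ J` of elements `y` with puncture `i` filled. -/
def killed (J : List ℕ) : Submodule R (SkeinAlgebra r n) :=
  Submodule.span R {x | ∃ i ∈ J, i < n ∧ ∃ y, fill r n i y = y ∧ x = tl r n [i] * y}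

theorem killed_mono {I J : List ℕ} (h : ∀ i ∈ I, i ∈ J) : killed r n I ≤ killed r n J :=
  Submodule.span_mono fun _ ⟨i, hi, hx⟩ => ⟨i, h i hi, hx⟩

/-- Terms may thus be discarded during the computation of a product, provided that the factors still
to come do not involve the indices in J. -/
theorem mul_mem_killed {J : List ℕ} {x z : SkeinAlgebra r n} (hx : ∀ i ∈ J, fill r n i x = x)
    (hz : z ∈ killed r n J) : x * z ∈ killed r n J := by
  induction hz using Submodule.span_induction with
  | mem z hz =>
    obtain ⟨i, hi, hn, y, hy, rfl⟩ := hz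
    refine Submodule.subset_span ⟨i, hi, hn, x * y, by rw [map_mul, hx i hi, hy], ?_⟩
    rw [← mul_assoc, ← mul_assoc, commute_loop hn]
  | zero => simp
  | add y z _ _ hy hz => rw [mul_add]; exact add_mem hy hz
  | smul c z _ hz => rw [mul_smul_comm]; exact Submodule.smul_mem _ c hz

variable (r n) in
/-- The composition of projectors. -/
noncomputable def projAll (β : R) : List ℕ → SkeinAlgebra r n →ₗ[R] SkeinAlgebra r n
  | [] => LinearMap.id
  | i :: I => proj r n β i ∘ₗ projAll β I

theorem fill_projAll {β : R} {k : ℕ} {I : List ℕ} (hk : k ∉ I) (z : SkeinAlgebra r n) :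
    fill r n k (projAll r n β I z) = projAll r n β I (fill r n k z) := by
  induction I with
  | nil => rfl
  | cons i I ih =>
    simp only [List.mem_cons, not_or] at hk
    rw [projAll, LinearMap.comp_apply, LinearMap.comp_apply, proj_apply, proj_apply, map_add,
      map_smul, map_mul, fill_loop_of_ne (Ne.symm hk.1), fill_comm k i, ih hk.2]

theorem projAll_mul_left {β : R} {I : List ℕ} (hI : ∀ i ∈ I, i < n) {x : SkeinAlgebra r n}
    (hx : ∀ i ∈ I, fill r n i x = x) (y : SkeinAlgebra r n) :
    projAll r n β I (x * y) = x * projAll r n β I y := by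
  induction I with
  | nil => rfl
  | cons i I ih =>
    rw [List.forall_mem_cons] at hI hx
    rw [projAll, LinearMap.comp_apply, LinearMap.comp_apply, ih hI.2 hx.2,
      proj_mul_left hI.1 hx.1]

/-- The projectors of other indices leave the factor t_i alone and preserve being fixed by fill_i,
so the projector of i still meets a multiple of t_i of the kind it annihilates. -/
theorem projAll_killed {β : R} (hβ : qTwo r * β = 1) {I : List ℕ} (hI : ∀ i ∈ I, i < n)
    (hd : I.Nodup) {z : SkeinAlgebra r n} (hz : z ∈ killed r n I) : projAll r n β I z = 0 := by
  induction hz using Submodule.span_induction with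
  | zero => simp
  | add y z _ _ hy hz => rw [map_add, hy, hz, add_zero]
  | smul c z _ hz => rw [map_smul, hz, smul_zero]
  | mem z hz =>
    obtain ⟨i, hi, hn, y, hy, rfl⟩ := hz
    induction I with
    | nil => simp at hi
    | cons j I ih =>
      rw [List.forall_mem_cons] at hI
      rw [List.nodup_cons] at hd
      rw [projAll, LinearMap.comp_apply]
      by_cases hij : i = j
      · subst hij
        rw [projAll_mul_left hI.2 fun k hk =>
            fill_loop_of_ne (by rintro rfl; exact hd.1 hk),
          proj_mul_right (by rw [fill_projAll hd.1, hy]), proj_loop hβ, zero_mul]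
      · rw [ih hI.2 hd.2 ((List.mem_cons.1 hi).resolve_left hij), map_zero]

end SkeinAlgebra

namespace SkeinAlgebra

open Slice

variable {R : Type*} [CommRing R] {r : Rˣ} {n : ℕ}

/-! ### Loops in linear combinations of words -/

/-- The number of punctures of a word. -/
def Stk.np : Stk → ℕ
  | .nil => 0
  | .b _ w => w.np
  | .d _ w => w.np
  | .p _ w => Nat.succ w.np

/-- The number of strands at the end of a word. -/
def Stk.width : Stk → ℕ
  | .nil => 0
  | .b _ w => Nat.add w.width 2
  | .d _ w => Nat.sub w.width 2
  | .p _ w => w.width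

theorem Stk.np_eq (w : Stk) : w.np = numPunct w.word := by
  induction w with
  | nil => rfl
  | b i w ih => simpa [Stk.np, Stk.word, Event.punctures] using ih
  | d i w ih => simpa [Stk.np, Stk.word, Event.punctures] using ih
  | p i w ih => simpa [Stk.np, Stk.word, Event.punctures] using ih

theorem Stk.width_eq {w : Stk} {m : ℕ} (h : Runs 0 w.word m) : w.width = m := by
  induction w generalizing m with
  | nil => exact runs_nil.1 h
  | b i w ih =>
    obtain ⟨l, hl, -, rfl⟩ := runs_snoc_birth.1 h
    simp [Stk.width, ih hl]
  | d i w ih =>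
    obtain ⟨l, hl, -, rfl⟩ := runs_snoc_death.1 h
    simp [Stk.width, ih hl]
  | p i w ih =>
    obtain ⟨l, hl, -, rfl⟩ := runs_snoc_punct.1 h
    simp [Stk.width, ih hl]

/-- Insert a loop around puncture `k`. -/
def addLoop (k : ℕ) : Stk → Stk
  | .nil => .nil
  | .b j w => .b j (addLoop k w)
  | .d j w => .d j (addLoop k w)
  | .p j w =>
    bif Nat.beq w.np k then .d j (.p (Nat.succ j) (.b j w)) else .p j (addLoop k w)

theorem word_addLoop {k : ℕ} {w : Stk} (h : k < numPunct w.word) :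
    ∃ u j v, w.word = u ++ punct j :: v ∧ numPunct u = k ∧ (addLoop k w).word = loopWord u j v := by
  induction w with
  | nil => exact absurd h (Nat.not_lt_zero _)
  | b i w ih =>
    obtain ⟨u, j, v, h1, h2, h3⟩ := ih (by simpa [Stk.word, Event.punctures] using h)
    exact ⟨u, j, v ++ [birth i], by simp [Stk.word, h1], h2,
      by simp [addLoop, Stk.word, h3, loopWord]⟩
  | d i w ih =>
    obtain ⟨u, j, v, h1, h2, h3⟩ := ih (by simpa [Stk.word, Event.punctures] using h)
    exact ⟨u, j, v ++ [death i], by simp [Stk.word, h1], h2,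
      by simp [addLoop, Stk.word, h3, loopWord]⟩
  | p i w ih =>
    rw [addLoop]
    cases hk : Nat.beq w.np k with
    | true =>
      refine ⟨w.word, i, [], rfl, ?_, by simp [Stk.word, loopWord]⟩
      rw [← Stk.np_eq, Nat.eq_of_beq_eq_true hk]
    | false =>
      have hk := beq_eq_false_iff.1 hk
      rw [Stk.np_eq] at hk
      obtain ⟨u, j, v, h1, h2, h3⟩ := ih (by
        simp [Stk.word, Event.punctures] at h; omega)
      exact ⟨u, j, v ++ [punct i], by simp [Stk.word, h1], h2,
        by simp [Stk.word, h3, loopWord]⟩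

theorem isTangle_loopWord {u v : List Slice} {j : ℕ} (h : IsTangle 0 n (u ++ punct j :: v)) :
    IsTangle 0 n (loopWord u j v) := by
  obtain ⟨h1, h2⟩ := isTangle_iff.1 h
  obtain ⟨m, hm, h3⟩ := runs_append.1 h1
  obtain ⟨h4, h5⟩ := runs_cons.1 h3
  obtain ⟨k, h6, h7, -⟩ := isTangle_of_superposed (superposed_loop_left hm h4 h5)
  obtain rfl : k = n := by
    rw [← h2, ← (isTangle_iff.1 h6).2]
    simp [loopWord, Event.punctures]
  exact h6

/-- Insert a loop around puncture `k` in all words. -/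
def loopAll (k : ℕ) : Comb → Comb
  | .nil => .nil
  | .cons w x C => .cons (addLoop k w) x (loopAll k C)

/-- Multiplication with a loop only inserts it at its puncture, without any crossing to resolve. -/
theorem combRep_loopAll {k : ℕ} (hk : k < n) {C : Comb} {z : SkeinAlgebra r n}
    (hC : CombRep r n C z) : CombRep r n (loopAll k C) (tl r n [k] * z) := by
  induction hC with
  | nil => rw [mul_zero]; exact .nil
  | cons w x C c z hw hx hC ih =>
    obtain ⟨u, j, v, h1, rfl, h3⟩ := word_addLoop (k := k) (w := w) (by rwa [(isTangle_iff.1 hw).2])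
    rw [h1] at hw
    refine (CombRep.cons _ x _ c _ (h3 ▸ isTangle_loopWord hw) hx ih).congr ?_
    rw [h1, h3, (ofWord_loopWord hw).1, mul_add, mul_smul_comm]

/-- Membership in a list of numbers. -/
def memB (I : List ℕ) (i : ℕ) : Bool := I.any (Nat.beq i)

theorem memB_eq {I : List ℕ} {i : ℕ} : memB I i = decide (i ∈ I) := any_beq

/-- Whether the word ends with a loop around a puncture in `J`, apart from a last death. -/
def topLoop (J : List ℕ) (i : ℕ) : Stk → Bool
  | .p j (.b k v) =>
    and (and (Nat.beq i k) (Nat.beq j (Nat.succ i))) (and (Nat.beq v.width i) (memB J v.np))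
  | _ => false

/-- Whether there is a loop around a puncture in `J`, with no strands above it. -/
def hasLoop (J : List ℕ) : Stk → Bool
  | .nil => false
  | .b _ w => hasLoop J w
  | .p _ w => hasLoop J w
  | .d i w => or (topLoop J i w) (hasLoop J w)

/-- Taking out the loop writes the word as t_i times a word in which puncture i has no strands above
it. The condition on strands above is essential: only then is the cofactor known to be fixed by
fill_i. -/
theorem mem_killed_of_hasLoop {J : List ℕ} {w : Stk} (h : hasLoop J w = true) {x : List Slice}
    (hw : IsTangle 0 n (w.word ++ x)) : ofWord r n (w.word ++ x) ∈ killed r n J := by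
  induction w generalizing x with
  | nil => exact Bool.noConfusion h
  | b i w ih =>
    rw [Stk.word, List.append_assoc] at hw ⊢
    exact ih h hw
  | p i w ih =>
    rw [Stk.word, List.append_assoc] at hw ⊢
    exact ih h hw
  | d i w ih =>
    rw [hasLoop, Bool.or_eq_true] at h
    rcases h with h | h
    · unfold topLoop at h
      split at h
      · next j k v =>
        simp only [Bool.and_eq_true] at h
        obtain ⟨⟨h1, h2⟩, h3, h4⟩ := h
        obtain rfl := Nat.eq_of_beq_eq_true h1
        obtain rfl := Nat.eq_of_beq_eq_true h2
        have h3 := Nat.eq_of_beq_eq_true h3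
        rw [memB_eq, decide_eq_true_iff, Stk.np_eq] at h4
        have e : (Stk.d i (.p (i + 1) (.b i v))).word ++ x = loopWord v.word i x := by
          simp [Stk.word, loopWord]
        rw [e] at hw ⊢
        obtain ⟨h5, h6⟩ := isTangle_iff.1 hw
        obtain ⟨m, h7, h8⟩ := runs_append.1 h5
        obtain rfl : i = m := by rw [← h3, Stk.width_eq h7]
        have h9 : Runs i x 0 := by
          have := (runs_cons.1 (runs_cons.1 (runs_cons.1 h8).2).2).2
          simpa [Event.ins, Event.outs] using this
        have ht : IsTangle 0 n (v.word ++ punct i :: x) := by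
          refine isTangle_iff.2 ⟨h7.append (runs_cons.2 ⟨le_rfl, h9⟩), ?_⟩
          rw [← h6]
          simp [loopWord, Event.punctures]
        rw [(ofWord_loopWord ht).1]
        -- The number of strands before the loop is i, which is also the position of the puncture
        -- once the loop is removed.
        refine Submodule.subset_span ⟨_, h4, ?_, _, fill_ofWord_top h7 ht, rfl⟩
        rw [← h6]
        simp [loopWord, Event.punctures]
      · exact Bool.noConfusion h
    · rw [Stk.word, List.append_assoc] at hw ⊢
      exact ih h hw

/-- Omit the words with a loop around a puncture in `J`, with no strands above it. -/
def prune (J : List ℕ) : Comb → Comb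
  | .nil => .nil
  | .cons w x C => bif hasLoop J w then prune J C else .cons w x (prune J C)

theorem combRep_prune (J : List ℕ) {C : Comb} {z : SkeinAlgebra r n} (hC : CombRep r n C z) :
    ∃ z', CombRep r n (prune J C) z' ∧ z - z' ∈ killed r n J := by
  induction hC with
  | nil => exact ⟨0, .nil, by simp⟩
  | cons w x C c z hw hx hC ih =>
    obtain ⟨z', h1, h2⟩ := ih
    rw [prune]
    cases h : hasLoop J w with
    | true =>
      refine ⟨z', h1, ?_⟩
      have := mem_killed_of_hasLoop (r := r) h (x := []) (by simpa using hw)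
      rw [List.append_nil] at this
      rw [add_sub_assoc]
      exact add_mem (Submodule.smul_mem _ c this) h2
    | false =>
      exact ⟨_, .cons w x _ c _ hw hx h1, by rwa [add_sub_add_left_eq_sub]⟩

/-! ### The generators of the identities -/

/-- The elements `t_i`, `s_{ij}`, `s_{ijk}`. -/
inductive Tok
  | t (i : ℕ)
  | s (i j : ℕ)
  | s3 (i j k : ℕ)

/-- The coefficient of `β² t_i t_j t_k`, given which of the indices are marked. -/
def tripleCoef : Bool → Bool → Bool → ℕ
  | false, false, false => 2
  | true, false, false => 1
  | false, true, false => 1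
  | false, false, true => 1
  | _, _, _ => 0

/-- The value of a generator, up to elements annihilated by the projectors for the marked
indices. -/
noncomputable def Tok.val (r : Rˣ) (n : ℕ) (β : R) (f : ℕ → Bool) : Tok → SkeinAlgebra r n
  | .t i => tl r n [i]
  | .s i j => bif Nat.beq i j then qTwo r • 1 - β • (tl r n [i] * tl r n [i])
    else tl r n [i, j] + bif and (f i) (f j) then 0 else β • (tl r n [i] * tl r n [j])
  | .s3 i j k => tl r n [i, j, k]
    + (bif f i then 0 else β • (tl r n [i] * tl r n [j, k]))
    + (bif f j then 0 else β • (tl r n [j] * tl r n [i, k]))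
    + (bif f k then 0 else β • (tl r n [k] * tl r n [i, j]))
    + ((tripleCoef (f i) (f j) (f k) : R) * β ^ 2) • (tl r n [i] * (tl r n [j] * tl r n [k]))

/-- Whether an index occurs. -/
def Tok.has (i : ℕ) : Tok → Bool
  | .t a => Nat.beq i a
  | .s a b => or (Nat.beq i a) (Nat.beq i b)
  | .s3 a b c => or (Nat.beq i a) (or (Nat.beq i b) (Nat.beq i c))

/-- Whether the indices are in range, and distinct for a generator with three indices. -/
def Tok.ok (n : ℕ) : Tok → Bool
  | .t a => Nat.blt a n
  | .s a b => and (Nat.blt a n) (Nat.blt b n)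
  | .s3 a b c => and (and (Nat.blt a n) (and (Nat.blt b n) (Nat.blt c n)))
      (not (or (Nat.beq a b) (or (Nat.beq a c) (Nat.beq b c))))

/-- Whether the generator is one of `s_{ij}` for `i ≠ j`, and `s_{ijk}`. -/
def Tok.proper : Tok → Bool
  | .t _ => false
  | .s a b => not (Nat.beq a b)
  | .s3 _ _ _ => true

theorem tl_congr {l l' : List ℕ} (h : ∀ i, i ∈ l ↔ i ∈ l') : tl r n l = tl r n l' := by
  have : bits n l = bits n l' := List.map_congr_left fun i _ => by
    rw [any_beq, any_beq, decide_eq_decide]; exact h i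
  rw [tl, tl, this]

theorem fill_tl_of_notMem {k : ℕ} {l : List ℕ} (h : k ∉ l) : fill r n k (tl r n l) = tl r n l := by
  rw [fill_tl, List.filter_eq_self.2]
  intro a ha
  simpa using fun e : a = k => h (e ▸ ha)

theorem fill_val {β : R} {f : ℕ → Bool} {k : ℕ} {x : Tok} (h : x.has k = false) :
    fill r n k (x.val r n β f) = x.val r n β f := by
  cases x with
  | t a =>
    have h : k ≠ a := beq_eq_false_iff.1 h
    exact fill_tl_of_notMem (by simpa using h)
  | s a b =>
    simp only [Tok.has, Bool.or_eq_false_iff, beq_eq_false_iff] at h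
    have h1 := fill_tl_of_notMem (r := r) (n := n) (k := k) (l := [a]) (by simp [h])
    have h2 := fill_tl_of_notMem (r := r) (n := n) (k := k) (l := [b]) (by simp [h])
    have h3 := fill_tl_of_notMem (r := r) (n := n) (k := k) (l := [a, b]) (by simp [h])
    rw [Tok.val]
    cases Nat.beq a b with
    | true => simp [h1]
    | false => cases and (f a) (f b) <;> simp [h1, h2, h3]
  | s3 a b c =>
    simp only [Tok.has, Bool.or_eq_false_iff, beq_eq_false_iff] at h
    have h1 := fill_tl_of_notMem (r := r) (n := n) (k := k) (l := [a]) (by simp [h])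
    have h2 := fill_tl_of_notMem (r := r) (n := n) (k := k) (l := [b]) (by simp [h])
    have h3 := fill_tl_of_notMem (r := r) (n := n) (k := k) (l := [c]) (by simp [h])
    have h4 := fill_tl_of_notMem (r := r) (n := n) (k := k) (l := [a, b]) (by simp [h])
    have h5 := fill_tl_of_notMem (r := r) (n := n) (k := k) (l := [a, c]) (by simp [h])
    have h6 := fill_tl_of_notMem (r := r) (n := n) (k := k) (l := [b, c]) (by simp [h])
    have h7 := fill_tl_of_notMem (r := r) (n := n) (k := k) (l := [a, b, c]) (by simp [h])
    rw [Tok.val]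
    cases f a <;> cases f b <;> cases f c <;> simp [h1, h2, h3, h4, h5, h6, h7]

/-- Mark one more index. -/
def mark (i : ℕ) (f : ℕ → Bool) (j : ℕ) : Bool := or (Nat.beq j i) (f j)

theorem mark_self (i : ℕ) (f : ℕ → Bool) : mark i f i = true := by simp [mark]

theorem mark_of_ne {i j : ℕ} (h : j ≠ i) (f : ℕ → Bool) : mark i f j = f j := by
  simp [mark, beq_eq_false_iff.2 h]

theorem val_mark {β : R} {f : ℕ → Bool} {k : ℕ} {x : Tok} (h : x.has k = false) :
    x.val r n β (mark k f) = x.val r n β f := by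
  cases x with
  | t a => rfl
  | s a b =>
    simp only [Tok.has, Bool.or_eq_false_iff, beq_eq_false_iff] at h
    rw [Tok.val, Tok.val, mark_of_ne (Ne.symm h.1), mark_of_ne (Ne.symm h.2)]
  | s3 a b c =>
    simp only [Tok.has, Bool.or_eq_false_iff, beq_eq_false_iff] at h
    rw [Tok.val, Tok.val, mark_of_ne (Ne.symm h.1), mark_of_ne (Ne.symm h.2.1),
      mark_of_ne (Ne.symm h.2.2)]

theorem lt_of_blt {a b : ℕ} (h : Nat.blt a b = true) : a < b := Nat.le_of_ble_eq_true h

/-- If b is marked too, the projector creates the missing term β t_a t_b from t_ab. If not, that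
term is already present and is annihilated, but t_ab creates it anew. -/
theorem proj_s {β : R} (hβ : qTwo r * β = 1) {f : ℕ → Bool} {a b : ℕ} (hab : a ≠ b)
    (ha : a < n) (hfa : f a = false) :
    proj r n β a ((Tok.s a b).val r n β (mark a f)) = (Tok.s a b).val r n β f ∧
    proj r n β a ((Tok.s b a).val r n β (mark a f)) = (Tok.s b a).val r n β f := by
  have h1 := fill_loop_self (r := r) (n := n) a
  have h2 : fill r n a (tl r n [b]) = tl r n [b] := fill_loop_of_ne (Ne.symm hab)
  have h3 : fill r n a (tl r n [a, b]) = tl r n [b] := by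
    rw [fill_tl]; simp [Ne.symm hab]
  have h3' : fill r n a (tl r n [b, a]) = tl r n [b] := by
    rw [fill_tl]; simp [Ne.symm hab]
  have e := commute_loop ha (tl r n [b])
  have hβ' : β * qTwo r = 1 := by rw [mul_comm, hβ]
  simp only [Tok.val, mark_self, mark_of_ne (Ne.symm hab), hfa, beq_eq_false_iff.2 hab,
    beq_eq_false_iff.2 (Ne.symm hab), cond_false, Bool.true_and, Bool.false_and, Bool.and_true,
    Bool.and_false, proj_apply]
  cases f b with
  | true => simp [h3, h3', e]
  | false => simp [h1, h2, h3, h3', e, smul_smul, hβ']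

/-- Filling puncture a turns t_abc into t_bc, and t_ab, t_ac into t_b, t_c, so the projector
supplies the omitted terms with factor t_a. The table `tripleCoef` is what this computation
requires. -/
theorem proj_s3 {β : R} (hβ : qTwo r * β = 1) {f : ℕ → Bool} {a b c : ℕ} (hab : a ≠ b)
    (hac : a ≠ c) (hb : b < n) (hfa : f a = false) :
    proj r n β a ((Tok.s3 a b c).val r n β (mark a f)) = (Tok.s3 a b c).val r n β f := by
  have h1 := fill_loop_self (r := r) (n := n) a
  have h2 : fill r n a (tl r n [b]) = tl r n [b] := fill_loop_of_ne (Ne.symm hab)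
  have h3 : fill r n a (tl r n [c]) = tl r n [c] := fill_loop_of_ne (Ne.symm hac)
  have h4 : fill r n a (tl r n [a, b]) = tl r n [b] := by
    rw [fill_tl]; simp [Ne.symm hab]
  have h5 : fill r n a (tl r n [a, c]) = tl r n [c] := by
    rw [fill_tl]; simp [Ne.symm hac]
  have h6 : fill r n a (tl r n [a, b, c]) = tl r n [b, c] := by
    rw [fill_tl]; simp [Ne.symm hac, Ne.symm hab]
  have e := commute_loop hb (tl r n [c])
  simp only [Tok.val, mark_self, mark_of_ne (Ne.symm hab), mark_of_ne (Ne.symm hac), hfa,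
    cond_false, cond_true, proj_apply]
  cases f b <;> cases f c <;>
    simp only [cond_false, cond_true, tripleCoef, map_add, map_mul, map_smul, h1, h2, h3, h4, h5, h6,
      e, smul_mul_assoc, one_mul, mul_smul_comm, mul_add, add_zero,
      Nat.cast_zero, zero_mul, zero_smul, smul_add]
  -- With b and c unmarked, filling produces β t_b t_c twice, and the triple product contributes -β²
  -- (q + q⁻¹) t_b t_c, which cancels one of them. The remaining one raises the coefficient of β²
  -- t_a t_b t_c from 1 to 2.
  · match_scalars <;>
      first | ring1 | linear_combination (-β ^ 2) * hβ
  all_goals module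

/-- Centrality of the loops makes the triple product symmetric. It therefore suffices to treat the
projector of the first index. -/
theorem val_s3_swap₁ {β : R} {f : ℕ → Bool} {a b c : ℕ} (ha : a < n) :
    (Tok.s3 a b c).val r n β f = (Tok.s3 b a c).val r n β f := by
  have h1 : tl r n [a, b, c] = tl r n [b, a, c] := tl_congr fun i => by simp; tauto
  have h2 : tl r n [a, b] = tl r n [b, a] := tl_congr fun i => by simp; tauto
  have h3 : tl r n [a] * (tl r n [b] * tl r n [c]) = tl r n [b] * (tl r n [a] * tl r n [c]) := by
    rw [← mul_assoc, commute_loop ha, mul_assoc]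
  have h4 : tripleCoef (f a) (f b) (f c) = tripleCoef (f b) (f a) (f c) := by
    cases f a <;> cases f b <;> cases f c <;> rfl
  rw [Tok.val, Tok.val, h1, h2, h3, h4]
  abel

theorem val_s3_swap₂ {β : R} {f : ℕ → Bool} {a b c : ℕ} (hb : b < n) :
    (Tok.s3 a b c).val r n β f = (Tok.s3 a c b).val r n β f := by
  have h1 : tl r n [a, b, c] = tl r n [a, c, b] := tl_congr fun i => by simp; tauto
  have h2 : tl r n [b, c] = tl r n [c, b] := tl_congr fun i => by simp; tauto
  have h3 : tl r n [b] * tl r n [c] = tl r n [c] * tl r n [b] := commute_loop hb _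
  have h4 : tripleCoef (f a) (f b) (f c) = tripleCoef (f a) (f c) (f b) := by
    cases f a <;> cases f b <;> cases f c <;> rfl
  rw [Tok.val, Tok.val, h1, h2, h3, h4]
  abel

theorem proj_val {β : R} (hβ : qTwo r * β = 1) {f : ℕ → Bool} {i : ℕ} (hf : f i = false) {x : Tok}
    (hx : x.has i = true) (hp : x.proper = true) (ho : x.ok n = true) :
    proj r n β i (x.val r n β (mark i f)) = x.val r n β f := by
  cases x with
  | t a => exact Bool.noConfusion hp
  | s a b =>
    simp only [Tok.has, Tok.proper, Tok.ok, Bool.or_eq_true, Bool.and_eq_true, Bool.not_eq_true',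
      beq_eq_false_iff] at hx hp ho
    rcases hx with h | h
    · obtain rfl := Nat.eq_of_beq_eq_true h
      exact (proj_s hβ hp (lt_of_blt ho.1) hf).1
    · obtain rfl := Nat.eq_of_beq_eq_true h
      exact (proj_s hβ (Ne.symm hp) (lt_of_blt ho.2) hf).2
  | s3 a b c =>
    simp only [Tok.has, Tok.ok, Bool.or_eq_true, Bool.and_eq_true, Bool.not_eq_true',
      Bool.or_eq_false_iff, beq_eq_false_iff] at hx ho
    obtain ⟨⟨ha, hb, hc⟩, hab, hac, hbc⟩ := ho
    have ha := lt_of_blt ha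
    have hb := lt_of_blt hb
    rcases hx with h | h | h
    · obtain rfl := Nat.eq_of_beq_eq_true h
      exact proj_s3 hβ hab hac hb hf
    · obtain rfl := Nat.eq_of_beq_eq_true h
      rw [val_s3_swap₁ ha, val_s3_swap₁ ha]
      exact proj_s3 hβ (Ne.symm hab) hbc ha hf
    · obtain rfl := Nat.eq_of_beq_eq_true h
      rw [val_s3_swap₂ hb, val_s3_swap₂ hb, val_s3_swap₁ ha, val_s3_swap₁ ha]
      exact proj_s3 hβ (Ne.symm hac) (Ne.symm hbc) ha hf

/-! ### Products of generators -/

/-- Multiply with a generator, up to elements annihilated by the projectors for the indices in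
`I`. -/
def mulTok (n : ℕ) (I : List ℕ) (C : Comb) : Tok → Comb
  | .t i => loopAll i C
  | .s i j =>
    bif Nat.beq i j then
      addScaled 0 0 false 1 0 1 C (addScaled 0 0 true 0 1 1 (loopAll i (loopAll i C)) .nil)
    else bif and (memB I i) (memB I j) then mulT (bits n [i, j]) C .nil
    else addScaled 0 0 false 0 1 1 (loopAll i (loopAll j C)) (mulT (bits n [i, j]) C .nil)
  | .s3 i j k =>
    let C0 := mulT (bits n [i, j, k]) C .nil
    let C1 := bif memB I i then C0
      else addScaled 0 0 false 0 1 1 (loopAll i (mulT (bits n [j, k]) C .nil)) C0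
    let C2 := bif memB I j then C1
      else addScaled 0 0 false 0 1 1 (loopAll j (mulT (bits n [i, k]) C .nil)) C1
    let C3 := bif memB I k then C2
      else addScaled 0 0 false 0 1 1 (loopAll k (mulT (bits n [i, j]) C .nil)) C2
    bif or (and (memB I i) (or (memB I j) (memB I k))) (and (memB I j) (memB I k)) then C3
    else addScaled 0 0 false 0 2 (tripleCoef (memB I i) (memB I j) (memB I k))
      (loopAll i (loopAll j (loopAll k C))) C3

theorem combRep_mulTok {β : R} (hβ : qTwo r * β = 1) {I : List ℕ} {C : Comb}
    {z : SkeinAlgebra r n} (hC : CombRep r n C z) {x : Tok} (hx : x.ok n = true) :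
    CombRep r n (mulTok n I C x) (x.val r n β (memB I) * z) := by
  have hT (l : List ℕ) : CombRep r n (mulT (bits n l) C .nil) (tl r n l * z) :=
    (combRep_mulT hβ (length_bits n l) hC .nil).congr (zero_add _)
  cases x with
  | t i => exact combRep_loopAll (lt_of_blt hx) hC
  | s i j =>
    simp only [Tok.ok, Bool.and_eq_true] at hx
    have hi := lt_of_blt hx.1
    have hj := lt_of_blt hx.2
    rw [mulTok, Tok.val]
    cases Nat.beq i j with
    | true =>
      refine (combRep_addScaled hβ 0 0 false 1 0 1 hC (combRep_addScaled hβ 0 0 true 0 1 1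
        (combRep_loopAll hi (combRep_loopAll hi hC)) .nil)).congr ?_
      simp only [cond_true, cond_false, sub_mul, smul_mul_assoc, one_mul, mul_assoc, pow_zero,
        mul_one, Nat.cast_one, pow_one]
      module
    | false =>
      cases and (memB I i) (memB I j) with
      | true => exact (hT [i, j]).congr (by simp)
      | false =>
        refine (combRep_addScaled hβ 0 0 false 0 1 1
          (combRep_loopAll hi (combRep_loopAll hj hC)) (hT [i, j])).congr ?_
        simp only [cond_false, add_mul, smul_mul_assoc, one_mul, mul_assoc, pow_zero,
          mul_one, Nat.cast_one, pow_one]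
  | s3 i j k =>
    simp only [Tok.ok, Bool.and_eq_true] at hx
    obtain ⟨⟨hi, hj, hk⟩, -⟩ := hx
    have hi := lt_of_blt hi
    have hj := lt_of_blt hj
    have hk := lt_of_blt hk
    have step {a : Bool} {i : ℕ} (hi : i < n) {l : List ℕ} {D : Comb} {y : SkeinAlgebra r n}
        (hD : CombRep r n D y) :
        CombRep r n (bif a then D
          else addScaled 0 0 false 0 1 1 (loopAll i (mulT (bits n l) C .nil)) D)
          (y + (bif a then 0 else β • (tl r n [i] * tl r n l)) * z) := by
      cases a with
      | true => exact hD.congr (by simp)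
      | false =>
        refine (combRep_addScaled hβ 0 0 false 0 1 1 (combRep_loopAll hi (hT l)) hD).congr ?_
        simp only [cond_false, smul_mul_assoc, one_mul, mul_assoc, pow_zero, mul_one, Nat.cast_one,
          pow_one]
    have h3 := step (a := memB I k) hk (l := [i, j]) (step (a := memB I j) hj (l := [i, k])
      (step (a := memB I i) hi (l := [j, k]) (hT [i, j, k])))
    rw [mulTok, Tok.val]
    cases hb : or (and (memB I i) (or (memB I j) (memB I k))) (and (memB I j) (memB I k)) with
    | true =>
      refine h3.congr ?_
      -- Once two of the three indices are marked, the triple product is not needed at all: the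
      -- projectors recreate it.
      have h0 : tripleCoef (memB I i) (memB I j) (memB I k) = 0 := by
        revert hb
        cases memB I i <;> cases memB I j <;> cases memB I k <;> simp [tripleCoef]
      rw [h0, Nat.cast_zero, zero_mul, zero_smul, add_zero]
      simp only [add_mul]
    | false =>
      refine (combRep_addScaled hβ 0 0 false 0 2 _ (combRep_loopAll hi (combRep_loopAll hj
        (combRep_loopAll hk hC))) h3).congr ?_
      simp only [cond_false, add_mul, smul_mul_assoc, one_mul, mul_assoc, pow_zero, mul_one]
      rw [mul_comm (β ^ 2)]

/-- The product of the values of generators. -/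
noncomputable def prodVal (r : Rˣ) (n : ℕ) (β : R) (f : ℕ → Bool) (l : List Tok) :
    SkeinAlgebra r n := (l.map fun x => x.val r n β f).prod

/-- Whether no generator has the index `i`. -/
def notIn (i : ℕ) : List Tok → Bool
  | [] => true
  | x :: l => and (not (x.has i)) (notIn i l)

/-- Whether exactly one generator has the index `i`, and that one is proper. -/
def onceIn (i : ℕ) : List Tok → Bool
  | [] => false
  | x :: l => bif x.has i then and x.proper (notIn i l) else onceIn i l

/-- Whether all generators are in range. -/
def allOk (n : ℕ) : List Tok → Bool
  | [] => true
  | x :: l => and (x.ok n) (allOk n l)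

/-- The indices in `I` that occur. -/
def seen (I : List ℕ) (l : List Tok) : List ℕ := I.filter fun i => not (notIn i l)

theorem fill_prodVal {β : R} {f : ℕ → Bool} {k : ℕ} {l : List Tok} (h : notIn k l = true) :
    fill r n k (prodVal r n β f l) = prodVal r n β f l := by
  induction l with
  | nil => simp [prodVal]
  | cons x l ih =>
    simp only [notIn, Bool.and_eq_true, Bool.not_eq_true'] at h
    have := ih h.2
    rw [prodVal] at this
    rw [prodVal, List.map_cons, List.prod_cons, map_mul, fill_val h.1, this]

theorem prodVal_mark {β : R} {f : ℕ → Bool} {k : ℕ} {l : List Tok} (h : notIn k l = true) :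
    prodVal r n β (mark k f) l = prodVal r n β f l := by
  induction l with
  | nil => rfl
  | cons x l ih =>
    simp only [notIn, Bool.and_eq_true, Bool.not_eq_true'] at h
    have := ih h.2
    rw [prodVal, prodVal] at this
    rw [prodVal, prodVal, List.map_cons, List.map_cons, List.prod_cons, List.prod_cons,
      val_mark h.1, this]

/-- Only one factor has the index i. All the others are fixed by fill_i, so the projector passes
through them and acts on that factor alone. -/
theorem proj_prodVal {β : R} (hβ : qTwo r * β = 1) {f : ℕ → Bool} {i : ℕ} (hi : i < n)
    (hf : f i = false) {l : List Tok} (h : onceIn i l = true) (ho : allOk n l = true) :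
    proj r n β i (prodVal r n β (mark i f) l) = prodVal r n β f l := by
  induction l with
  | nil => exact Bool.noConfusion h
  | cons x l ih =>
    simp only [allOk, Bool.and_eq_true] at ho
    rw [onceIn] at h
    have e (f : ℕ → Bool) : prodVal r n β f (x :: l) = x.val r n β f * prodVal r n β f l := by
      simp [prodVal]
    rw [e, e]
    cases hx : x.has i with
    | true =>
      rw [hx, cond_true, Bool.and_eq_true] at h
      rw [proj_mul_right (fill_prodVal h.2), proj_val hβ hf hx h.1 ho.1, prodVal_mark h.2]
    | false =>
      rw [hx, cond_false] at h
      rw [proj_mul_left hi (fill_val hx), ih h ho.2, val_mark hx]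

/-- The marks are removed one index at a time, each by its own projector. The additional marks f
serve the induction. -/
theorem projAll_prodVal {β : R} (hβ : qTwo r * β = 1) {I : List ℕ} (hI : ∀ i ∈ I, i < n)
    (hd : I.Nodup) {f : ℕ → Bool} (hf : ∀ i ∈ I, f i = false) {l : List Tok}
    (h : ∀ i ∈ I, onceIn i l = true) (ho : allOk n l = true) :
    projAll r n β I (prodVal r n β (fun i => or (memB I i) (f i)) l) = prodVal r n β f l := by
  induction I generalizing f with
  | nil => rfl
  | cons i I ih =>
    rw [List.forall_mem_cons] at hI hf h
    rw [List.nodup_cons] at hd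
    rw [projAll, LinearMap.comp_apply]
    have e : (fun j => or (memB (i :: I) j) (f j)) = fun j => or (memB I j) (mark i f j) := by
      funext j
      simp only [memB, List.any_cons, mark]
      cases Nat.beq j i <;> simp
    rw [e, ih hI.2 hd.2 (fun j hj => ?_) h.2, proj_prodVal hβ hI.1 hf.1 h.1 ho]
    rw [mark_of_ne (by rintro rfl; exact hd.1 hj), hf.2 j hj]

/-- The word without strands. -/
def emptyStk (n : ℕ) : Stk := Nat.rec .nil (fun _ s => .p 0 s) n

theorem word_emptyStk (n : ℕ) : (emptyStk n).word = List.replicate n (punct 0) := by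
  induction n with
  | zero => rfl
  | succ n ih => rw [List.replicate_succ', ← ih]; rfl

/-- The product of generators, up to elements annihilated by the projectors. -/
def prodComb (n : ℕ) (I : List ℕ) : List Tok → Comb
  | [] => .cons (emptyStk n) .one .nil
  | x :: l => prune (seen I (x :: l)) (mulTok n I (prodComb n I l) x)

/-- Products are built from the right, and only loops around indices already seen are discarded:
such an index does not occur in the factors still to come. -/
theorem combRep_prodComb {β : R} (hβ : qTwo r * β = 1) {I : List ℕ} {l : List Tok}
    (ho : allOk n l = true) (h : ∀ i ∈ I, onceIn i l = true ∨ notIn i l = true) :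
    ∃ z, CombRep r n (prodComb n I l) z ∧
      prodVal r n β (memB I) l - z ∈ killed r n (seen I l) := by
  induction l with
  | nil =>
    have h1 : IsTangle 0 n (emptyStk n).word := by
      rw [word_emptyStk]
      have := isTangle_curveB (bits n [])
      refine isTangle_iff.2 ⟨?_, ?_⟩
      · clear this h ho
        induction n with
        | zero => exact runs_nil.2 rfl
        | succ n ih => exact runs_cons.2 ⟨Nat.zero_le _, ih⟩
      · rw [← word_emptyStk, ← Stk.np_eq]
        clear this h ho
        induction n with
        | zero => rfl
        | succ n ih => exact congrArg Nat.succ ih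
    refine ⟨_, .cons _ _ _ _ _ h1 cfRep_one .nil, ?_⟩
    rw [word_emptyStk, ofWord_empty]
    simp [prodVal]
  | cons x l ih =>
    simp only [allOk, Bool.and_eq_true] at ho
    obtain ⟨z, h1, h2⟩ := ih ho.2 fun i hi => by
      rcases h i hi with h | h
      · rw [onceIn] at h
        cases hx : x.has i with
        | true =>
          rw [hx, cond_true, Bool.and_eq_true] at h
          exact .inr h.2
        | false =>
          rw [hx, cond_false] at h
          exact .inl h
      · rw [notIn, Bool.and_eq_true] at h
        exact .inr h.2
    obtain ⟨z', h3, h4⟩ := combRep_prune (seen I (x :: l)) (combRep_mulTok hβ (I := I) h1 ho.1)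
    refine ⟨z', h3, ?_⟩
    -- An index of I seen in l is absent from x, because it occurs at most once; hence x is fixed by
    -- its filling.
    have h5 : x.val r n β (memB I) * (prodVal r n β (memB I) l - z) ∈ killed r n (seen I l) := by
      refine mul_mem_killed (fun i hi => fill_val ?_) h2
      simp only [seen, List.mem_filter, Bool.not_eq_true'] at hi
      rcases h i hi.1 with h | h
      · rw [onceIn] at h
        cases hx : x.has i with
        | true =>
          rw [hx, cond_true, Bool.and_eq_true, hi.2] at h
          exact Bool.noConfusion h.2
        | false => rfl
      · rw [notIn, Bool.and_eq_true, hi.2] at h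
        exact Bool.noConfusion h.2
    have h6 : killed r n (seen I l) ≤ killed r n (seen I (x :: l)) := by
      refine killed_mono fun i hi => ?_
      simp only [seen, List.mem_filter, Bool.not_eq_true'] at hi ⊢
      exact ⟨hi.1, by rw [notIn, hi.2, Bool.and_false]⟩
    have e : prodVal r n β (memB I) (x :: l) = x.val r n β (memB I) * prodVal r n β (memB I) l := by
      simp [prodVal]
    have := add_mem (h6 h5) h4
    rwa [mul_sub, sub_add_sub_cancel, ← e] at this

/-! ### Identities -/

/-- The monomial `r ^ a * r⁻¹ ^ d * (-1) ^ o * (q + q⁻¹) ^ k * β ^ e * c`. -/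
inductive Mono
  | mk (a d : ℕ) (o : Bool) (k e c : ℕ)

/-- The value of a monomial. -/
def Mono.val (r : Rˣ) (β : R) : Mono → R
  | ⟨a, d, o, k, e, c⟩ => (r : R) ^ a * ((r⁻¹ : Rˣ) : R) ^ d * (bif o then -1 else 1) *
      qTwo r ^ k * β ^ e * c

/-- The value of a polynomial. -/
def polyVal (r : Rˣ) (β : R) (p : List Mono) : R := (p.map (Mono.val r β)).sum

/-- Add a multiple of a linear combination. -/
def addPoly (C : Comb) (acc : Comb) : List Mono → Comb
  | [] => acc
  | ⟨a, d, o, k, e, c⟩ :: p => addPoly C (addScaled a d o k e c C acc) p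

theorem combRep_addPoly {β : R} (hβ : qTwo r * β = 1) {C : Comb} {z : SkeinAlgebra r n}
    (hC : CombRep r n C z) (p : List Mono) {acc : Comb} {y : SkeinAlgebra r n}
    (hacc : CombRep r n acc y) : CombRep r n (addPoly C acc p) (y + polyVal r β p • z) := by
  induction p generalizing acc y with
  | nil => exact hacc.congr (by simp [polyVal])
  | cons x p ih =>
    obtain ⟨a, d, o, k, e, c⟩ := x
    refine (ih (combRep_addScaled hβ a d o k e c hC hacc)).congr ?_
    rw [polyVal, polyVal, List.map_cons, List.sum_cons, Mono.val, add_smul, add_assoc]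

/-- Linear combinations of products of generators. -/
abbrev Expr : Type := List (List Mono × List Tok)

/-- The value of a linear combination of products of generators. -/
noncomputable def exprVal (r : Rˣ) (n : ℕ) (β : R) (f : ℕ → Bool) (E : Expr) : SkeinAlgebra r n :=
  (E.map fun x => polyVal r β x.1 • prodVal r n β f x.2).sum

/-- The sum of a linear combination of products of generators. -/
def total (n : ℕ) (I : List ℕ) : Expr → Comb → Comb
  | [], acc => acc
  | (p, l) :: E, acc => total n I E (addPoly (prodComb n I l) acc p)

/-- Whether all products are as required. -/
def exprOk (n : ℕ) (I : List ℕ) : Expr → Bool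
  | [] => true
  | (_, l) :: E => and (and (allOk n l) (I.all fun i => onceIn i l)) (exprOk n I E)

theorem combRep_total {β : R} (hβ : qTwo r * β = 1) {I : List ℕ} {E : Expr}
    (h : exprOk n I E = true) {acc : Comb} {y : SkeinAlgebra r n} (hacc : CombRep r n acc y) :
    ∃ z, CombRep r n (total n I E acc) z ∧ y + exprVal r n β (memB I) E - z ∈ killed r n I := by
  induction E generalizing acc y with
  | nil => exact ⟨y, hacc, by simp [exprVal]⟩
  | cons x E ih =>
    obtain ⟨p, l⟩ := x
    simp only [exprOk, Bool.and_eq_true, List.all_eq_true] at h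
    obtain ⟨z, h1, h2⟩ := combRep_prodComb hβ h.1.1 fun i hi => .inl (h.1.2 i hi)
    obtain ⟨z', h3, h4⟩ := ih h.2 (combRep_addPoly hβ h1 p hacc)
    refine ⟨z', h3, ?_⟩
    have h5 := killed_mono (r := r) (n := n) (I := seen I l) (J := I)
      (fun i hi => List.mem_of_mem_filter hi) h2
    have := add_mem h4 (Submodule.smul_mem _ (polyVal r β p) h5)
    convert this using 1
    rw [exprVal, exprVal, List.map_cons, List.sum_cons, smul_sub]
    abel

theorem projAll_exprVal {β : R} (hβ : qTwo r * β = 1) {I : List ℕ} (hI : ∀ i ∈ I, i < n)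
    (hd : I.Nodup) {E : Expr} (h : exprOk n I E = true) :
    projAll r n β I (exprVal r n β (memB I) E) = exprVal r n β (fun _ => false) E := by
  induction E with
  | nil => simp [exprVal]
  | cons x E ih =>
    obtain ⟨p, l⟩ := x
    simp only [exprOk, Bool.and_eq_true, List.all_eq_true] at h
    have := projAll_prodVal (f := fun _ => false) hβ hI hd (fun _ _ => rfl) h.1.2 h.1.1
    simp only [Bool.or_false] at this
    have ih := ih h.2
    rw [exprVal, exprVal] at ih
    rw [exprVal, exprVal, List.map_cons, List.map_cons, List.sum_cons, List.sum_cons, map_add,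
      map_smul, ih]
    congr 2

/-- Whether the indices are distinct and in range. -/
def indicesOk (n : ℕ) : List ℕ → Bool
  | [] => true
  | i :: I => and (and (Nat.blt i n) (not (memB I i))) (indicesOk n I)

theorem of_indicesOk {I : List ℕ} (h : indicesOk n I = true) : (∀ i ∈ I, i < n) ∧ I.Nodup := by
  induction I with
  | nil => simp
  | cons i I ih =>
    simp only [indicesOk, Bool.and_eq_true, Bool.not_eq_true', memB_eq, decide_eq_false_iff_not] at h
    obtain ⟨h1, h2⟩ := ih h.2
    exact ⟨List.forall_mem_cons.2 ⟨lt_of_blt h.1.1, h1⟩, List.nodup_cons.2 ⟨h.1.2, h2⟩⟩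

/-- Whether an expression is zero; `I` is a list of indices that occur exactly once in each
product. -/
def check (n : ℕ) (I : List ℕ) (E : Expr) : Bool :=
  and (and (indicesOk n I) (exprOk n I E)) (total n I E .nil).isZero

/-- The computation shows that the truncated expression lies in the span annihilated by the
projectors, and the projectors turn it into the full expression. -/
theorem exprVal_eq_zero {β : R} (hβ : qTwo r * β = 1) {I : List ℕ} {E : Expr}
    (h : check n I E = true) : exprVal r n β (fun _ => false) E = 0 := by
  simp only [check, Bool.and_eq_true] at h
  obtain ⟨⟨h1, h2⟩, h3⟩ := h
  obtain ⟨hI, hd⟩ := of_indicesOk h1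
  obtain ⟨z, hz, hk⟩ := combRep_total hβ h2 (acc := .nil) (y := 0) .nil
  rw [eq_zero_of_comb_isZero hβ hz h3, zero_add, sub_zero] at hk
  rw [← projAll_exprVal hβ hI hd h2, projAll_killed hβ hI hd hk]

end SkeinAlgebra

namespace SkeinAlgebra

/-! ### The differences of the two sides of the quantized type I relations -/

/-- The relation is written as left side minus right side, with all coefficients expanded into
monomials. As q = r², the scalars q² and q⁻² are ⟨4, 0, …⟩ and ⟨0, 4, …⟩; a fourth entry 1 is a
factor α, and a fifth entry 1 is a factor β. The other expressions follow the same scheme. -/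
def six₁Expr (a b c d e f : ℕ) : Expr :=
  [([⟨0, 0, false, 0, 0, 1⟩],
    [.s b d, .s c f, .s a e]),
   ([⟨0, 0, true, 0, 0, 1⟩],
    [.s a c, .s b e, .s d f]),
   ([⟨0, 0, true, 1, 0, 1⟩],
    [.s3 b c d, .s3 a e f]),
   ([⟨0, 0, false, 1, 0, 1⟩],
    [.s3 a b c, .s3 d e f]),
   ([⟨4, 0, true, 0, 0, 1⟩, ⟨0, 4, false, 0, 0, 1⟩],
    [.s b c, .s d f, .s a e]),
   ([⟨4, 0, false, 0, 0, 1⟩, ⟨0, 4, true, 0, 0, 1⟩],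
    [.s e f, .s a c, .s b d]),
   ([⟨4, 0, true, 0, 0, 1⟩],
    [.s a f, .s b d, .s c e]),
   ([⟨4, 0, false, 0, 0, 1⟩],
    [.s a b, .s c e, .s d f]),
   ([⟨0, 4, true, 0, 0, 1⟩],
    [.s c d, .s a e, .s b f]),
   ([⟨0, 4, false, 0, 0, 1⟩],
    [.s d e, .s b f, .s a c]),
   ([⟨0, 8, true, 0, 0, 1⟩],
    [.s a b, .s c f, .s d e]),
   ([⟨0, 8, false, 0, 0, 1⟩],
    [.s a f, .s b e, .s c d]),
   ([⟨8, 0, true, 0, 0, 1⟩, ⟨4, 4, false, 0, 0, 2⟩, ⟨0, 8, true, 0, 0, 1⟩],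
    [.s a b, .s c d, .s e f]),
   ([⟨8, 0, false, 0, 0, 1⟩, ⟨4, 4, true, 0, 0, 2⟩, ⟨0, 8, false, 0, 0, 1⟩],
    [.s a f, .s b c, .s d e])]

def six₂Expr (a b c d e f : ℕ) : Expr :=
  [([⟨0, 0, false, 0, 0, 1⟩],
    [.s a d, .s b e, .s c f]),
   ([⟨6, 0, true, 0, 0, 1⟩, ⟨0, 6, true, 0, 0, 1⟩],
    [.s3 a b c, .s3 d e f]),
   ([⟨0, 4, true, 0, 0, 1⟩],
    [.s b d, .s c f, .s a e]),
   ([⟨0, 4, true, 0, 0, 1⟩],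
    [.s c e, .s a d, .s b f]),
   ([⟨0, 0, false, 0, 0, 1⟩],
    [.s c d, .s a e, .s b f]),
   ([⟨0, 0, false, 0, 0, 1⟩],
    [.s a f, .s b d, .s c e]),
   ([⟨0, 12, true, 0, 0, 1⟩],
    [.s a f, .s b e, .s c d]),
   ([⟨0, 0, true, 0, 0, 1⟩, ⟨0, 4, false, 0, 0, 1⟩],
    [.s a c, .s b e, .s d f]),
   ([⟨0, 0, true, 0, 0, 1⟩, ⟨0, 4, false, 0, 0, 1⟩],
    [.s d e, .s b f, .s a c]),
   ([⟨4, 0, false, 0, 0, 1⟩, ⟨4, 4, true, 0, 0, 1⟩],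
    [.s a b, .s c e, .s d f]),
   ([⟨0, 4, false, 0, 0, 1⟩, ⟨0, 8, true, 0, 0, 1⟩],
    [.s b c, .s d f, .s a e]),
   ([⟨8, 0, true, 0, 0, 1⟩, ⟨4, 0, false, 0, 0, 2⟩, ⟨0, 4, true, 0, 0, 2⟩, ⟨0, 12, false, 0, 0, 1⟩],
    [.s a b, .s c d, .s e f]),
   ([⟨0, 0, true, 0, 0, 2⟩, ⟨4, 0, false, 0, 0, 1⟩, ⟨0, 8, false, 0, 0, 1⟩],
    [.s e f, .s a c, .s b d]),
   ([⟨0, 0, true, 0, 0, 2⟩, ⟨4, 0, false, 0, 0, 1⟩, ⟨0, 8, false, 0, 0, 1⟩],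
    [.s a f, .s b c, .s d e]),
   ([⟨4, 0, true, 0, 0, 1⟩, ⟨0, 8, true, 0, 0, 1⟩, ⟨0, 4, false, 0, 0, 2⟩],
    [.s a d, .s b c, .s e f]),
   ([⟨4, 0, true, 0, 0, 1⟩, ⟨0, 8, true, 0, 0, 1⟩, ⟨0, 4, false, 0, 0, 2⟩],
    [.s a b, .s c f, .s d e])]

def six₃Expr (a b c d e f : ℕ) : Expr :=
  [([⟨0, 0, false, 1, 0, 1⟩],
    [.s3 a b d, .s3 c e f]),
   ([⟨0, 0, true, 0, 0, 1⟩],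
    [.s a c, .s b e, .s d f]),
   ([⟨0, 4, true, 0, 0, 1⟩],
    [.s c d, .s a e, .s b f]),
   ([⟨0, 4, false, 0, 0, 1⟩],
    [.s b c, .s d f, .s a e]),
   ([⟨0, 4, false, 0, 0, 1⟩],
    [.s d e, .s b f, .s a c]),
   ([⟨0, 0, true, 0, 0, 2⟩, ⟨0, 8, false, 0, 0, 1⟩],
    [.s a f, .s b c, .s d e]),
   ([⟨0, 8, false, 0, 0, 1⟩],
    [.s a f, .s c d, .s b e]),
   ([⟨4, 0, true, 1, 0, 1⟩, ⟨0, 0, false, 1, 0, 1⟩],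
    [.s3 a b c, .s3 d e f]),
   ([⟨8, 0, true, 0, 0, 1⟩, ⟨4, 4, false, 0, 0, 1⟩, ⟨4, 0, false, 0, 0, 2⟩, ⟨0, 4, true, 0, 0, 1⟩, ⟨0, 0, true, 0, 0, 1⟩],
    [.s a b, .s c d, .s e f]),
   ([⟨4, 0, false, 0, 0, 1⟩, ⟨0, 0, true, 0, 0, 1⟩],
    [.s a b, .s c e, .s d f]),
   ([⟨4, 0, false, 0, 0, 1⟩, ⟨0, 0, true, 0, 0, 1⟩],
    [.s e f, .s a c, .s b d]),
   ([⟨4, 8, false, 0, 0, 1⟩, ⟨0, 8, true, 0, 0, 1⟩],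
    [.s a b, .s c f, .s d e]),
   ([⟨4, 8, false, 0, 0, 1⟩, ⟨0, 8, true, 0, 0, 1⟩],
    [.s e f, .s a d, .s b c])]

def six₄Expr (a b c d e f : ℕ) : Expr :=
  [([⟨0, 0, false, 1, 0, 1⟩],
    [.s3 a c e, .s3 b d f]),
   ([⟨4, 0, true, 0, 0, 1⟩],
    [.s a d, .s b e, .s c f]),
   ([⟨4, 0, true, 0, 0, 1⟩, ⟨8, 0, true, 0, 0, 1⟩, ⟨12, 0, false, 0, 0, 1⟩],
    [.s a b, .s c d, .s e f]),
   ([⟨0, 0, false, 0, 0, 1⟩],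
    [.s a f, .s b e, .s c d]),
   ([⟨8, 0, true, 0, 0, 2⟩, ⟨4, 0, false, 0, 0, 2⟩, ⟨0, 4, true, 0, 0, 2⟩, ⟨0, 0, false, 0, 0, 1⟩],
    [.s a f, .s b c, .s d e]),
   ([⟨0, 0, true, 0, 0, 1⟩, ⟨0, 4, false, 0, 0, 1⟩, ⟨8, 0, false, 0, 0, 1⟩],
    [.s a d, .s b c, .s e f]),
   ([⟨0, 0, true, 0, 0, 1⟩, ⟨0, 4, false, 0, 0, 1⟩, ⟨8, 0, false, 0, 0, 1⟩],
    [.s a b, .s c f, .s d e]),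
   ([⟨4, 0, true, 1, 0, 1⟩, ⟨8, 0, false, 1, 0, 1⟩],
    [.s3 a b c, .s3 d e f]),
   ([⟨4, 0, false, 0, 0, 1⟩, ⟨8, 0, true, 0, 0, 1⟩],
    [.s a b, .s c e, .s d f]),
   ([⟨4, 0, false, 0, 0, 1⟩, ⟨8, 0, true, 0, 0, 1⟩],
    [.s e f, .s a c, .s b d]),
   ([⟨0, 0, true, 0, 0, 1⟩, ⟨4, 0, false, 0, 0, 1⟩],
    [.s a c, .s b e, .s d f]),
   ([⟨0, 0, true, 0, 0, 1⟩, ⟨4, 0, false, 0, 0, 1⟩],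
    [.s b c, .s d f, .s a e]),
   ([⟨0, 0, true, 0, 0, 1⟩, ⟨4, 0, false, 0, 0, 1⟩],
    [.s d e, .s b f, .s a c]),
   ([⟨0, 2, false, 1, 0, 1⟩, ⟨4, 2, true, 1, 0, 1⟩],
    [.s c d, .s a e, .s b f])]

def five₁Expr (a b c d e : ℕ) : Expr :=
  [([⟨0, 0, false, 1, 0, 1⟩],
    [.s3 a b c, .s3 c d e]),
   ([⟨0, 0, true, 0, 0, 1⟩],
    [.s a c, .s b d, .s c e]),
   ([⟨0, 4, true, 0, 0, 1⟩],
    [.s a d, .s b e, .s c c]),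
   ([⟨0, 4, false, 0, 0, 1⟩],
    [.s a c, .s b e, .s c d]),
   ([⟨0, 4, false, 0, 0, 1⟩],
    [.s a d, .s b c, .s c e]),
   ([⟨0, 8, true, 0, 0, 1⟩],
    [.s a e, .s b c, .s c d]),
   ([⟨0, 8, false, 0, 0, 1⟩],
    [.s a e, .s b d, .s c c]),
   ([⟨0, 0, true, 0, 0, 1⟩, ⟨4, 0, false, 0, 0, 1⟩],
    [.s c c, .s a b, .s d e]),
   ([⟨0, 4, true, 0, 0, 1⟩, ⟨0, 0, false, 0, 0, 1⟩],
    [.t c, .s a c, .s3 b d e]),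
   ([⟨0, 8, false, 0, 0, 1⟩, ⟨0, 4, true, 0, 0, 1⟩],
    [.t c, .s b c, .s3 a d e]),
   ([⟨4, 4, true, 0, 0, 1⟩, ⟨0, 4, false, 0, 0, 1⟩, ⟨4, 0, false, 0, 0, 1⟩, ⟨0, 0, true, 0, 0, 1⟩],
    [.t c, .s d e, .s3 a b c])]

def five₂Expr (a b c d e : ℕ) : Expr :=
  [([⟨0, 0, false, 1, 0, 1⟩],
    [.s3 a c e, .s3 b c d]),
   ([⟨0, 0, true, 0, 0, 1⟩],
    [.s a c, .s b e, .s c d]),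
   ([⟨0, 0, false, 0, 0, 1⟩],
    [.s b e, .s a d, .s c c]),
   ([⟨0, 0, true, 0, 0, 1⟩],
    [.s c e, .s a d, .s b c]),
   ([⟨4, 0, false, 0, 0, 1⟩],
    [.s c e, .s a b, .s c d]),
   ([⟨0, 4, true, 0, 0, 1⟩],
    [.s d e, .s a b, .s c c]),
   ([⟨0, 4, false, 0, 0, 1⟩],
    [.s d e, .s a c, .s b c]),
   ([⟨0, 0, true, 0, 0, 1⟩, ⟨0, 4, false, 0, 0, 1⟩],
    [.s c c, .s a e, .s b d]),
   ([⟨4, 0, true, 0, 0, 1⟩, ⟨0, 0, false, 0, 0, 1⟩],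
    [.t c, .s c d, .s3 a b e]),
   ([⟨4, 4, false, 0, 0, 1⟩, ⟨0, 4, true, 0, 0, 1⟩],
    [.t c, .s b c, .s3 a d e]),
   ([⟨4, 4, true, 0, 0, 1⟩, ⟨4, 0, false, 0, 0, 1⟩, ⟨0, 4, false, 0, 0, 1⟩, ⟨0, 0, true, 0, 0, 1⟩],
    [.t c, .s a e, .s3 b c d])]

def five₃Expr (a b c d e : ℕ) : Expr :=
  [([⟨0, 0, false, 1, 0, 1⟩],
    [.s3 a c d, .s3 b c e]),
   ([⟨0, 0, true, 0, 0, 1⟩],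
    [.s a c, .s b d, .s c e]),
   ([⟨4, 0, true, 0, 0, 1⟩],
    [.s c c, .s a b, .s d e]),
   ([⟨4, 0, false, 0, 0, 1⟩],
    [.s a b, .s c d, .s c e]),
   ([⟨4, 0, false, 0, 0, 1⟩],
    [.s a c, .s b c, .s d e]),
   ([⟨0, 4, true, 0, 0, 1⟩],
    [.s a e, .s b c, .s c d]),
   ([⟨0, 4, false, 0, 0, 1⟩],
    [.s c c, .s a e, .s b d]),
   ([⟨0, 0, true, 0, 0, 1⟩, ⟨0, 4, false, 0, 0, 1⟩],
    [.s c c, .s a d, .s b e]),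
   ([⟨0, 0, true, 0, 0, 1⟩, ⟨0, 4, false, 0, 0, 1⟩],
    [.t c, .s b c, .s3 a d e]),
   ([⟨4, 0, true, 0, 0, 1⟩, ⟨4, 4, false, 0, 0, 1⟩],
    [.t c, .s d e, .s3 a b c]),
   ([⟨0, 0, true, 0, 0, 1⟩, ⟨0, 4, false, 0, 0, 1⟩],
    [.t c, .s3 a c d, .s b e])]

def four₁Expr (a b c d : ℕ) : Expr :=
  [([⟨0, 0, false, 1, 0, 1⟩],
    [.s3 a b c, .s3 b c d]),
   ([⟨0, 4, true, 0, 0, 1⟩],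
    [.s a b, .s b c, .s c d]),
   ([⟨0, 4, false, 0, 0, 1⟩],
    [.s a d, .s b c, .s b c]),
   ([⟨0, 4, true, 0, 0, 1⟩],
    [.s b b, .s c c, .s a d]),
   ([⟨0, 4, false, 0, 0, 1⟩],
    [.s c c, .s a b, .s b d]),
   ([⟨0, 0, true, 0, 0, 1⟩],
    [.s b c, .s a c, .s b d]),
   ([⟨0, 0, true, 0, 0, 1⟩, ⟨4, 0, false, 0, 0, 1⟩, ⟨0, 4, false, 0, 0, 1⟩],
    [.s b b, .s a c, .s c d]),
   ([⟨4, 0, true, 0, 0, 2⟩, ⟨8, 0, false, 0, 0, 1⟩, ⟨0, 0, false, 0, 0, 1⟩],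
    [.t b, .s c d, .s3 a b c]),
   ([⟨4, 4, false, 0, 0, 1⟩, ⟨0, 4, true, 0, 0, 1⟩],
    [.t b, .s b c, .s3 a c d]),
   ([⟨8, 0, true, 0, 0, 1⟩, ⟨6, 2, false, 0, 0, 2⟩, ⟨4, 4, true, 0, 0, 1⟩, ⟨4, 0, false, 0, 0, 1⟩, ⟨2, 2, true, 0, 0, 2⟩, ⟨0, 4, false, 0, 0, 1⟩],
    [.t b, .s c c, .s3 a b d]),
   ([⟨0, 0, true, 0, 0, 1⟩, ⟨0, 4, false, 0, 0, 1⟩],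
    [.t c, .s a b, .s3 b c d]),
   ([⟨0, 0, false, 0, 0, 1⟩, ⟨0, 4, true, 0, 0, 1⟩],
    [.t c, .s b b, .s3 a c d]),
   ([⟨8, 0, true, 0, 1, 1⟩, ⟨6, 2, false, 0, 1, 2⟩, ⟨4, 4, true, 0, 1, 1⟩, ⟨4, 0, false, 0, 1, 1⟩, ⟨2, 2, true, 0, 1, 2⟩, ⟨0, 4, false, 0, 1, 1⟩],
    [.t b, .t c, .s a c, .s b d]),
   ([⟨8, 4, false, 0, 1, 1⟩, ⟨6, 6, true, 0, 1, 2⟩, ⟨4, 8, false, 0, 1, 1⟩, ⟨4, 4, true, 0, 1, 1⟩, ⟨2, 6, false, 0, 1, 2⟩, ⟨0, 8, true, 0, 1, 1⟩],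
    [.t b, .t c, .s a d, .s b c]),
   ([⟨8, 0, true, 0, 1, 4⟩, ⟨12, 0, false, 0, 1, 1⟩, ⟨4, 0, false, 0, 1, 5⟩, ⟨0, 0, true, 0, 1, 2⟩],
    [.t b, .t c, .s a b, .s c d])]

def four₂Expr (a b c d : ℕ) : Expr :=
  [([⟨0, 0, false, 1, 0, 1⟩],
    [.s3 a b c, .s3 a c d]),
   ([⟨8, 0, true, 0, 0, 1⟩, ⟨4, 0, false, 0, 0, 1⟩, ⟨0, 0, true, 0, 0, 1⟩],
    [.s a a, .s b c, .s c d]),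
   ([⟨0, 0, false, 0, 0, 1⟩],
    [.s a a, .s b d, .s c c]),
   ([⟨0, 0, true, 0, 0, 1⟩],
    [.s a c, .s a c, .s b d]),
   ([⟨8, 0, false, 0, 0, 1⟩],
    [.s a b, .s a c, .s c d]),
   ([⟨0, 0, true, 0, 0, 1⟩],
    [.s a b, .s a d, .s c c]),
   ([⟨0, 4, false, 0, 0, 1⟩],
    [.s a c, .s a d, .s b c]),
   ([⟨4, 4, true, 0, 0, 1⟩, ⟨0, 4, false, 0, 0, 1⟩],
    [.t a, .s b c, .s3 a c d]),
   ([⟨12, 0, true, 0, 0, 1⟩, ⟨8, 0, false, 0, 0, 1⟩],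
    [.t a, .s c d, .s3 a b c]),
   ([⟨8, 0, true, 0, 0, 2⟩, ⟨12, 0, false, 0, 0, 1⟩, ⟨4, 4, false, 0, 0, 1⟩, ⟨4, 0, false, 0, 0, 1⟩, ⟨0, 4, true, 0, 0, 1⟩],
    [.t a, .s c c, .s3 a b d]),
   ([⟨4, 0, true, 0, 0, 1⟩, ⟨0, 0, false, 0, 0, 1⟩],
    [.t c, .s a a, .s3 b c d]),
   ([⟨4, 0, false, 0, 0, 1⟩, ⟨0, 0, true, 0, 0, 1⟩],
    [.t c, .s a b, .s3 a c d]),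
   ([⟨12, 0, false, 0, 1, 1⟩, ⟨8, 4, true, 0, 1, 1⟩, ⟨8, 0, true, 0, 1, 2⟩, ⟨4, 4, false, 0, 1, 2⟩, ⟨4, 0, false, 0, 1, 1⟩, ⟨0, 4, true, 0, 1, 1⟩],
    [.t a, .t c, .s a c, .s b d]),
   ([⟨12, 4, true, 0, 1, 1⟩, ⟨8, 8, false, 0, 1, 1⟩, ⟨8, 4, false, 0, 1, 2⟩, ⟨4, 8, true, 0, 1, 2⟩, ⟨4, 4, true, 0, 1, 1⟩, ⟨0, 8, false, 0, 1, 1⟩],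
    [.t a, .t c, .s a d, .s b c]),
   ([⟨12, 0, false, 0, 1, 3⟩, ⟨8, 0, true, 0, 1, 2⟩, ⟨16, 0, true, 0, 1, 1⟩, ⟨4, 0, true, 0, 1, 1⟩, ⟨0, 0, false, 0, 1, 1⟩],
    [.t a, .t c, .s a b, .s c d])]

def threeExpr (a b c : ℕ) : Expr :=
  [([⟨0, 0, false, 1, 0, 1⟩],
    [.s3 a b c, .s3 a b c]),
   ([⟨0, 2, true, 1, 0, 1⟩],
    [.s a b, .s b c, .s a c]),
   ([⟨0, 0, true, 0, 0, 1⟩],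
    [.s a a, .s b b, .s c c]),
   ([⟨4, 0, false, 0, 0, 1⟩],
    [.s a a, .s b c, .s b c]),
   ([⟨0, 4, false, 0, 0, 1⟩],
    [.s b b, .s a c, .s a c]),
   ([⟨0, 4, false, 0, 0, 1⟩],
    [.s c c, .s a b, .s a b]),
   ([⟨4, 4, true, 0, 0, 1⟩, ⟨4, 0, false, 0, 0, 1⟩],
    [.t a, .s b c, .s3 a b c]),
   ([⟨0, 4, false, 0, 0, 1⟩, ⟨0, 0, true, 0, 0, 1⟩],
    [.t b, .s a c, .s3 a b c]),
   ([⟨0, 4, false, 0, 0, 1⟩, ⟨0, 0, true, 0, 0, 1⟩],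
    [.t c, .s a b, .s3 a b c]),
   ([⟨4, 4, false, 0, 1, 1⟩, ⟨2, 6, true, 0, 1, 2⟩, ⟨0, 8, false, 0, 1, 1⟩, ⟨4, 0, true, 0, 1, 1⟩, ⟨2, 2, false, 0, 1, 2⟩, ⟨0, 4, true, 0, 1, 1⟩],
    [.t a, .t b, .t c, .s3 a b c]),
   ([⟨4, 0, true, 0, 1, 1⟩, ⟨2, 2, false, 0, 1, 2⟩, ⟨0, 4, true, 0, 1, 1⟩],
    [.t b, .t c, .s a a, .s b c]),
   ([⟨4, 0, true, 0, 1, 1⟩, ⟨2, 2, false, 0, 1, 2⟩, ⟨0, 4, true, 0, 1, 1⟩],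
    [.t a, .t c, .s b b, .s a c]),
   ([⟨4, 4, false, 0, 1, 1⟩, ⟨2, 6, true, 0, 1, 2⟩, ⟨0, 8, false, 0, 1, 1⟩],
    [.t a, .t b, .s c c, .s a b]),
   ([⟨4, 2, true, 1, 1, 1⟩, ⟨2, 4, false, 1, 1, 2⟩, ⟨0, 6, true, 1, 1, 1⟩],
    [.t a, .t b, .s b c, .s a c])]

/-! ### The relations for given indices, as normal form computations -/

/-- All six indices occur exactly once in each product, so a projector is available for every one of
them. -/
def checkSix (a b c d e f : ℕ) : Bool :=
  (and (check 6 [a, b, c, d, e, f] (six₁Expr a b c d e f)) (and (check 6 [a, b, c, d, e, f] (six₂Expr a b c d e f)) (and (check 6 [a, b, c, d, e, f] (six₃Expr a b c d e f)) (check 6 [a, b, c, d, e, f] (six₄Expr a b c d e f)))))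

/-- The index c is the repeated one and has no projector. -/
def checkFive (a b c d e : ℕ) : Bool :=
  (and (check 5 [a, b, d, e] (five₁Expr a b c d e)) (and (check 5 [a, b, d, e] (five₂Expr a b c d e)) (check 5 [a, b, d, e] (five₃Expr a b c d e))))

/-- The repeated indices are b, c in the first relation and a, c in the second; projectors are used
for the other two. -/
def checkFour (a b c d : ℕ) : Bool :=
  (and (check 4 [a, d] (four₁Expr a b c d)) (check 4 [b, d] (four₂Expr a b c d)))

/-- Here every index is repeated, and the expression is expanded completely. -/
def checkThree (a b c : ℕ) : Bool :=
  check 3 [] (threeExpr a b c)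

end SkeinAlgebra

/-! ### Evaluation of the finite checks. -/

namespace SkeinAlgebra

-- The words depend on the linear order of the punctures, so a cyclic order is covered by checking
-- each rotation separately. The computation does not refer to `R`.
set_option maxRecDepth 100000 in
theorem checkSix_rotations :
    (and (checkSix 0 1 2 3 4 5) (and (checkSix 1 2 3 4 5 0) (and (checkSix 2 3 4 5 0 1)
      (and (checkSix 3 4 5 0 1 2) (and (checkSix 4 5 0 1 2 3) (checkSix 5 0 1 2 3 4)))))) = true := by
  decide +kernel

set_option maxRecDepth 100000 in
theorem checkFive_rotations :
    (and (checkFive 0 1 2 3 4) (and (checkFive 1 2 3 4 0) (and (checkFive 2 3 4 0 1)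
      (and (checkFive 3 4 0 1 2) (checkFive 4 0 1 2 3))))) = true := by
  decide +kernel

set_option maxRecDepth 100000 in
theorem checkFour_rotations :
    (and (checkFour 0 1 2 3) (and (checkFour 1 2 3 0) (and (checkFour 2 3 0 1)
      (checkFour 3 0 1 2)))) = true := by
  decide +kernel

set_option maxRecDepth 100000 in
theorem checkThree_rotations :
    (and (checkThree 0 1 2) (and (checkThree 1 2 0) (checkThree 2 0 1))) = true := by
  decide +kernel

end SkeinAlgebra

/-! ### Homomorphisms induced by increasing maps of punctures. -/

namespace SkeinAlgebra

open Slice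

variable {R : Type*} [CommRing R] {r : Rˣ} {n : ℕ}

/-- Cuts a list into a list of leading unmarked entries and blocks that begin with a mark. -/
def cutMarks : List Bool → List Bool × List (List Bool)
  | [] => ([], [])
  | true :: M => ([], (true :: (cutMarks M).1) :: (cutMarks M).2)
  | false :: M => (false :: (cutMarks M).1, (cutMarks M).2)

theorem cutMarks_length {X : Type*} (p : X → Bool) (l : List X) :
    (cutMarks (l.map p)).2.length = (l.filter p).length := by
  induction l with
  | nil => rfl
  | cons x l ih => cases h : p x <;> simp [cutMarks, h, ih]

theorem cutMarks_sum (M : List Bool) :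
    (cutMarks M).1.length + ((cutMarks M).2.map List.length).sum = M.length := by
  induction M with
  | nil => rfl
  | cons x l ih => cases x <;> simp [cutMarks] <;> omega

/-- The entries before the first mark are all `false`, so masking them has no effect. -/
theorem cutMarks_map_and (x : Bool) (M : List Bool) :
    (cutMarks M).1.map (x && ·) = (cutMarks M).1 := by
  induction M with
  | nil => rfl
  | cons y l ih => cases y <;> simp_all [cutMarks]

theorem expand_cutMarks {X : Type*} (p f : X → Bool) (l : List X) :
    (cutMarks (l.map p)).1 ++ expand ((l.filter p).map f) (cutMarks (l.map p)).2 =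
      l.map fun x => p x && f x := by
  induction l with
  | nil => rfl
  | cons x l ih =>
    cases h : p x
    · simpa [cutMarks, h] using ih
    · simp only [List.map_cons, h, cutMarks, List.filter_cons_of_pos, expand, List.nil_append,
        Bool.and_true, Bool.true_and, List.cons_append, List.cons.injEq, true_and]
      rw [cutMarks_map_and, ih]

/-- Cuts a list into blocks with one mark each. -/
def markBlocks (M : List Bool) : List (List Bool) :=
  match cutMarks M with
  | (_, []) => []
  | (l, b :: bs) => (l ++ b) :: bs

theorem markBlocks_length {X : Type*} (p : X → Bool) (l : List X) :
    (markBlocks (l.map p)).length = (l.filter p).length := by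
  rw [← cutMarks_length, markBlocks]
  split <;> simp_all

theorem markBlocks_sum {M : List Bool} (h : markBlocks M ≠ []) :
    ((markBlocks M).map List.length).sum = M.length := by
  rw [← cutMarks_sum]
  revert h
  rw [markBlocks]
  split <;> simp_all [add_assoc]

/-- A block expands to its value at the single mark and to `false` elsewhere; it does not matter
which block an unmarked entry belongs to. If there is no mark at all, there is no block to hold the
entries, which explains the hypothesis. -/
theorem expand_markBlocks {X : Type*} (p f : X → Bool) (l : List X)
    (h : markBlocks (l.map p) ≠ []) :
    expand ((l.filter p).map f) (markBlocks (l.map p)) = l.map fun x => p x && f x := by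
  rw [← expand_cutMarks p f l]
  have hl := cutMarks_length p l
  have hm := fun x => cutMarks_map_and x (l.map p)
  revert h
  rw [markBlocks]
  split
  · simp
  · rename_i u b bs hu
    rw [hu] at hl hm ⊢
    intro _
    cases hB : l.filter p with
    | nil => simp [hB] at hl
    | cons x B =>
      have hu := hm (f x)
      simp_all [expand]

theorem filter_finRange_range {m : ℕ} {ι : Fin m → Fin n} (hι : StrictMono ι) :
    ((List.finRange n).filter fun k => decide (k ∈ Set.range ι)) = (List.finRange m).map ι := by
  apply List.Perm.eq_of_pairwise (le := (· < ·))
  · intro a b _ _ h h'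
    exact absurd h (lt_asymm h')
  · exact (List.pairwise_lt_finRange n).filter _
  · exact (List.pairwise_lt_finRange m).map _ fun _ _ h => hι h
  · rw [List.perm_ext_iff_of_nodup ((List.nodup_finRange n).filter _)
      ((List.nodup_finRange m).map hι.injective)]
    simp

/-- Puncture rows for an increasing map: the marks are the punctures in the image. -/
def embedBlocks {m : ℕ} (ι : Fin m → Fin n) : List (List Bool) :=
  markBlocks ((List.finRange n).map fun k => decide (∃ i, ι i = k))

theorem embedBlocks_length {m : ℕ} {ι : Fin m → Fin n} (hι : StrictMono ι) :
    (embedBlocks ι).length = m := by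
  rw [embedBlocks, markBlocks_length]
  have := congrArg List.length (filter_finRange_range hι)
  simpa using this

/-- Every increasing map of punctures induces a homomorphism of skein algebras. -/
theorem exists_embed (r : Rˣ) {m : ℕ} [NeZero m] {ι : Fin m → Fin n} (hι : StrictMono ι) :
    ∃ F : SkeinAlgebra r m →ₐ[R] SkeinAlgebra r n, ∀ S, F (t r S) = t r (S.image ι) := by
  have hm := embedBlocks_length hι
  have hne : embedBlocks ι ≠ [] := by
    intro h
    rw [h] at hm
    exact NeZero.ne m hm.symm
  have hn : ((embedBlocks ι).map List.length).sum = n := by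
    rw [embedBlocks, markBlocks_sum hne, List.length_map, List.length_finRange]
  refine ⟨blockHom r n (embedBlocks ι) hm hn, fun S => ?_⟩
  have hB : ((List.finRange m).map fun k => decide (k ∈ S)).length = m := by simp
  have hT := isTangle_curveB ((List.finRange m).map fun k => decide (k ∈ S))
  rw [hB] at hT
  rw [t_eq_ofWord, blockHom_ofWord _ _ hT, blockWord_curveB (hB.trans hm.symm), t_eq_ofWord]
  congr 2
  have h := expand_markBlocks (fun k => decide (∃ i, ι i = k)) (fun k => decide (k ∈ S.image ι))
    (List.finRange n) hne
  have hf := filter_finRange_range hι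
  simp only [Set.mem_range] at hf
  rw [hf, List.map_map] at h
  convert h using 2
  · apply List.map_congr_left
    intro k _
    simp [hι.injective.eq_iff]
  · rfl
  · funext k
    by_cases h : k ∈ S.image ι
    · have : ∃ i, ι i = k := by
        obtain ⟨i, _, hi⟩ := Finset.mem_image.1 h
        exact ⟨i, hi⟩
      simp only [h, this, decide_true, Bool.and_true]
    · simp only [h, decide_false, Bool.and_false]

theorem tl_eq_t {m : ℕ} (J : List (Fin m)) : tl r m (J.map Fin.val) = t r J.toFinset := by
  rw [tl, t_eq_ofWord, bits, ← List.map_coe_finRange_eq_range, List.map_map]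
  congr 2
  apply List.map_congr_left
  intro i _
  rw [Bool.eq_iff_iff]
  simp [Fin.val_inj]

end SkeinAlgebra

/-! ### The relations for arbitrary indices in cyclic order. -/

namespace SkeinAlgebra

open Slice

variable {R : Type*} [CommRing R] {r : Rˣ} {n : ℕ}

section Embed

variable {m : ℕ} {ι : Fin m → Fin n} {F : SkeinAlgebra r m →ₐ[R] SkeinAlgebra r n} {β : R}

theorem embed_tl (hF : ∀ S, F (t r S) = t r (S.image ι)) (J : List (Fin m)) :
    F (tl r m (J.map Fin.val)) = t r ((J.map ι).toFinset) := by
  rw [tl_eq_t, hF]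
  congr 1
  ext
  simp

theorem embed_val_t (hF : ∀ S, F (t r S) = t r (S.image ι)) (i : Fin m) :
    F (Tok.val r m β (fun _ => false) (.t i)) = t r {ι i} := by
  simpa [Tok.val] using embed_tl hF [i]

theorem embed_val_s (hF : ∀ S, F (t r S) = t r (S.image ι)) (hι : StrictMono ι) (i j : Fin m) :
    F (Tok.val r m β (fun _ => false) (.s i j)) = sPair (qTwo r) β (t r) (ι i) (ι j) := by
  have h1 := embed_tl hF [i]
  have h2 := embed_tl hF [j]
  have h3 := embed_tl hF [i, j]
  simp only [List.map_cons, List.map_nil, List.toFinset_cons, List.toFinset_nil,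
    insert_empty_eq] at h1 h2 h3
  by_cases h : i = j
  · subst h
    simp [Tok.val, sPair, h1, pow_two, Algebra.smul_def]
  · have h' : Nat.beq i j = false := by
      rw [beq_eq_false_iff]
      exact fun e => h (Fin.ext e)
    simp [Tok.val, sPair, h1, h2, h3, h', hι.injective.eq_iff, h]

theorem embed_val_s3 (hF : ∀ S, F (t r S) = t r (S.image ι)) (i j k : Fin m) :
    F (Tok.val r m β (fun _ => false) (.s3 i j k)) = sTriple β (t r) (ι i) (ι j) (ι k) := by
  have h1 := embed_tl hF [i]
  have h2 := embed_tl hF [j]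
  have h3 := embed_tl hF [k]
  have h12 := embed_tl hF [i, j]
  have h13 := embed_tl hF [i, k]
  have h23 := embed_tl hF [j, k]
  have h := embed_tl hF [i, j, k]
  simp only [List.map_cons, List.map_nil, List.toFinset_cons, List.toFinset_nil,
    insert_empty_eq] at h1 h2 h3 h h12 h13 h23
  simp [Tok.val, tripleCoef, sTriple, h1, h2, h3, h12, h13, h23, h, mul_assoc, smul_add, add_assoc]

end Embed

theorem exists_rotation {l : List (Fin n)} (h : CyclicOrder l) (hl : l ≠ []) :
    ∃ k < l.length, (l.rotate k).Pairwise (· < ·) := by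
  obtain ⟨k, hk⟩ := h
  exact ⟨k % l.length, Nat.mod_lt _ (List.length_pos_of_ne_nil hl), by rwa [List.rotate_mod]⟩

theorem strictMono_of_pairwise_ofFn {m : ℕ} {j : Fin m → Fin n}
    (h : (List.ofFn j).Pairwise (· < ·)) : StrictMono j := by
  rw [List.pairwise_ofFn] at h
  exact fun _ _ h' => h h'

/-- If rotation by k sorts the indices, the sorted list is the required embedding. For k > 0 the
index i₁ has become entry 6 - k, so the rotation starting with 6 - k is the one whose check applies.
-/
theorem exists_checkSix {i₁ i₂ i₃ i₄ i₅ i₆ : Fin n} (h : CyclicOrder [i₁, i₂, i₃, i₄, i₅, i₆]) :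
    ∃ (ι : Fin 6 → Fin n) (a b c d e f : Fin 6), StrictMono ι ∧ checkSix a b c d e f = true ∧
      i₁ = ι a ∧ i₂ = ι b ∧ i₃ = ι c ∧ i₄ = ι d ∧ i₅ = ι e ∧ i₆ = ι f := by
  obtain ⟨k, hk, h⟩ := exists_rotation h (by simp)
  have hc := checkSix_rotations
  simp only [Bool.and_eq_true] at hc
  obtain ⟨c₀, c₁, c₂, c₃, c₄, c₅⟩ := hc
  simp only [List.length_cons, List.length_nil] at hk
  interval_cases k
  · exact ⟨![i₁, i₂, i₃, i₄, i₅, i₆], 0, 1, 2, 3, 4, 5,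
      strictMono_of_pairwise_ofFn (by simpa [List.ofFn_succ] using h), c₀, rfl, rfl, rfl, rfl, rfl, rfl⟩
  · exact ⟨![i₂, i₃, i₄, i₅, i₆, i₁], 5, 0, 1, 2, 3, 4,
      strictMono_of_pairwise_ofFn (by simpa [List.ofFn_succ] using h), c₅, rfl, rfl, rfl, rfl, rfl, rfl⟩
  · exact ⟨![i₃, i₄, i₅, i₆, i₁, i₂], 4, 5, 0, 1, 2, 3,
      strictMono_of_pairwise_ofFn (by simpa [List.ofFn_succ] using h), c₄, rfl, rfl, rfl, rfl, rfl, rfl⟩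
  · exact ⟨![i₄, i₅, i₆, i₁, i₂, i₃], 3, 4, 5, 0, 1, 2,
      strictMono_of_pairwise_ofFn (by simpa [List.ofFn_succ] using h), c₃, rfl, rfl, rfl, rfl, rfl, rfl⟩
  · exact ⟨![i₅, i₆, i₁, i₂, i₃, i₄], 2, 3, 4, 5, 0, 1,
      strictMono_of_pairwise_ofFn (by simpa [List.ofFn_succ] using h), c₂, rfl, rfl, rfl, rfl, rfl, rfl⟩
  · exact ⟨![i₆, i₁, i₂, i₃, i₄, i₅], 1, 2, 3, 4, 5, 0,
      strictMono_of_pairwise_ofFn (by simpa [List.ofFn_succ] using h), c₁, rfl, rfl, rfl, rfl, rfl, rfl⟩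

theorem exists_checkFive {i₁ i₂ i₃ i₄ i₅ : Fin n} (h : CyclicOrder [i₁, i₂, i₃, i₄, i₅]) :
    ∃ (ι : Fin 5 → Fin n) (a b c d e : Fin 5), StrictMono ι ∧ checkFive a b c d e = true ∧
      i₁ = ι a ∧ i₂ = ι b ∧ i₃ = ι c ∧ i₄ = ι d ∧ i₅ = ι e := by
  obtain ⟨k, hk, h⟩ := exists_rotation h (by simp)
  have hc := checkFive_rotations
  simp only [Bool.and_eq_true] at hc
  obtain ⟨c₀, c₁, c₂, c₃, c₄⟩ := hc
  simp only [List.length_cons, List.length_nil] at hk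
  interval_cases k
  · exact ⟨![i₁, i₂, i₃, i₄, i₅], 0, 1, 2, 3, 4,
      strictMono_of_pairwise_ofFn (by simpa [List.ofFn_succ] using h), c₀, rfl, rfl, rfl, rfl, rfl⟩
  · exact ⟨![i₂, i₃, i₄, i₅, i₁], 4, 0, 1, 2, 3,
      strictMono_of_pairwise_ofFn (by simpa [List.ofFn_succ] using h), c₄, rfl, rfl, rfl, rfl, rfl⟩
  · exact ⟨![i₃, i₄, i₅, i₁, i₂], 3, 4, 0, 1, 2,
      strictMono_of_pairwise_ofFn (by simpa [List.ofFn_succ] using h), c₃, rfl, rfl, rfl, rfl, rfl⟩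
  · exact ⟨![i₄, i₅, i₁, i₂, i₃], 2, 3, 4, 0, 1,
      strictMono_of_pairwise_ofFn (by simpa [List.ofFn_succ] using h), c₂, rfl, rfl, rfl, rfl, rfl⟩
  · exact ⟨![i₅, i₁, i₂, i₃, i₄], 1, 2, 3, 4, 0,
      strictMono_of_pairwise_ofFn (by simpa [List.ofFn_succ] using h), c₁, rfl, rfl, rfl, rfl, rfl⟩

theorem exists_checkFour {i₁ i₂ i₃ i₄ : Fin n} (h : CyclicOrder [i₁, i₂, i₃, i₄]) :
    ∃ (ι : Fin 4 → Fin n) (a b c d : Fin 4), StrictMono ι ∧ checkFour a b c d = true ∧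
      i₁ = ι a ∧ i₂ = ι b ∧ i₃ = ι c ∧ i₄ = ι d := by
  obtain ⟨k, hk, h⟩ := exists_rotation h (by simp)
  have hc := checkFour_rotations
  simp only [Bool.and_eq_true] at hc
  obtain ⟨c₀, c₁, c₂, c₃⟩ := hc
  simp only [List.length_cons, List.length_nil] at hk
  interval_cases k
  · exact ⟨![i₁, i₂, i₃, i₄], 0, 1, 2, 3,
      strictMono_of_pairwise_ofFn (by simpa [List.ofFn_succ] using h), c₀, rfl, rfl, rfl, rfl⟩
  · exact ⟨![i₂, i₃, i₄, i₁], 3, 0, 1, 2,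
      strictMono_of_pairwise_ofFn (by simpa [List.ofFn_succ] using h), c₃, rfl, rfl, rfl, rfl⟩
  · exact ⟨![i₃, i₄, i₁, i₂], 2, 3, 0, 1,
      strictMono_of_pairwise_ofFn (by simpa [List.ofFn_succ] using h), c₂, rfl, rfl, rfl, rfl⟩
  · exact ⟨![i₄, i₁, i₂, i₃], 1, 2, 3, 0,
      strictMono_of_pairwise_ofFn (by simpa [List.ofFn_succ] using h), c₁, rfl, rfl, rfl, rfl⟩

theorem exists_checkThree {i₁ i₂ i₃ : Fin n} (h : CyclicOrder [i₁, i₂, i₃]) :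
    ∃ (ι : Fin 3 → Fin n) (a b c : Fin 3), StrictMono ι ∧ checkThree a b c = true ∧
      i₁ = ι a ∧ i₂ = ι b ∧ i₃ = ι c := by
  obtain ⟨k, hk, h⟩ := exists_rotation h (by simp)
  have hc := checkThree_rotations
  simp only [Bool.and_eq_true] at hc
  obtain ⟨c₀, c₁, c₂⟩ := hc
  simp only [List.length_cons, List.length_nil] at hk
  interval_cases k
  · exact ⟨![i₁, i₂, i₃], 0, 1, 2,
      strictMono_of_pairwise_ofFn (by simpa [List.ofFn_succ] using h), c₀, rfl, rfl, rfl⟩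
  · exact ⟨![i₂, i₃, i₁], 2, 0, 1,
      strictMono_of_pairwise_ofFn (by simpa [List.ofFn_succ] using h), c₂, rfl, rfl, rfl⟩
  · exact ⟨![i₃, i₁, i₂], 1, 2, 0,
      strictMono_of_pairwise_ofFn (by simpa [List.ofFn_succ] using h), c₁, rfl, rfl, rfl⟩

set_option linter.unusedSimpArgs false in
/-- The quantized type I relations hold in the skein algebra. -/
theorem eq_of_typeIRelation {β : R} (hβ : qTwo r * β = 1) {x y : SkeinAlgebra r n}
    (h : TypeIRelation ((r : R) ^ 2) (((r⁻¹ : Rˣ) : R) ^ 2) β (fun i => t r {i})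
      (sPair (qTwo r) β (t r)) (sTriple β (t r)) x y) : x = y := by
  have hT : qTwo r = (r : R) ^ 2 + ((r⁻¹ : Rˣ) : R) ^ 2 := by simp [qTwo]
  -- With s and s₃ opaque, the comparison of the two forms of a relation is linear in the
  -- noncommutative monomials.
  generalize hs : sPair (qTwo r) β (t r (n := n)) = s at h
  generalize hs₃ : sTriple β (t r (n := n)) = s₃ at h
  rw [← sub_eq_zero]
  cases h
  case six₁ i₁ i₂ i₃ i₄ i₅ i₆ h =>
    obtain ⟨ι, a, b, c, d, e, f, hι, hc, rfl, rfl, rfl, rfl, rfl, rfl⟩ := exists_checkSix h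
    obtain ⟨F, hF⟩ := exists_embed r hι
    simp only [checkSix, Bool.and_eq_true] at hc
    -- Zero is replaced by the image of the checked expression. It remains to compare the
    -- coefficients of equal products; the other cases are alike.
    rw [← map_zero F, ← exprVal_eq_zero hβ hc.1]
    simp only [exprVal, six₁Expr, List.map_cons, List.map_nil, List.sum_cons, List.sum_nil,
      prodVal, List.prod_cons, List.prod_nil, map_add, map_smul, map_mul, map_one, map_zero,
      embed_val_s hF hι, embed_val_s3 hF, embed_val_t hF, hs, hs₃, polyVal, Mono.val, mul_one,
      cond_true, cond_false, pow_two (s _ _), pow_two (s₃ _ _ _), mul_add, add_mul, mul_sub,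
      sub_mul, mul_smul_comm, smul_mul_assoc, ← mul_assoc]
    rw [hT]
    module
  case six₂ i₁ i₂ i₃ i₄ i₅ i₆ h =>
    obtain ⟨ι, a, b, c, d, e, f, hι, hc, rfl, rfl, rfl, rfl, rfl, rfl⟩ := exists_checkSix h
    obtain ⟨F, hF⟩ := exists_embed r hι
    simp only [checkSix, Bool.and_eq_true] at hc
    rw [← map_zero F, ← exprVal_eq_zero hβ hc.2.1]
    simp only [exprVal, six₂Expr, List.map_cons, List.map_nil, List.sum_cons, List.sum_nil,
      prodVal, List.prod_cons, List.prod_nil, map_add, map_smul, map_mul, map_one, map_zero,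
      embed_val_s hF hι, embed_val_s3 hF, embed_val_t hF, hs, hs₃, polyVal, Mono.val, mul_one,
      cond_true, cond_false, pow_two (s _ _), pow_two (s₃ _ _ _), mul_add, add_mul, mul_sub,
      sub_mul, mul_smul_comm, smul_mul_assoc, ← mul_assoc]
    rw [hT]
    module
  case six₃ i₁ i₂ i₃ i₄ i₅ i₆ h =>
    obtain ⟨ι, a, b, c, d, e, f, hι, hc, rfl, rfl, rfl, rfl, rfl, rfl⟩ := exists_checkSix h
    obtain ⟨F, hF⟩ := exists_embed r hι
    simp only [checkSix, Bool.and_eq_true] at hc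
    rw [← map_zero F, ← exprVal_eq_zero hβ hc.2.2.1]
    simp only [exprVal, six₃Expr, List.map_cons, List.map_nil, List.sum_cons, List.sum_nil,
      prodVal, List.prod_cons, List.prod_nil, map_add, map_smul, map_mul, map_one, map_zero,
      embed_val_s hF hι, embed_val_s3 hF, embed_val_t hF, hs, hs₃, polyVal, Mono.val, mul_one,
      cond_true, cond_false, pow_two (s _ _), pow_two (s₃ _ _ _), mul_add, add_mul, mul_sub,
      sub_mul, mul_smul_comm, smul_mul_assoc, ← mul_assoc]
    rw [hT]
    module
  case six₄ i₁ i₂ i₃ i₄ i₅ i₆ h =>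
    obtain ⟨ι, a, b, c, d, e, f, hι, hc, rfl, rfl, rfl, rfl, rfl, rfl⟩ := exists_checkSix h
    obtain ⟨F, hF⟩ := exists_embed r hι
    simp only [checkSix, Bool.and_eq_true] at hc
    rw [← map_zero F, ← exprVal_eq_zero hβ hc.2.2.2]
    simp only [exprVal, six₄Expr, List.map_cons, List.map_nil, List.sum_cons, List.sum_nil,
      prodVal, List.prod_cons, List.prod_nil, map_add, map_smul, map_mul, map_one, map_zero,
      embed_val_s hF hι, embed_val_s3 hF, embed_val_t hF, hs, hs₃, polyVal, Mono.val, mul_one,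
      cond_true, cond_false, pow_two (s _ _), pow_two (s₃ _ _ _), mul_add, add_mul, mul_sub,
      sub_mul, mul_smul_comm, smul_mul_assoc, ← mul_assoc]
    rw [hT]
    module
  case five₁ i₁ i₂ i₃ i₄ i₅ h =>
    obtain ⟨ι, a, b, c, d, e, hι, hc, rfl, rfl, rfl, rfl, rfl⟩ := exists_checkFive h
    obtain ⟨F, hF⟩ := exists_embed r hι
    simp only [checkFive, Bool.and_eq_true] at hc
    rw [← map_zero F, ← exprVal_eq_zero hβ hc.1]
    simp only [exprVal, five₁Expr, List.map_cons, List.map_nil, List.sum_cons, List.sum_nil,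
      prodVal, List.prod_cons, List.prod_nil, map_add, map_smul, map_mul, map_one, map_zero,
      embed_val_s hF hι, embed_val_s3 hF, embed_val_t hF, hs, hs₃, polyVal, Mono.val, mul_one,
      cond_true, cond_false, pow_two (s _ _), pow_two (s₃ _ _ _), mul_add, add_mul, mul_sub,
      sub_mul, mul_smul_comm, smul_mul_assoc, ← mul_assoc]
    rw [hT]
    module
  case five₂ i₁ i₂ i₃ i₄ i₅ h =>
    obtain ⟨ι, a, b, c, d, e, hι, hc, rfl, rfl, rfl, rfl, rfl⟩ := exists_checkFive h
    obtain ⟨F, hF⟩ := exists_embed r hι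
    simp only [checkFive, Bool.and_eq_true] at hc
    rw [← map_zero F, ← exprVal_eq_zero hβ hc.2.1]
    simp only [exprVal, five₂Expr, List.map_cons, List.map_nil, List.sum_cons, List.sum_nil,
      prodVal, List.prod_cons, List.prod_nil, map_add, map_smul, map_mul, map_one, map_zero,
      embed_val_s hF hι, embed_val_s3 hF, embed_val_t hF, hs, hs₃, polyVal, Mono.val, mul_one,
      cond_true, cond_false, pow_two (s _ _), pow_two (s₃ _ _ _), mul_add, add_mul, mul_sub,
      sub_mul, mul_smul_comm, smul_mul_assoc, ← mul_assoc]
    rw [hT]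
    module
  case five₃ i₁ i₂ i₃ i₄ i₅ h =>
    obtain ⟨ι, a, b, c, d, e, hι, hc, rfl, rfl, rfl, rfl, rfl⟩ := exists_checkFive h
    obtain ⟨F, hF⟩ := exists_embed r hι
    simp only [checkFive, Bool.and_eq_true] at hc
    rw [← map_zero F, ← exprVal_eq_zero hβ hc.2.2]
    simp only [exprVal, five₃Expr, List.map_cons, List.map_nil, List.sum_cons, List.sum_nil,
      prodVal, List.prod_cons, List.prod_nil, map_add, map_smul, map_mul, map_one, map_zero,
      embed_val_s hF hι, embed_val_s3 hF, embed_val_t hF, hs, hs₃, polyVal, Mono.val, mul_one,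
      cond_true, cond_false, pow_two (s _ _), pow_two (s₃ _ _ _), mul_add, add_mul, mul_sub,
      sub_mul, mul_smul_comm, smul_mul_assoc, ← mul_assoc]
    rw [hT]
    module
  case four₁ i₁ i₂ i₃ i₄ h =>
    obtain ⟨ι, a, b, c, d, hι, hc, rfl, rfl, rfl, rfl⟩ := exists_checkFour h
    obtain ⟨F, hF⟩ := exists_embed r hι
    simp only [checkFour, Bool.and_eq_true] at hc
    rw [← map_zero F, ← exprVal_eq_zero hβ hc.1]
    simp only [exprVal, four₁Expr, List.map_cons, List.map_nil, List.sum_cons, List.sum_nil,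
      prodVal, List.prod_cons, List.prod_nil, map_add, map_smul, map_mul, map_one, map_zero,
      embed_val_s hF hι, embed_val_s3 hF, embed_val_t hF, hs, hs₃, polyVal, Mono.val, mul_one,
      cond_true, cond_false, pow_two (s _ _), pow_two (s₃ _ _ _), mul_add, add_mul, mul_sub,
      sub_mul, mul_smul_comm, smul_mul_assoc, ← mul_assoc]
    rw [hT]
    module
  case four₂ i₁ i₂ i₃ i₄ h =>
    obtain ⟨ι, a, b, c, d, hι, hc, rfl, rfl, rfl, rfl⟩ := exists_checkFour h
    obtain ⟨F, hF⟩ := exists_embed r hι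
    simp only [checkFour, Bool.and_eq_true] at hc
    rw [← map_zero F, ← exprVal_eq_zero hβ hc.2]
    simp only [exprVal, four₂Expr, List.map_cons, List.map_nil, List.sum_cons, List.sum_nil,
      prodVal, List.prod_cons, List.prod_nil, map_add, map_smul, map_mul, map_one, map_zero,
      embed_val_s hF hι, embed_val_s3 hF, embed_val_t hF, hs, hs₃, polyVal, Mono.val, mul_one,
      cond_true, cond_false, pow_two (s _ _), pow_two (s₃ _ _ _), mul_add, add_mul, mul_sub,
      sub_mul, mul_smul_comm, smul_mul_assoc, ← mul_assoc]
    rw [hT]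
    module
  case three i₁ i₂ i₃ h =>
    obtain ⟨ι, a, b, c, hι, hc, rfl, rfl, rfl⟩ := exists_checkThree h
    obtain ⟨F, hF⟩ := exists_embed r hι
    rw [← map_zero F, ← exprVal_eq_zero hβ hc]
    simp only [exprVal, threeExpr, List.map_cons, List.map_nil, List.sum_cons, List.sum_nil,
      prodVal, List.prod_cons, List.prod_nil, map_add, map_smul, map_mul, map_one, map_zero,
      embed_val_s hF hι, embed_val_s3 hF, embed_val_t hF, hs, hs₃, polyVal, Mono.val, mul_one,
      cond_true, cond_false, pow_two (s _ _), pow_two (s₃ _ _ _), mul_add, add_mul, mul_sub,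
      sub_mul, mul_smul_comm, smul_mul_assoc, ← mul_assoc]
    rw [hT]
    module

end SkeinAlgebra

/-! ### The mirror homomorphism. -/

namespace SkeinAlgebra

open Slice

variable {R : Type*} [CommRing R] {r : Rˣ} {n : ℕ}

/-- The mirror image of an event. -/
def mirrorEvent : Event → Event
  | .cross b => .cross !b
  | e => e

/-- The mirror image of a word: all crossings are changed. -/
def mirrorWord (w : List Slice) : List Slice := w.map fun s => ⟨mirrorEvent s.kind, s.pos⟩

@[simp] theorem mirrorWord_append (u v : List Slice) :
    mirrorWord (u ++ v) = mirrorWord u ++ mirrorWord v := List.map_append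

theorem isTangle_mirrorWord {m k : ℕ} {w : List Slice} (h : IsTangle m k w) :
    IsTangle m k (mirrorWord w) := by
  induction h with
  | nil => exact .nil
  | cons e i j k w _ ih =>
    cases e with
    | cross b => exact IsTangle.cons (.cross !b) i j k _ ih
    | birth => exact IsTangle.cons .birth i j k _ ih
    | death => exact IsTangle.cons .death i j k _ ih
    | punct => exact IsTangle.cons .punct i j k _ ih

/-- Every family of moves is closed under changing all crossings; the condition in the third
Reidemeister move is unaffected by negating all three signs. -/
theorem move_mirrorWord {x y : List Slice} (h : Move x y) :
    Move (mirrorWord x) (mirrorWord y) := by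
  cases h with
  | interchange a b i d hab =>
    have h := Move.interchange (mirrorEvent a) (mirrorEvent b) i d
      (by cases a <;> cases b <;> simp_all [mirrorEvent])
    cases a <;> exact h
  | zigzag i => exact .zigzag i
  | zagzig i => exact .zagzig i
  | slideBirth i b => exact .slideBirth i !b
  | slideDeath i b => exact .slideDeath i !b
  | reidemeisterI i b => exact .reidemeisterI i !b
  | reidemeisterII i b => exact .reidemeisterII i !b
  | reidemeisterIII i a b c h =>
    exact .reidemeisterIII i (!a) (!b) (!c) (by simpa using h)

/-- Changing all crossings turns the stack of strands upside down, so the upper and the lower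
diagram exchange their roles. This is why products are reversed. -/
theorem superposed_mirrorWord {c : List Bool} {w u v : List Slice} (h : Superposed c w u v) :
    Superposed (c.map not) (mirrorWord w) (mirrorWord v) (mirrorWord u) := by
  have hc (l : List Bool) : (l.map not).count true = l.count false ∧
      (l.map not).count false = l.count true := by
    induction l with
    | nil => simp
    | cons x l ih => cases x <;> simp [ih]
  induction h with
  | nil => exact .nil
  | birthUpper l r w u v h ih =>
    have := Superposed.birthLower (l.map not) (r.map not) _ _ _ (by simpa using ih)
    simpa [hc, mirrorWord, mirrorEvent] using this
  | birthLower l r w u v h ih =>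
    have := Superposed.birthUpper (l.map not) (r.map not) _ _ _ (by simpa using ih)
    simpa [hc, mirrorWord, mirrorEvent] using this
  | deathUpper l r w u v h ih =>
    have := Superposed.deathLower (l.map not) (r.map not) _ _ _ (by simpa using ih)
    simpa [hc, mirrorWord, mirrorEvent] using this
  | deathLower l r w u v h ih =>
    have := Superposed.deathUpper (l.map not) (r.map not) _ _ _ (by simpa using ih)
    simpa [hc, mirrorWord, mirrorEvent] using this
  | crossUpper b l r w u v h ih =>
    have := Superposed.crossLower (!b) (l.map not) (r.map not) _ _ _ (by simpa using ih)
    simpa [hc, mirrorWord, mirrorEvent] using this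
  | crossLower b l r w u v h ih =>
    have := Superposed.crossUpper (!b) (l.map not) (r.map not) _ _ _ (by simpa using ih)
    simpa [hc, mirrorWord, mirrorEvent] using this
  | crossMixedUp l r w u v h ih =>
    have := Superposed.crossMixedDown (l.map not) (r.map not) _ _ _ (by simpa using ih)
    simpa [hc, mirrorWord, mirrorEvent] using this
  | crossMixedDown l r w u v h ih =>
    have := Superposed.crossMixedUp (l.map not) (r.map not) _ _ _ (by simpa using ih)
    simpa [hc, mirrorWord, mirrorEvent] using this
  | punct l r w u v h ih =>
    have := Superposed.punct (l.map not) (r.map not) _ _ _ (by simpa using ih)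
    simpa [hc, mirrorWord, mirrorEvent] using this

/-- The mirror image of a link diagram. -/
def mirrorDiagram (D : LinkDiagram n) : LinkDiagram n := ⟨mirrorWord D.1, isTangle_mirrorWord D.2⟩

/-- The two crossing relations are exchanged. Their weights match because the source has parameter
r⁻¹, and the value of a circle is symmetric in q and q⁻¹. -/
theorem skeinRel_mirror {x y : FreeAlgebra R (LinkDiagram n)} (h : SkeinRel r⁻¹ n x y) :
    FreeAlgebra.lift R (fun D => MulOpposite.op (ofDiagram r (mirrorDiagram D))) x =
      FreeAlgebra.lift R (fun D => MulOpposite.op (ofDiagram r (mirrorDiagram D))) y := by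
  cases h with
  | isotopy x y u v D E h hD hE =>
    rw [FreeAlgebra.lift_ι_apply, FreeAlgebra.lift_ι_apply]
    congr 1
    exact RingQuot.mkAlgHom_rel R (.isotopy _ _ (mirrorWord u) (mirrorWord v) _ _
      (move_mirrorWord h) (by simp [mirrorDiagram, hD]) (by simp [mirrorDiagram, hE]))
  | crossUp i u v D E F hD hE hF =>
    have := RingQuot.mkAlgHom_rel R (SkeinRel.crossDown (r := r) i (mirrorWord u) (mirrorWord v)
      (mirrorDiagram D) (mirrorDiagram E) (mirrorDiagram F)
      (by simp [mirrorDiagram, hD]; rfl) (by simp [mirrorDiagram, hE]; rfl)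
      (by simp [mirrorDiagram, hF]))
    rw [map_add, map_smul, map_smul] at this
    rw [map_add, map_smul, map_smul, FreeAlgebra.lift_ι_apply, FreeAlgebra.lift_ι_apply,
      FreeAlgebra.lift_ι_apply, inv_inv, ← MulOpposite.op_smul, ← MulOpposite.op_smul,
      ← MulOpposite.op_add, add_comm]
    exact congrArg _ this
  | crossDown i u v D E F hD hE hF =>
    have := RingQuot.mkAlgHom_rel R (SkeinRel.crossUp (r := r) i (mirrorWord u) (mirrorWord v)
      (mirrorDiagram D) (mirrorDiagram E) (mirrorDiagram F)
      (by simp [mirrorDiagram, hD]; rfl) (by simp [mirrorDiagram, hE]; rfl)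
      (by simp [mirrorDiagram, hF]))
    rw [map_add, map_smul, map_smul] at this
    rw [map_add, map_smul, map_smul, FreeAlgebra.lift_ι_apply, FreeAlgebra.lift_ι_apply,
      FreeAlgebra.lift_ι_apply, inv_inv, ← MulOpposite.op_smul, ← MulOpposite.op_smul,
      ← MulOpposite.op_add, add_comm]
    exact congrArg _ this
  | circle i u v D E hD hE =>
    have := RingQuot.mkAlgHom_rel R (SkeinRel.circle (r := r) i (mirrorWord u) (mirrorWord v)
      (mirrorDiagram D) (mirrorDiagram E) (by simp [mirrorDiagram, hD]; rfl)
      (by simp [mirrorDiagram, hE]))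
    rw [map_smul] at this
    rw [map_smul, FreeAlgebra.lift_ι_apply, FreeAlgebra.lift_ι_apply, ← MulOpposite.op_smul,
      inv_pow, inv_inv, add_comm]
    exact congrArg _ this
  | empty D hD =>
    have := RingQuot.mkAlgHom_rel R (SkeinRel.empty (r := r) (mirrorDiagram D)
      (by simp [mirrorDiagram, hD, mirrorWord, mirrorEvent]))
    rw [map_one] at this
    rw [FreeAlgebra.lift_ι_apply, map_one, ← MulOpposite.op_one]
    exact congrArg _ this
  | superposition D E F h =>
    have := RingQuot.mkAlgHom_rel R (SkeinRel.superposition (r := r) (mirrorDiagram D)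
      (mirrorDiagram F) (mirrorDiagram E) (superposed_mirrorWord h))
    rw [map_mul] at this
    rw [map_mul, FreeAlgebra.lift_ι_apply, FreeAlgebra.lift_ι_apply, FreeAlgebra.lift_ι_apply,
      ← MulOpposite.op_mul]
    exact congrArg _ this

/-- Changing all crossings inverts `q` and reverses products. -/
noncomputable def mirror (r : Rˣ) (n : ℕ) :
    SkeinAlgebra r⁻¹ n →ₐ[R] (SkeinAlgebra r n)ᵐᵒᵖ :=
  RingQuot.liftAlgHom R
    ⟨FreeAlgebra.lift R fun D => MulOpposite.op (ofDiagram r (mirrorDiagram D)),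
      fun _ _ h => skeinRel_mirror h⟩

theorem mirror_ofDiagram (D : LinkDiagram n) :
    mirror r n (ofDiagram r⁻¹ D) = MulOpposite.op (ofDiagram r (mirrorDiagram D)) := by
  unfold ofDiagram mirror
  rw [RingQuot.liftAlgHom_mkAlgHom_apply]
  exact FreeAlgebra.lift_ι_apply _ _

theorem mirror_t (S : Finset (Fin n)) :
    mirror r n (t r⁻¹ S) = MulOpposite.op (t r S) := by
  rw [t, mirror_ofDiagram, t]
  congr 2
  apply Subtype.ext
  simp [mirrorDiagram, curve, curveWord, mirrorWord, mirrorEvent]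

end SkeinAlgebra

/-! ### Naturality of the relations under algebra homomorphisms. -/

section

variable {R A B : Type*} [CommRing R] [Ring A] [Algebra R A] [Ring B] [Algebra R B] {n : ℕ}
  {q p β : R} {t : Fin n → A} {s : Fin n → Fin n → A} {s₃ : Fin n → Fin n → Fin n → A}

theorem TypeIRelation.map (φ : A →ₐ[R] B) {x y : A} (h : TypeIRelation q p β t s s₃ x y) :
    TypeIRelation q p β (fun i => φ (t i)) (fun i j => φ (s i j)) (fun i j k => φ (s₃ i j k))
      (φ x) (φ y) := by
  cases h
  case six₁ i₁ i₂ i₃ i₄ i₅ i₆ h => convert TypeIRelation.six₁ i₁ i₂ i₃ i₄ i₅ i₆ h using 1 <;> simp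
  case six₂ i₁ i₂ i₃ i₄ i₅ i₆ h => convert TypeIRelation.six₂ i₁ i₂ i₃ i₄ i₅ i₆ h using 1 <;> simp
  case six₃ i₁ i₂ i₃ i₄ i₅ i₆ h => convert TypeIRelation.six₃ i₁ i₂ i₃ i₄ i₅ i₆ h using 1 <;> simp
  case six₄ i₁ i₂ i₃ i₄ i₅ i₆ h => convert TypeIRelation.six₄ i₁ i₂ i₃ i₄ i₅ i₆ h using 1 <;> simp
  case five₁ i₁ i₂ i₃ i₄ i₅ h => convert TypeIRelation.five₁ i₁ i₂ i₃ i₄ i₅ h using 1 <;> simp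
  case five₂ i₁ i₂ i₃ i₄ i₅ h => convert TypeIRelation.five₂ i₁ i₂ i₃ i₄ i₅ h using 1 <;> simp
  case five₃ i₁ i₂ i₃ i₄ i₅ h => convert TypeIRelation.five₃ i₁ i₂ i₃ i₄ i₅ h using 1 <;> simp
  case four₁ i₁ i₂ i₃ i₄ h => convert TypeIRelation.four₁ i₁ i₂ i₃ i₄ h using 1 <;> simp
  case four₂ i₁ i₂ i₃ i₄ h => convert TypeIRelation.four₂ i₁ i₂ i₃ i₄ h using 1 <;> simp
  case three i₁ i₂ i₃ h => convert TypeIRelation.three i₁ i₂ i₃ h using 1 <;> simp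

/-- Both sides are expressions in the elements t, s, s₃, so a relation among their images comes from
the same relation among the elements. No injectivity or surjectivity of φ is involved. -/
theorem TypeIRelation.exists_of_map (φ : A →ₐ[R] B) {x y : B}
    (h : TypeIRelation q p β (fun i => φ (t i)) (fun i j => φ (s i j))
      (fun i j k => φ (s₃ i j k)) x y) :
    ∃ x' y', TypeIRelation q p β t s s₃ x' y' ∧ φ x' = x ∧ φ y' = y := by
  cases h
  case six₁ i₁ i₂ i₃ i₄ i₅ i₆ h => exact ⟨_, _, .six₁ i₁ i₂ i₃ i₄ i₅ i₆ h, by simp, by simp⟩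
  case six₂ i₁ i₂ i₃ i₄ i₅ i₆ h => exact ⟨_, _, .six₂ i₁ i₂ i₃ i₄ i₅ i₆ h, by simp, by simp⟩
  case six₃ i₁ i₂ i₃ i₄ i₅ i₆ h => exact ⟨_, _, .six₃ i₁ i₂ i₃ i₄ i₅ i₆ h, by simp, by simp⟩
  case six₄ i₁ i₂ i₃ i₄ i₅ i₆ h => exact ⟨_, _, .six₄ i₁ i₂ i₃ i₄ i₅ i₆ h, by simp, by simp⟩
  case five₁ i₁ i₂ i₃ i₄ i₅ h => exact ⟨_, _, .five₁ i₁ i₂ i₃ i₄ i₅ h, by simp, by simp⟩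
  case five₂ i₁ i₂ i₃ i₄ i₅ h => exact ⟨_, _, .five₂ i₁ i₂ i₃ i₄ i₅ h, by simp, by simp⟩
  case five₃ i₁ i₂ i₃ i₄ i₅ h => exact ⟨_, _, .five₃ i₁ i₂ i₃ i₄ i₅ h, by simp, by simp⟩
  case four₁ i₁ i₂ i₃ i₄ h => exact ⟨_, _, .four₁ i₁ i₂ i₃ i₄ h, by simp, by simp⟩
  case four₂ i₁ i₂ i₃ i₄ h => exact ⟨_, _, .four₂ i₁ i₂ i₃ i₄ h, by simp, by simp⟩
  case three i₁ i₂ i₃ h => exact ⟨_, _, .three i₁ i₂ i₃ h, by simp, by simp⟩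

end

/-! ### Mirrors of the relations, and commutativity for q = 1. -/

namespace SkeinAlgebra

open Slice

variable {R : Type*} [CommRing R] {r : Rˣ} {n : ℕ}

theorem commute_t_single (i : Fin n) (z : SkeinAlgebra r n) : t r {i} * z = z * t r {i} := by
  have h := tl_eq_t (r := r) [i]
  simp only [List.map_cons, List.map_nil, List.toFinset_cons, List.toFinset_nil,
    insert_empty_eq] at h
  rw [← h, commute_loop i.2]

theorem mirror_sPair (α β : R) (i j : Fin n) :
    mirror r n (sPair α β (t r⁻¹) i j) = MulOpposite.op (sPair α β (t r) i j) := by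
  by_cases h : i = j
  · simp [sPair, h, mirror_t]
  · simp [sPair, h, mirror_t, commute_t_single i (t r {j})]

/-- The reversal of products is invisible here, since each product in s_ijk has at most one factor
that is not a central loop. -/
theorem mirror_sTriple (β : R) (i j k : Fin n) :
    mirror r n (sTriple β (t r⁻¹) i j k) = MulOpposite.op (sTriple β (t r) i j k) := by
  have h : t r {k} * (t r {j} * t r {i}) = t r {i} * t r {j} * t r {k} := by
    rw [commute_t_single k, commute_t_single j]
  simp only [sTriple, map_add, map_smul, map_mul, mirror_t, ← MulOpposite.op_mul, h,
    ← MulOpposite.op_add, ← MulOpposite.op_smul, commute_t_single i (t r {j, k}),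
    commute_t_single j (t r {i, k}), commute_t_single k (t r {i, j})]

/-- The mirrors of the quantized type I relations hold in the skein algebra. -/
theorem eq_of_typeIRelation_mirror {β : R} (hβ : qTwo r * β = 1) {x y : (SkeinAlgebra r n)ᵐᵒᵖ}
    (h : TypeIRelation (((r⁻¹ : Rˣ) : R) ^ 2) ((r : R) ^ 2) β
      (fun i => MulOpposite.op (t r {i})) (fun i j => MulOpposite.op (sPair (qTwo r) β (t r) i j))
      (fun i j k => MulOpposite.op (sTriple β (t r) i j k)) x y) : x = y := by
  have hT : qTwo r⁻¹ = qTwo r := by simp [qTwo, add_comm]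
  -- The generators are recognized as images under `mirror`, which exhibits the relation as the
  -- image of an unmirrored one for the parameter r⁻¹.
  simp only [← mirror_t, ← mirror_sPair, ← mirror_sTriple (r := r)] at h
  obtain ⟨x, y, h, rfl, rfl⟩ := h.exists_of_map
  exact congrArg _ (eq_of_typeIRelation (hT.symm ▸ hβ) (by rwa [hT, inv_inv]))

/-! ### Commutativity -/

/-- When r⁻¹ = r the two smoothings have equal weights, so an overcrossing and an undercrossing
resolve to the same combination and may be exchanged one by one. -/
theorem ofWord_mirrorWord (hr : r⁻¹ = r) {u v : List Slice} {m k : ℕ} (hu : Runs 0 u m)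
    (hv : Runs m v k) : ofWord r n (u ++ mirrorWord v) = ofWord r n (u ++ v) := by
  induction v generalizing u m with
  | nil => rfl
  | cons s v ih =>
    obtain ⟨e, i⟩ := s
    have hi := (runs_cons.1 hv).1
    have h' := (runs_cons.1 hv).2
    have hu' : Runs 0 (u ++ [⟨e, i⟩]) (m - e.ins + e.outs) :=
      runs_append.2 ⟨m, hu, runs_cons.2 ⟨hi, runs_nil.2 rfl⟩⟩
    have h := ih hu' h'
    simp only [List.append_assoc, List.cons_append, List.nil_append] at h
    rw [← h]
    cases e with
    | cross b =>
      cases b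
      · show ofWord r n (u ++ cross i true :: mirrorWord v) = _
        rw [ofWord_crossUp hu hi, ofWord_crossDown hu hi, hr, add_comm]
      · show ofWord r n (u ++ cross i false :: mirrorWord v) = _
        rw [ofWord_crossUp hu hi, ofWord_crossDown hu hi, hr, add_comm]
    | birth => rfl
    | death => rfl
    | punct => rfl

/-- A curve is a crossingless diagram, so the construction for drawing one curve above such a
diagram applies. -/
theorem exists_superposed_curveB (B B' : List Bool) (h : B.length = B'.length) :
    ∃ w, Superposed [] w (curveB B) (curveB B') := by
  obtain ⟨s, hs⟩ : ∃ s : Stk, s.fwd = curveB B' := by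
    refine ⟨.b 0 (B'.foldr (fun b s => .p (bif b then 1 else 2) s) (.d 0 .nil)), ?_⟩
    rw [curveB, Stk.fwd]
    congr 1
    induction B' generalizing B with
    | nil => rfl
    | cons b B' ih =>
      obtain ⟨c, B, rfl⟩ := List.exists_cons_of_length_pos (show 0 < B.length by simp [h])
      rw [List.foldr_cons, Stk.fwd, ih B (by simpa using h)]
      rfl
  have h1 := superposed_sup s (B := B) (p := 0) (q := 0) (by
    rw [hs, h]
    exact isTangle_curveB B')
  rw [hs] at h1
  exact ⟨_, Superposed.birthUpper [] [] _ _ _ h1⟩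

theorem mirrorWord_curveB (B : List Bool) : mirrorWord (curveB B) = curveB B := by
  simp [mirrorWord, curveB, curveTail, mirrorEvent]

/-- A superposition of the two curves represents one product and its mirror image represents the
other, while for r⁻¹ = r both have the same class. -/
theorem commute_t (hr : r⁻¹ = r) (S T : Finset (Fin n)) : Commute (t r S) (t r T) := by
  rw [t_eq_ofWord, t_eq_ofWord]
  obtain ⟨w, hw⟩ := exists_superposed_curveB
    ((List.finRange n).map fun k => decide (k ∈ S)) ((List.finRange n).map fun k => decide (k ∈ T))
    (by simp)
  have h := superposed_mirrorWord hw
  rw [mirrorWord_curveB, mirrorWord_curveB] at h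
  obtain ⟨k, hk, -⟩ := isTangle_of_superposed hw
  have h' := ofWord_mirrorWord (n := n) hr (runs_nil.2 rfl) (isTangle_iff.1 hk).1
  rw [List.nil_append, List.nil_append, ofWord_superposed hw] at h'
  rw [Commute, SemiconjBy, ← h', ← ofWord_superposed h]

end SkeinAlgebra

/-! ### Classical relations as specializations of the quantized ones. -/

section Classical

set_option linter.unusedSimpArgs false

variable {R A : Type*} [CommRing R] [CommRing A] [Algebra R A] {n : ℕ}

/-- The classical type I relation for two triples of indices is one of the quantized ones. -/
def ClassicalFromQuantized (β : R) (t : Fin n → A) (s : Fin n → Fin n → A)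
    (s₃ : Fin n → Fin n → Fin n → A) (a₁ a₂ a₃ b₁ b₂ b₃ : Fin n) : Prop :=
  ∃ x y : A, TypeIRelation (1 : R) 1 β t s s₃ x y ∧ ∀ d,
    d = 2 * s₃ a₁ a₂ a₃ * s₃ b₁ b₂ b₃ - (s a₁ b₁ * s a₂ b₂ * s a₃ b₃ - s a₁ b₁ * s a₂ b₃ * s a₃ b₂
        - s a₁ b₂ * s a₂ b₁ * s a₃ b₃ + s a₁ b₂ * s a₂ b₃ * s a₃ b₁ + s a₁ b₃ * s a₂ b₁ * s a₃ b₂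
        - s a₁ b₃ * s a₂ b₂ * s a₃ b₁) →
      x - y = d ∨ y - x = d

namespace ClassicalFromQuantized

variable {β : R} {t : Fin n → A} {s : Fin n → Fin n → A} {s₃ : Fin n → Fin n → Fin n → A}
  {a₁ a₂ a₃ b₁ b₂ b₃ : Fin n}

/-- Exchanging the triples transposes the determinant. Since the target difference is a variable d,
it can be rewritten without touching the witnesses x and y. -/
theorem swap (hs : ∀ i j, s i j = s j i)
    (h : ClassicalFromQuantized β t s s₃ a₁ a₂ a₃ b₁ b₂ b₃) :
    ClassicalFromQuantized β t s s₃ b₁ b₂ b₃ a₁ a₂ a₃ := by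
  obtain ⟨x, y, h, hd⟩ := h
  refine ⟨x, y, h, fun d h' => hd d ?_⟩
  rw [h', hs b₁, hs b₁, hs b₁, hs b₂, hs b₂, hs b₂, hs b₃, hs b₃, hs b₃]
  ring

/-- A cyclic permutation of three rows is even, so the determinant does not change. -/
theorem rotate_left (hs₃ : ∀ i j k, s₃ i j k = s₃ j k i)
    (h : ClassicalFromQuantized β t s s₃ a₁ a₂ a₃ b₁ b₂ b₃) :
    ClassicalFromQuantized β t s s₃ a₂ a₃ a₁ b₁ b₂ b₃ := by
  obtain ⟨x, y, h, hd⟩ := h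
  refine ⟨x, y, h, fun d h' => hd d ?_⟩
  rw [h', hs₃ a₁]
  ring

theorem rotate_right (hs₃ : ∀ i j k, s₃ i j k = s₃ j k i)
    (h : ClassicalFromQuantized β t s s₃ a₁ a₂ a₃ b₁ b₂ b₃) :
    ClassicalFromQuantized β t s s₃ a₁ a₂ a₃ b₂ b₃ b₁ := by
  obtain ⟨x, y, h, hd⟩ := h
  refine ⟨x, y, h, fun d h' => hd d ?_⟩
  rw [h', hs₃ b₁]
  ring

/-- At q = 1 the coefficients containing differences of powers of q vanish and q³ + q⁻³ becomes 2.
Here the six surviving products form the determinant with the sign opposite to that of d, hence the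
second alternative; in the lemmas below it is the first one. -/
theorem six₂ {i₁ i₂ i₃ i₄ i₅ i₆ : Fin n}
    (h : CyclicOrder [i₁, i₂, i₃, i₄, i₅, i₆]) :
    ClassicalFromQuantized β t s s₃ i₁ i₂ i₃ i₄ i₅ i₆ := by
  refine ⟨_, _, .six₂ i₁ i₂ i₃ i₄ i₅ i₆ h, fun d hd => .inr ?_⟩
  simp only [hd, Algebra.smul_def, map_add, map_sub, map_mul, map_pow, map_one,
    map_ofNat]
  ring

theorem six₃ (hs : ∀ i j, s i j = s j i) {i₁ i₂ i₃ i₄ i₅ i₆ : Fin n}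
    (h : CyclicOrder [i₁, i₂, i₃, i₄, i₅, i₆]) :
    ClassicalFromQuantized β t s s₃ i₁ i₂ i₄ i₃ i₅ i₆ := by
  refine ⟨_, _, .six₃ i₁ i₂ i₃ i₄ i₅ i₆ h, fun d hd => .inl ?_⟩
  simp only [hd, hs i₄ i₃, Algebra.smul_def, map_add, map_sub, map_mul, map_pow, map_one,
    map_ofNat]
  ring

theorem six₄ (hs : ∀ i j, s i j = s j i) {i₁ i₂ i₃ i₄ i₅ i₆ : Fin n}
    (h : CyclicOrder [i₁, i₂, i₃, i₄, i₅, i₆]) :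
    ClassicalFromQuantized β t s s₃ i₁ i₃ i₅ i₂ i₄ i₆ := by
  refine ⟨_, _, .six₄ i₁ i₂ i₃ i₄ i₅ i₆ h, fun d hd => .inl ?_⟩
  simp only [hd, hs i₃ i₂, hs i₅ i₂, hs i₅ i₄, Algebra.smul_def, map_add, map_sub, map_mul, map_pow, map_one,
    map_ofNat]
  ring

theorem five₁ {i₁ i₂ i₃ i₄ i₅ : Fin n}
    (h : CyclicOrder [i₁, i₂, i₃, i₄, i₅]) :
    ClassicalFromQuantized β t s s₃ i₁ i₂ i₃ i₃ i₄ i₅ := by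
  refine ⟨_, _, .five₁ i₁ i₂ i₃ i₄ i₅ h, fun d hd => .inl ?_⟩
  simp only [hd, Algebra.smul_def, map_add, map_sub, map_mul, map_pow, map_one,
    map_ofNat]
  ring

theorem five₂ (hs : ∀ i j, s i j = s j i) {i₁ i₂ i₃ i₄ i₅ : Fin n}
    (h : CyclicOrder [i₁, i₂, i₃, i₄, i₅]) :
    ClassicalFromQuantized β t s s₃ i₁ i₃ i₅ i₂ i₃ i₄ := by
  refine ⟨_, _, .five₂ i₁ i₂ i₃ i₄ i₅ h, fun d hd => .inl ?_⟩
  simp only [hd, hs i₃ i₂, hs i₅ i₂, hs i₅ i₃, hs i₅ i₄, Algebra.smul_def, map_add, map_sub, map_mul, map_pow, map_one,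
    map_ofNat]
  ring

theorem five₃ (hs : ∀ i j, s i j = s j i) {i₁ i₂ i₃ i₄ i₅ : Fin n}
    (h : CyclicOrder [i₁, i₂, i₃, i₄, i₅]) :
    ClassicalFromQuantized β t s s₃ i₁ i₃ i₄ i₂ i₃ i₅ := by
  refine ⟨_, _, .five₃ i₁ i₂ i₃ i₄ i₅ h, fun d hd => .inl ?_⟩
  simp only [hd, hs i₃ i₂, hs i₄ i₂, hs i₄ i₃, Algebra.smul_def, map_add, map_sub, map_mul, map_pow, map_one,
    map_ofNat]
  ring

theorem four₁ (hs : ∀ i j, s i j = s j i) {i₁ i₂ i₃ i₄ : Fin n}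
    (h : CyclicOrder [i₁, i₂, i₃, i₄]) :
    ClassicalFromQuantized β t s s₃ i₁ i₂ i₃ i₂ i₃ i₄ := by
  refine ⟨_, _, .four₁ i₁ i₂ i₃ i₄ h, fun d hd => .inl ?_⟩
  simp only [hd, hs i₃ i₂, Algebra.smul_def, map_add, map_sub, map_mul, map_pow, map_one,
    map_ofNat]
  ring

theorem four₂ (hs : ∀ i j, s i j = s j i) {i₁ i₂ i₃ i₄ : Fin n}
    (h : CyclicOrder [i₁, i₂, i₃, i₄]) :
    ClassicalFromQuantized β t s s₃ i₁ i₂ i₃ i₁ i₃ i₄ := by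
  refine ⟨_, _, .four₂ i₁ i₂ i₃ i₄ h, fun d hd => .inl ?_⟩
  simp only [hd, hs i₂ i₁, hs i₃ i₁, Algebra.smul_def, map_add, map_sub, map_mul, map_pow, map_one,
    map_ofNat]
  ring

theorem three (hs : ∀ i j, s i j = s j i) {i₁ i₂ i₃ : Fin n}
    (h : CyclicOrder [i₁, i₂, i₃]) :
    ClassicalFromQuantized β t s s₃ i₁ i₂ i₃ i₁ i₂ i₃ := by
  refine ⟨_, _, .three i₁ i₂ i₃ h, fun d hd => .inl ?_⟩
  simp only [hd, hs i₂ i₁, hs i₃ i₁, hs i₃ i₂, Algebra.smul_def, map_add, map_sub, map_mul, map_pow, map_one,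
    map_ofNat]
  ring

end ClassicalFromQuantized

theorem CyclicOrder.of_isChain {l : List (Fin n)} (k : ℕ) (h : (l.rotate k).IsChain (· < ·)) :
    CyclicOrder l := ⟨k, List.isChain_iff_pairwise.1 h⟩

open ClassicalFromQuantized in
-- All ways of merging the two triples, coincidences included, are run through. On a circle the
-- merged indices form one of the nine patterns above, up to rotation and exchange of the triples.
-- Rotating the circle permutes each triple cyclically, which the `rotate` lemmas undo; the number
-- given to `CyclicOrder.of_isChain` is the rotation that sorts the indices of the pattern.
theorem classicalFromQuantized {β : R} {t : Fin n → A} {s : Fin n → Fin n → A}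
    {s₃ : Fin n → Fin n → Fin n → A} (hs : ∀ i j, s i j = s j i)
    (hs₃ : ∀ i j k, s₃ i j k = s₃ j k i) {a₁ a₂ a₃ b₁ b₂ b₃ : Fin n} (ha₁ : a₁ < a₂) (ha₂ : a₂ < a₃)
    (hb₁ : b₁ < b₂) (hb₂ : b₂ < b₃) : ClassicalFromQuantized β t s s₃ a₁ a₂ a₃ b₁ b₂ b₃ := by
  rcases lt_trichotomy a₁ b₁ with h₁₁ | rfl | h₁₁
  · rcases lt_trichotomy a₂ b₁ with h₂₁ | rfl | h₂₁
    · rcases lt_trichotomy a₃ b₁ with h₃₁ | rfl | h₃₁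
      · exact six₂ (.of_isChain 0 (by simp [*]))
      · exact five₁ (.of_isChain 0 (by simp [*]))
      · rcases lt_trichotomy a₃ b₂ with h₃₂ | rfl | h₃₂
        · exact six₃ hs (.of_isChain 0 (by simp [*]))
        · exact ((five₂ hs (.of_isChain 4 (by simp [*]))).rotate_left hs₃).rotate_left hs₃
        · rcases lt_trichotomy a₃ b₃ with h₃₃ | rfl | h₃₃
          · exact ((six₃ hs (.of_isChain 4 (by simp [*]))).rotate_right hs₃).swap hs
          · exact ((five₁ (.of_isChain 3 (by simp [*]))).rotate_right hs₃).swap hs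
          · exact (six₂ (.of_isChain 1 (by simp [*]))).rotate_left hs₃
    · rcases lt_trichotomy a₃ b₂ with h₃₂ | rfl | h₃₂
      · exact ((five₂ hs (.of_isChain 1 (by simp [*]))).rotate_left hs₃).swap hs
      · exact four₁ hs (.of_isChain 0 (by simp [*]))
      · rcases lt_trichotomy a₃ b₃ with h₃₃ | rfl | h₃₃
        · exact ((five₃ hs (.of_isChain 1 (by simp [*]))).rotate_left hs₃).swap hs
        · exact ((four₂ hs (.of_isChain 1 (by simp [*]))).rotate_left hs₃).rotate_right hs₃
        · exact (five₁ (.of_isChain 1 (by simp [*]))).rotate_left hs₃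
    · rcases lt_trichotomy a₂ b₂ with h₂₂ | rfl | h₂₂
      · rcases lt_trichotomy a₃ b₂ with h₃₂ | rfl | h₃₂
        · exact (((six₃ hs (.of_isChain 2 (by simp [*]))).rotate_left hs₃).rotate_left hs₃).swap hs
        · exact (((five₃ hs (.of_isChain 4 (by simp [*]))).rotate_right hs₃).rotate_right hs₃).swap hs
        · rcases lt_trichotomy a₃ b₃ with h₃₃ | rfl | h₃₃
          · exact six₄ hs (.of_isChain 0 (by simp [*]))
          · exact ((((five₃ hs (.of_isChain 3 (by simp [*]))).rotate_left hs₃).rotate_left hs₃).rotate_right hs₃).rotate_right hs₃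
          · exact (six₃ hs (.of_isChain 1 (by simp [*]))).rotate_left hs₃
      · rcases lt_trichotomy a₃ b₃ with h₃₃ | rfl | h₃₃
        · exact five₃ hs (.of_isChain 0 (by simp [*]))
        · exact (((four₁ hs (.of_isChain 3 (by simp [*]))).rotate_right hs₃).rotate_right hs₃).swap hs
        · exact five₂ hs (.of_isChain 0 (by simp [*]))
      · rcases lt_trichotomy a₂ b₃ with h₂₃ | rfl | h₂₃
        · rcases lt_trichotomy a₃ b₃ with h₃₃ | rfl | h₃₃
          · exact (((six₃ hs (.of_isChain 3 (by simp [*]))).rotate_left hs₃).rotate_left hs₃).rotate_right hs₃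
          · exact (((((five₂ hs (.of_isChain 3 (by simp [*]))).rotate_left hs₃).rotate_left hs₃).rotate_right hs₃).rotate_right hs₃).swap hs
          · exact (((six₃ hs (.of_isChain 5 (by simp [*]))).rotate_right hs₃).rotate_right hs₃).swap hs
        · exact (((five₁ (.of_isChain 4 (by simp [*]))).rotate_right hs₃).rotate_right hs₃).swap hs
        · exact ((six₂ (.of_isChain 2 (by simp [*]))).rotate_left hs₃).rotate_left hs₃
  · rcases lt_trichotomy a₂ b₂ with h₂₂ | rfl | h₂₂
    · rcases lt_trichotomy a₃ b₂ with h₃₂ | rfl | h₃₂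
      · exact (((five₁ (.of_isChain 2 (by simp [*]))).rotate_left hs₃).rotate_left hs₃).swap hs
      · exact four₂ hs (.of_isChain 0 (by simp [*]))
      · rcases lt_trichotomy a₃ b₃ with h₃₃ | rfl | h₃₃
        · exact ((five₃ hs (.of_isChain 2 (by simp [*]))).rotate_left hs₃).rotate_right hs₃
        · exact ((((four₁ hs (.of_isChain 2 (by simp [*]))).rotate_left hs₃).rotate_left hs₃).rotate_right hs₃).swap hs
        · exact (((five₂ hs (.of_isChain 2 (by simp [*]))).rotate_left hs₃).rotate_right hs₃).swap hs
    · rcases lt_trichotomy a₃ b₃ with h₃₃ | rfl | h₃₃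
      · exact ((four₁ hs (.of_isChain 1 (by simp [*]))).rotate_left hs₃).swap hs
      · exact three hs (.of_isChain 0 (by simp [*]))
      · exact (four₁ hs (.of_isChain 1 (by simp [*]))).rotate_left hs₃
    · rcases lt_trichotomy a₂ b₃ with h₂₃ | rfl | h₂₃
      · rcases lt_trichotomy a₃ b₃ with h₃₃ | rfl | h₃₃
        · exact ((five₂ hs (.of_isChain 2 (by simp [*]))).rotate_left hs₃).rotate_right hs₃
        · exact (((four₁ hs (.of_isChain 2 (by simp [*]))).rotate_left hs₃).rotate_left hs₃).rotate_right hs₃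
        · exact (((five₃ hs (.of_isChain 2 (by simp [*]))).rotate_left hs₃).rotate_right hs₃).swap hs
      · exact (four₂ hs (.of_isChain 0 (by simp [*]))).swap hs
      · exact ((five₁ (.of_isChain 2 (by simp [*]))).rotate_left hs₃).rotate_left hs₃
  · rcases lt_trichotomy a₁ b₂ with h₁₂ | rfl | h₁₂
    · rcases lt_trichotomy a₂ b₂ with h₂₂ | rfl | h₂₂
      · rcases lt_trichotomy a₃ b₂ with h₃₂ | rfl | h₃₂
        · exact ((six₂ (.of_isChain 5 (by simp [*]))).rotate_right hs₃).rotate_right hs₃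
        · exact ((five₁ (.of_isChain 4 (by simp [*]))).rotate_right hs₃).rotate_right hs₃
        · rcases lt_trichotomy a₃ b₃ with h₃₃ | rfl | h₃₃
          · exact ((six₃ hs (.of_isChain 5 (by simp [*]))).rotate_right hs₃).rotate_right hs₃
          · exact ((((five₂ hs (.of_isChain 3 (by simp [*]))).rotate_left hs₃).rotate_left hs₃).rotate_right hs₃).rotate_right hs₃
          · exact ((((six₃ hs (.of_isChain 3 (by simp [*]))).rotate_left hs₃).rotate_left hs₃).rotate_right hs₃).swap hs
      · rcases lt_trichotomy a₃ b₃ with h₃₃ | rfl | h₃₃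
        · exact (five₂ hs (.of_isChain 0 (by simp [*]))).swap hs
        · exact ((four₁ hs (.of_isChain 3 (by simp [*]))).rotate_right hs₃).rotate_right hs₃
        · exact (five₃ hs (.of_isChain 0 (by simp [*]))).swap hs
      · rcases lt_trichotomy a₂ b₃ with h₂₃ | rfl | h₂₃
        · rcases lt_trichotomy a₃ b₃ with h₃₃ | rfl | h₃₃
          · exact ((six₃ hs (.of_isChain 1 (by simp [*]))).rotate_left hs₃).swap hs
          · exact (((((five₃ hs (.of_isChain 3 (by simp [*]))).rotate_left hs₃).rotate_left hs₃).rotate_right hs₃).rotate_right hs₃).swap hs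
          · exact (six₄ hs (.of_isChain 0 (by simp [*]))).swap hs
        · exact ((five₃ hs (.of_isChain 4 (by simp [*]))).rotate_right hs₃).rotate_right hs₃
        · exact ((six₃ hs (.of_isChain 2 (by simp [*]))).rotate_left hs₃).rotate_left hs₃
    · rcases lt_trichotomy a₂ b₃ with h₂₃ | rfl | h₂₃
      · rcases lt_trichotomy a₃ b₃ with h₃₃ | rfl | h₃₃
        · exact ((five₁ (.of_isChain 1 (by simp [*]))).rotate_left hs₃).swap hs
        · exact ((four₂ hs (.of_isChain 3 (by simp [*]))).rotate_right hs₃).rotate_right hs₃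
        · exact (five₃ hs (.of_isChain 1 (by simp [*]))).rotate_left hs₃
      · exact (four₁ hs (.of_isChain 0 (by simp [*]))).swap hs
      · exact (five₂ hs (.of_isChain 1 (by simp [*]))).rotate_left hs₃
    · rcases lt_trichotomy a₁ b₃ with h₁₃ | rfl | h₁₃
      · rcases lt_trichotomy a₂ b₃ with h₂₃ | rfl | h₂₃
        · rcases lt_trichotomy a₃ b₃ with h₃₃ | rfl | h₃₃
          · exact (six₂ (.of_isChain 4 (by simp [*]))).rotate_right hs₃
          · exact (five₁ (.of_isChain 3 (by simp [*]))).rotate_right hs₃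
          · exact (six₃ hs (.of_isChain 4 (by simp [*]))).rotate_right hs₃
        · exact (((five₂ hs (.of_isChain 4 (by simp [*]))).rotate_left hs₃).rotate_left hs₃).swap hs
        · exact (six₃ hs (.of_isChain 0 (by simp [*]))).swap hs
      · exact (five₁ (.of_isChain 0 (by simp [*]))).swap hs
      · exact six₂ (.of_isChain 3 (by simp [*]))

end Classical

theorem sPair_comm {R A : Type*} [CommRing R] [CommRing A] [Algebra R A] {n : ℕ} (α β : R)
    (t : Finset (Fin n) → A) (i j : Fin n) : sPair α β t i j = sPair α β t j i := by
  by_cases h : i = j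
  · rw [h]
  · rw [sPair, sPair, if_neg h, if_neg (Ne.symm h), Finset.pair_comm, mul_comm]

theorem sTriple_rotate {R A : Type*} [CommRing R] [CommRing A] [Algebra R A] {n : ℕ} (β : R)
    (t : Finset (Fin n) → A) (i j k : Fin n) : sTriple β t i j k = sTriple β t j k i := by
  have h : ({j, k, i} : Finset (Fin n)) = {i, j, k} := by
    ext
    simp only [Finset.mem_insert, Finset.mem_singleton]
    tauto
  have e : t {i} * t {j} * t {k} = t {j} * t {k} * t {i} := by ring
  rw [sTriple, sTriple, h, Finset.pair_comm j i, Finset.pair_comm k i, e]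
  congr 3
  ring

/-- For commuting variables and `q = 1`, the classical relations of type I are quantized ones. -/
theorem exists_typeIRelation_classical {R A : Type*} [CommRing R] [CommRing A] [Algebra R A] {n : ℕ}
    (α β : R) (t : Finset (Fin n) → A) (a b : Fin 3 → Fin n) (ha : StrictMono a)
    (hb : StrictMono b) :
    ∃ x y : A, TypeIRelation (1 : R) 1 β (fun i => t {i}) (sPair α β t) (sTriple β t) x y ∧
      (x - y = 2 * sTriple β t (a 0) (a 1) (a 2) * sTriple β t (b 0) (b 1) (b 2)
          - Matrix.det (Matrix.of fun i j => sPair α β t (a i) (b j)) ∨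
       y - x = 2 * sTriple β t (a 0) (a 1) (a 2) * sTriple β t (b 0) (b 1) (b 2)
          - Matrix.det (Matrix.of fun i j => sPair α β t (a i) (b j))) := by
  obtain ⟨x, y, h, hd⟩ := classicalFromQuantized (β := β) (t := fun i => t {i})
    (sPair_comm α β t) (sTriple_rotate β t) (a₁ := a 0) (a₂ := a 1) (a₃ := a 2) (b₁ := b 0)
    (b₂ := b 1) (b₃ := b 2) (ha (by decide)) (ha (by decide)) (hb (by decide)) (hb (by decide))
  refine ⟨x, y, h, hd _ ?_⟩
  rw [Matrix.det_fin_three]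
  simp only [Matrix.of_apply]

theorem map_sPair {R A B : Type*} [CommRing R] [Ring A] [Algebra R A] [Ring B] [Algebra R B]
    {n : ℕ} (φ : A →ₐ[R] B) (α β : R) (t : Finset (Fin n) → A) (i j : Fin n) :
    φ (sPair α β t i j) = sPair α β (fun S => φ (t S)) i j := by
  by_cases h : i = j <;> simp [sPair, h]

theorem map_sTriple {R A B : Type*} [CommRing R] [Ring A] [Algebra R A] [Ring B] [Algebra R B]
    {n : ℕ} (φ : A →ₐ[R] B) (β : R) (t : Finset (Fin n) → A) (i j k : Fin n) :
    φ (sTriple β t i j k) = sTriple β (fun S => φ (t S)) i j k := by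
  simp [sTriple]

/-! ### The classical relations in the skein algebra. -/

namespace SkeinAlgebra

variable {R : Type*} [CommRing R] {r : Rˣ} {n : ℕ}

open scoped IsMulCommutative in
/-- For `q = 1` the classical relations of type I hold in the skein algebra. -/
theorem classical_typeI (hr : r ^ 2 = 1) {β : R} (hβ : qTwo r * β = 1) {a b : Fin 3 → Fin n}
    (ha : StrictMono a) (hb : StrictMono b) :
    2 * (sTriple β (t r) (a 0) (a 1) (a 2) * sTriple β (t r) (b 0) (b 1) (b 2)) =
      ∑ σ : Equiv.Perm (Fin 3), ((Equiv.Perm.sign σ : ℤˣ) : ℤ) •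
        (sPair (qTwo r) β (t r) (a 0) (b (σ 0)) * sPair (qTwo r) β (t r) (a 1) (b (σ 1))
          * sPair (qTwo r) β (t r) (a 2) (b (σ 2))) := by
  have hr' : r⁻¹ = r := by rw [inv_eq_iff_mul_eq_one, ← pow_two, hr]
  have h1 : (r : R) ^ 2 = 1 := by rw [← Units.val_pow_eq_pow_val, hr, Units.val_one]
  -- The comparison with determinants needs a commutative algebra; the subalgebra generated by the
  -- curves is one for q = 1.
  let A := Algebra.adjoin R (Set.range (t r (n := n)))
  have : IsMulCommutative A := Algebra.isMulCommutative_adjoin R (by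
    rintro _ ⟨S, rfl⟩ _ ⟨T, rfl⟩
    exact commute_t hr' S T)
  let u (S : Finset (Fin n)) : A := ⟨t r S, Algebra.subset_adjoin ⟨S, rfl⟩⟩
  obtain ⟨x, y, h, hd⟩ := exists_typeIRelation_classical (qTwo r) β u a b ha hb
  have hp (i j : Fin n) : A.val (sPair (qTwo r) β u i j) = sPair (qTwo r) β (t r) i j :=
    map_sPair A.val (qTwo r) β u i j
  have ht (i j k : Fin n) : A.val (sTriple β u i j k) = sTriple β (t r) i j k :=
    map_sTriple A.val β u i j k
  have h' := h.map A.val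
  simp only [hp, ht] at h'
  have hxy : x = y := Subtype.ext (eq_of_typeIRelation hβ (by rw [hr', h1]; exact h'))
  -- The expansion of a determinant permutes the row index; transposing first lets the permutation
  -- act on b and leaves the factors in the order of a.
  rw [hxy, sub_self, or_self, eq_comm, sub_eq_zero, ← Matrix.det_transpose, Matrix.det_apply,
    mul_assoc] at hd
  have := congrArg A.val hd
  simp only [map_mul, map_sum, map_ofNat, Units.smul_def, map_zsmul, hp, ht,
    Fin.prod_univ_three, Matrix.transpose_apply, Matrix.of_apply] at this
  exact this

end SkeinAlgebra

/-! ### The main theorem. -/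

theorem mainTheorem7 {R : Type*} [CommRing R] (r q : Rˣ) (hq : q = r ^ 2)
    (α β : R) (hα : α = (q : R) + ((q⁻¹ : Rˣ) : R)) (hβ : α * β = 1) (n : ℕ) :
    -- the identities hold in the skein algebra
    (∀ x y : SkeinAlgebra r n,
      TypeIRelation (q : R) ((q⁻¹ : Rˣ) : R) β (fun i => SkeinAlgebra.t r {i})
        (sPair α β (SkeinAlgebra.t r)) (sTriple β (SkeinAlgebra.t r)) x y → x = y) ∧
    -- so do their mirrors: `q` is replaced by `q⁻¹` and all products are reversed
    (∀ x y : (SkeinAlgebra r n)ᵐᵒᵖ,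
      TypeIRelation ((q⁻¹ : Rˣ) : R) (q : R) β (fun i => MulOpposite.op (SkeinAlgebra.t r {i}))
        (fun i j => MulOpposite.op (sPair α β (SkeinAlgebra.t r) i j))
        (fun i j k => MulOpposite.op (sTriple β (SkeinAlgebra.t r) i j k)) x y → x = y) ∧
    -- for `q = 1` every classical relation of type I is, for commuting variables, one of them
    (q = 1 → ∀ (A : Type*) [CommRing A] [Algebra R A] (t : Finset (Fin n) → A)
      (a b : Fin 3 → Fin n), StrictMono a → StrictMono b →
      ∃ x y : A, TypeIRelation (q : R) ((q⁻¹ : Rˣ) : R) β (fun i => t {i})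
          (sPair α β t) (sTriple β t) x y ∧
        (x - y = 2 * sTriple β t (a 0) (a 1) (a 2) * sTriple β t (b 0) (b 1) (b 2)
            - Matrix.det (Matrix.of fun i j => sPair α β t (a i) (b j)) ∨
         y - x = 2 * sTriple β t (a 0) (a 1) (a 2) * sTriple β t (b 0) (b 1) (b 2)
            - Matrix.det (Matrix.of fun i j => sPair α β t (a i) (b j)))) ∧
    -- and the classical relations of type I hold in the skein algebra for `q = 1`
    (q = 1 → ∀ a b : Fin 3 → Fin n, StrictMono a → StrictMono b →
      2 * (sTriple β (SkeinAlgebra.t r) (a 0) (a 1) (a 2)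
          * sTriple β (SkeinAlgebra.t r) (b 0) (b 1) (b 2)) =
        ∑ σ : Equiv.Perm (Fin 3), ((Equiv.Perm.sign σ : ℤˣ) : ℤ) •
          (sPair α β (SkeinAlgebra.t r) (a 0) (b (σ 0))
            * sPair α β (SkeinAlgebra.t r) (a 1) (b (σ 1))
            * sPair α β (SkeinAlgebra.t r) (a 2) (b (σ 2)))) := by
  subst hq
  obtain rfl : α = SkeinAlgebra.qTwo r := hα
  refine ⟨fun x y h => SkeinAlgebra.eq_of_typeIRelation hβ (by simpa using h),
    fun x y h => SkeinAlgebra.eq_of_typeIRelation_mirror hβ (by simpa using h),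
    fun hr A _ _ t a b ha hb => ?_, fun hr a b ha hb => SkeinAlgebra.classical_typeI hr hβ ha hb⟩
  rw [hr, inv_one, Units.val_one]
  exact exists_typeIRelation_classical _ β t a b ha hb
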